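/- Let $U$ and $W$ be two disjoint sets of $n$ agents each. A preference profile $P$ gives each agent $x$ a strict linear order $\succ_x$ on a subset of the opposite set (the agents acceptable to $x$). The rank $\mathsf{rk}_x(y)$ of an acceptable agent $y$ is the number of agents that $x$ prefers to $y$. A matching $M$ is a set of pairwise disjoint pairs $\{u,w\}$ with $u\in U$, $w\in W$; it is perfect if every agent is in a pair. $M$ is stable in $P$ if each of its pairs is mutually acceptable and there is no blocking pair, i.e. no mutually acceptable pair $\{u,w\}\notin M$ such that each of $u$ and $w$ is unmatched in $M$ or prefers the other one to its partner in $M$. The swap distance $\tau(P,P')$ of two profiles is the sum, over all agents, of the number of pairs that are ordered differently in the agent's two lists (infinite if the two acceptable sets of some agent differ). For $d\in\mathbb{N}$, a matching is $d$-robust for $P$ if it is stable in every profile $P'$ with $\tau(P,P')\le d$. The egalitarian cost of $M$ is $\sum_{x\in U\cup W}\mathsf{rk}_x(M(x))$, where an unmatched agent contributes the number of its acceptable agents. **Theorem.** Each of the following two search problems is solvable in polynomial time: given a preference profile $P$ with $n$ agents on each side and $d\in\mathbb{N}$, 1. find a $d$-robust perfect matching for $P$, or report that none exists; 2. find a $d$-robust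 matching for $P$ whose egalitarian cost is minimum among all $d$-robust matchings for $P$, or report that no $d$-robust matching exists. That is, for each of the two problems there is one program for a random access machine (unit-cost addition, truncated subtraction, zero tests and indirect access to memory tables; no multiplication) and a polynomial $T$ such that on every input $(P,d)$ the program halts after at most $T(n)$ steps with a correct answer. -/

import Mathlib

/-! ## Preference profiles, stable matchings, robustness -/

/-- A preference list over `n` agents of the opposite side: a linear order on a subset of them,
written as a list without repetitions, most preferred agent first. The members of the list are the
acceptable agents. -/
abbrev PrefList (n : ℕ) : Type := {l : List (Fin n) // l.Nodup}

namespace PrefList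

variable {n : ℕ}

/-- `y` is acceptable to the owner of the list. -/
abbrev Accepts (l : PrefList n) (y : Fin n) : Prop := y ∈ l.1

/-- The rank of `y`: the number of agents preferred to `y`. If `y` is not acceptable, this is the
number of acceptable agents (`List.idxOf` returns the length of the list in that case). -/
def rank (l : PrefList n) (y : Fin n) : ℕ := l.1.idxOf y

/-- The owner of the list ranks both `x` and `y`, and prefers `x` to `y`. -/
abbrev Prefers (l : PrefList n) (x y : Fin n) : Prop :=
  l.Accepts x ∧ l.Accepts y ∧ l.rank x < l.rank y

/-- The swap distance (Kendall tau distance): the number of pairs that are ordered differently by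
the two lists (each unordered pair is counted once, named in the order of the first list), and
infinity if the acceptable sets differ. -/
def swapDist (l l' : PrefList n) : ℕ∞ :=
  if ∀ x, l.Accepts x ↔ l'.Accepts x then
    ((Finset.univ.filter fun p : Fin n × Fin n =>
      l.Prefers p.1 p.2 ∧ l'.Prefers p.2 p.1).card : ℕ∞)
  else ⊤

/-- The rank of the partner, where an unmatched agent contributes the number of her acceptable
agents. -/
def partnerRank (l : PrefList n) : Option (Fin n) → ℕ
  | none => l.1.length
  | some y => l.rank y

end PrefList

/-- A preference profile (no ties, possibly incomplete lists) for two disjoint sets `U` and `W` of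
`n` agents each; both sets are indexed by `Fin n`. -/
structure PrefProfile (n : ℕ) where
  /-- The preference lists of the agents in `U`. -/
  prefU : Fin n → PrefList n
  /-- The preference lists of the agents in `W`. -/
  prefW : Fin n → PrefList n

/-- A set of pairwise disjoint pairs from `U × W`, as a partial bijection: `w ∈ M u` says that
`u` and `w` are matched, `M u = none` that `u` is unmatched; `M.symm` gives the partners of the
agents in `W`. -/
abbrev Matching (n : ℕ) : Type := Fin n ≃. Fin n

namespace PrefProfile

variable {n : ℕ}

/-- The swap distance between two profiles: the sum over all agents. -/
def swapDist (P Q : PrefProfile n) : ℕ∞ :=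
  ∑ u, (P.prefU u).swapDist (Q.prefU u) + ∑ w, (P.prefW w).swapDist (Q.prefW w)

/-- `u` and `w` find each other acceptable. -/
def Mutual (P : PrefProfile n) (u w : Fin n) : Prop :=
  (P.prefU u).Accepts w ∧ (P.prefW w).Accepts u

/-- `{u, w}` blocks `M`: both find each other acceptable, they are not matched together, and each
of them is unmatched or ranks the other one higher than the current partner. -/
def Blocking (P : PrefProfile n) (M : Matching n) (u w : Fin n) : Prop :=
  P.Mutual u w ∧ w ∉ M u ∧
    (∀ w', w' ∈ M u → (P.prefU u).rank w < (P.prefU u).rank w') ∧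
    (∀ u', u' ∈ M.symm w → (P.prefW w).rank u < (P.prefW w).rank u')

/-- `M` is stable: it matches only pairs who find each other acceptable, and it has no blocking
pair. -/
def Stable (P : PrefProfile n) (M : Matching n) : Prop :=
  (∀ u w, w ∈ M u → P.Mutual u w) ∧ ∀ u w, ¬ P.Blocking M u w

/-- `M` is `d`-robust: it is stable in every profile at swap distance at most `d`. -/
def Robust (P : PrefProfile n) (d : ℕ) (M : Matching n) : Prop :=
  ∀ Q : PrefProfile n, P.swapDist Q ≤ (d : ℕ∞) → Q.Stable M

/-- The egalitarian cost: the sum over all agents of the rank of the partner. -/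
def egalCost (P : PrefProfile n) (M : Matching n) : ℕ :=
  ∑ u, (P.prefU u).partnerRank (M u) + ∑ w, (P.prefW w).partnerRank (M.symm w)

/-- `M` is `d`-robust and has minimum egalitarian cost among all `d`-robust matchings. -/
def IsMinEgalRobust (P : PrefProfile n) (d : ℕ) (M : Matching n) : Prop :=
  P.Robust d M ∧ ∀ M' : Matching n, P.Robust d M' → P.egalCost M ≤ P.egalCost M'

end PrefProfile

/-- Every agent has a partner. -/
def Matching.Perfect {n : ℕ} (M : Matching n) : Prop :=
  (∀ u, ∃ w, w ∈ M u) ∧ ∀ w, ∃ u, u ∈ M.symm w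

/-! ## Random access machine programs and their running time

Programs work on natural numbers held in variables and in tables with two indices, all named by
numerals that are fixed in the program text; table cells are addressed by computed indices. The
only arithmetic is addition and truncated subtraction, at unit cost (there is no multiplication),
so within `t` steps numbers only grow by `O(t)` bits, and polynomial time is the same as on Turing
machines. -/

namespace RAM

/-- The memory. -/
structure Store where
  /-- The content of the variables. -/
  var : ℕ → ℕ
  /-- `tab t i j` is the content of the cell in row `i` and column `j` of table `t`. -/
  tab : ℕ → ℕ → ℕ → ℕ

/-- Assign `v` to variable `x`. -/
def Store.setVar (σ : Store) (x v : ℕ) : Store :=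
  { σ with var := fun y => if y = x then v else σ.var y }

/-- Write `v` into the cell `(i, j)` of table `t`. -/
def Store.setTab (σ : Store) (t i j v : ℕ) : Store :=
  { σ with tab := fun t' i' j' => if t' = t ∧ i' = i ∧ j' = j then v else σ.tab t' i' j' }

/-- Arithmetic terms. -/
inductive Term : Type
  | const (k : ℕ)
  | var (x : ℕ)
  | cell (t : ℕ) (i j : Term)
  | add (a b : Term)
  | sub (a b : Term)

/-- The value of a term. -/
def Term.eval (σ : Store) : Term → ℕ
  | const k => k
  | var x => σ.var x
  | cell t i j => σ.tab t (i.eval σ) (j.eval σ)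
  | add a b => a.eval σ + b.eval σ
  | sub a b => a.eval σ - b.eval σ

/-- The number of steps to evaluate a term: one for each constant, variable, table access,
addition and subtraction in it. -/
def Term.cost : Term → ℕ
  | const _ => 1
  | var _ => 1
  | cell _ i j => i.cost + j.cost + 1
  | add a b => a.cost + b.cost + 1
  | sub a b => a.cost + b.cost + 1

/-- Programs. A test succeeds if its term is nonzero. -/
inductive Prog : Type
  | skip
  | assign (x : ℕ) (a : Term)
  | write (t : ℕ) (i j a : Term)
  | seq (p q : Prog)
  | ite (b : Term) (p q : Prog)
  | while (b : Term) (p : Prog)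

/-- `Run p σ t σ'`: program `p`, started in the memory `σ`, halts after exactly `t` steps with the
memory `σ'`. -/
inductive Run : Prog → Store → ℕ → Store → Prop
  | skip (σ : Store) : Run .skip σ 1 σ
  | assign (σ : Store) (x : ℕ) (a : Term) :
      Run (.assign x a) σ (a.cost + 1) (σ.setVar x (a.eval σ))
  | write (σ : Store) (t : ℕ) (i j a : Term) :
      Run (.write t i j a) σ (i.cost + j.cost + a.cost + 1)
        (σ.setTab t (i.eval σ) (j.eval σ) (a.eval σ))
  | seq {p q : Prog} {σ₀ σ₁ σ₂ : Store} {s t : ℕ} (hp : Run p σ₀ s σ₁) (hq : Run q σ₁ t σ₂) :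
      Run (.seq p q) σ₀ (s + t) σ₂
  | ite_true {b : Term} {p q : Prog} {σ σ' : Store} {t : ℕ} (hb : b.eval σ ≠ 0)
      (hp : Run p σ t σ') : Run (.ite b p q) σ (b.cost + 1 + t) σ'
  | ite_false {b : Term} {p q : Prog} {σ σ' : Store} {t : ℕ} (hb : b.eval σ = 0)
      (hq : Run q σ t σ') : Run (.ite b p q) σ (b.cost + 1 + t) σ'
  | while_true {b : Term} {p : Prog} {σ₀ σ₁ σ₂ : Store} {s t : ℕ} (hb : b.eval σ₀ ≠ 0)
      (hp : Run p σ₀ s σ₁) (hw : Run (.while b p) σ₁ t σ₂) :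
      Run (.while b p) σ₀ (b.cost + 1 + s + t) σ₂
  | while_false {b : Term} {p : Prog} {σ : Store} (hb : b.eval σ = 0) :
      Run (.while b p) σ (b.cost + 1) σ

/-- The `j`-th entry of a preference list as it is written in memory: `w + 1` for the agent with
index `w`, and `0` beyond the end of the list. -/
def entry {n : ℕ} (l : PrefList n) (j : ℕ) : ℕ :=
  match l.1[j]? with
  | none => 0
  | some y => (y : ℕ) + 1

/-- The input `(P, d)` in memory: variable `0` holds `n`, variable `1` holds `d`, row `i` of table
`0` (of table `1`) holds the preference list of the `i`-th agent of `U` (of `W`), and everything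
else is `0`. -/
def inputStore {n : ℕ} (P : PrefProfile n) (d : ℕ) : Store where
  var x := if x = 0 then n else if x = 1 then d else 0
  tab t i j :=
    if h : i < n then
      if t = 0 then entry (P.prefU ⟨i, h⟩) j
      else if t = 1 then entry (P.prefW ⟨i, h⟩) j
      else 0
    else 0

/-- The memory reports the matching `M`: variable `0` is `1`, and cell `u` of row `0` of table `2`
holds `w + 1` if `M` matches `u` with `w`, and `0` if `u` is unmatched. -/
def Reports {n : ℕ} (σ : Store) (M : Matching n) : Prop :=
  σ.var 0 = 1 ∧ ∀ u : Fin n, σ.tab 2 0 u =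
    match M u with
    | none => 0
    | some w => (w : ℕ) + 1

/-- The memory reports that there is no solution: variable `0` is `0`. -/
def ReportsNone (σ : Store) : Prop := σ.var 0 = 0

/-- The search problem "given a profile `P` for `2n` agents and `d`, find a matching `M` with
`S P d M`" is solvable in polynomial time: one program, for all inputs, halts within a number of
steps that is polynomial in `n`, having found a solution if there is one and having reported that
there is none otherwise. -/
def SolvableInPolyTime
    (S : ∀ {n : ℕ}, PrefProfile n → ℕ → Matching n → Prop) : Prop :=
  ∃ (p : Prog) (T : Polynomial ℕ), ∀ (n : ℕ) (P : PrefProfile n) (d : ℕ),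
    ∃ (t : ℕ) (σ : Store), Run p (inputStore P d) t σ ∧ t ≤ T.eval n ∧
      ((∃ M : Matching n, S P d M ∧ Reports σ M) ∨
        ((¬ ∃ M : Matching n, S P d M) ∧ ReportsNone σ))

end RAM

/-! Letting an acceptable agent overtake a preferred one costs, in swaps, exactly the difference of
their ranks (`le_swapDist`, `exists_swapDist_le`). For a pair `{u, w}` let the margin of each agent
be the amount by which it ranks the other below its partner, truncated at `0`. A matching of
mutually acceptable pairs is then `d`-robust iff for every other mutually acceptable pair the two
margins add up to more than `d` (`robust_iff`).

This condition supports a version of deferred acceptance. Keep a lower bound `x u` on the rank of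
the partner of `u` in every robust matching, possibly one that avoids given forbidden pairs. If `w`
is in position `x u`, but some `u'`, even when placed at `x u'`, needs at most `d` swaps to block
with `w`, then `u` and `w` are never partners and `x u` can grow (`lt_posU_of_rejected`). When
nothing can grow, the positions describe a matching, which is robust if any admissible robust
matching exists (`Stuck.exists_robust`, `Stuck.covered`), and it is the least one. All robust
matchings match the same agents, so the least one already decides the existence of a perfect one.

For the egalitarian cost, giving each `u` the worse of its partners in two robust matchings is again
robust, and leaves every `w` at least as well off as in both (`Robust.exists_sup`). Consider the
bounds "`w` gets a partner of rank at most `j`". A robust matching that obeys a bound places `U` no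
higher than the least such matching does. Up to a constant, the cost of a robust matching is the
number of steps by which `U` descends below the least robust matching, minus the number of bounds
obeyed (`sum_posU_eq`, `Robust.card_bounds_add`). So one looks for a set `Y` of bounds that
maximizes `|Y|` minus the number of steps required by `Y`; the join of the least matchings for the
bounds in `Y` realizes it. By König's argument an optimal `Y` consists of the bounds reachable by
alternating paths from the unmatched ones, for a maximum matching of bounds with required steps
(`MatchingCert.card_add_card_le`, `exists_isMinEgalRobust`).

The algorithms are written in a language whose loops and sums run only up to `n` or `n * n`. Their
running time is then polynomial by syntax alone (`Stmt.comp_run`), and their correctness concerns a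
total function on memories. -/

/-! ## A loop language with sums, and its compilation to random access machine programs -/

namespace RAM

/-- Arithmetic expressions with bounded sums. Summation indices are de Bruijn indices. -/
inductive Exp : Type
  | const (k : ℕ)
  | var (x : ℕ)
  | bvar (i : ℕ)
  | cell (t : ℕ) (i j : Exp)
  | add (a b : Exp)
  | sub (a b : Exp)
  | sum (b : ℕ) (a : Exp)

/-- The value of an expression, where `ρ` lists the values of the summation indices. -/
def Exp.eval (σ : Store) : Exp → List ℕ → ℕ
  | const k, _ => k
  | var x, _ => σ.var x
  | bvar i, ρ => ρ.getD i 0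
  | cell t i j, ρ => σ.tab t (i.eval σ ρ) (j.eval σ ρ)
  | add a b, ρ => a.eval σ ρ + b.eval σ ρ
  | sub a b, ρ => a.eval σ ρ - b.eval σ ρ
  | sum b a, ρ => ∑ k ∈ Finset.range (σ.var b), a.eval σ (k :: ρ)

/-- Variables from `50` on are scratch space; sums run up to the values of variables `0` and `2`. -/
def Exp.ok : Exp → Bool
  | const _ => true
  | var x => x < 50
  | bvar _ => true
  | cell _ i j => i.ok && j.ok
  | add a b => a.ok && b.ok
  | sub a b => a.ok && b.ok
  | sum b a => (b == 0 || b == 2) && a.ok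

/-- The term for a summation index, where `γ` lists the variables that hold the indices. -/
def bvarTerm (γ : List ℕ) (i : ℕ) : Term :=
  match γ[i]? with
  | none => .const 0
  | some y => .var y

/-- A program that computes the value of an expression into variable `50 + k`, leaving all
variables below `50 + k` and all tables unchanged. -/
def Exp.comp : Exp → ℕ → List ℕ → Prog
  | const c, k, _ => .assign (50 + k) (.const c)
  | var x, k, _ => .assign (50 + k) (.var x)
  | bvar i, k, γ => .assign (50 + k) (bvarTerm γ i)
  | cell t i j, k, γ => .seq (i.comp k γ) (.seq (j.comp (k + 1) γ)
      (.assign (50 + k) (.cell t (.var (50 + k)) (.var (50 + (k + 1))))))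
  | add a b, k, γ => .seq (a.comp k γ) (.seq (b.comp (k + 1) γ)
      (.assign (50 + k) (.add (.var (50 + k)) (.var (50 + (k + 1))))))
  | sub a b, k, γ => .seq (a.comp k γ) (.seq (b.comp (k + 1) γ)
      (.assign (50 + k) (.sub (.var (50 + k)) (.var (50 + (k + 1))))))
  | sum b a, k, γ => .seq (.assign (50 + k) (.const 0)) (.seq (.assign (50 + (k + 1)) (.const 0))
      (.while (.sub (.var b) (.var (50 + (k + 1))))
        (.seq (a.comp (k + 2) ((50 + (k + 1)) :: γ))
          (.seq (.assign (50 + k) (.add (.var (50 + k)) (.var (50 + (k + 2)))))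
            (.assign (50 + (k + 1)) (.add (.var (50 + (k + 1))) (.const 1)))))))

open Polynomial in
/-- The running time of the compiled expression, as a polynomial in a bound on the lengths of the
sums. -/
noncomputable def Exp.time : Exp → Polynomial ℕ
  | const _ => 2
  | var _ => 2
  | bvar _ => 2
  | cell _ i j => i.time + j.time + 4
  | add a b => a.time + b.time + 4
  | sub a b => a.time + b.time + 4
  | sum _ a => X * (a.time + 12) + 8

/-- If `I i` leads to `I (i + 1)` in one pass through the body, then the loop leads from `I 0` to
`I N`. -/
theorem run_while {b : Term} {p : Prog} (N c : ℕ) (I : ℕ → Store → Prop)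
    (hstep : ∀ i < N, ∀ σ, I i σ → b.eval σ ≠ 0 ∧ ∃ t σ', Run p σ t σ' ∧ t ≤ c ∧ I (i + 1) σ')
    (hN : ∀ σ, I N σ → b.eval σ = 0) (σ : Store) (h0 : I 0 σ) :
    ∃ t σ', Run (.while b p) σ t σ' ∧ t ≤ N * (b.cost + 1 + c) + (b.cost + 1) ∧ I N σ' := by
  -- The induction is on the number `j` of passes still to be made, because `Run` unfolds a loop
  -- from its first pass.
  suffices h : ∀ j ≤ N, ∀ σ, I (N - j) σ → ∃ t σ', Run (.while b p) σ t σ' ∧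
      t ≤ j * (b.cost + 1 + c) + (b.cost + 1) ∧ I N σ' from h N le_rfl σ (by simpa using h0)
  intro j
  induction j with
  | zero => exact fun _ σ h => ⟨_, σ, .while_false (hN σ (by simpa using h)), by simp, by simpa using h⟩
  | succ j ih =>
    intro hj σ h
    obtain ⟨hb, t, σ', hr, ht, hI⟩ := hstep _ (by omega) σ h
    obtain ⟨t', σ'', hr', ht', hI'⟩ := ih (by omega) σ' (by convert hI using 1; omega)
    exact ⟨_, σ'', .while_true hb hr hr', by rw [Nat.succ_mul]; omega, hI'⟩

/-- The two memories agree outside the scratch space. -/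
def Agree (σ τ : Store) : Prop := (∀ x < 50, τ.var x = σ.var x) ∧ τ.tab = σ.tab

/-- The scratch space serves as a stack: subexpressions are evaluated at greater depth and leave
everything below untouched. Here `σ` is the memory in which the expression has its meaning and `τ`
the actual one, with intermediate results and summation indices on the stack. -/
theorem Exp.comp_run {B : ℕ} {σ : Store} (h0 : σ.var 0 ≤ B) (h2 : σ.var 2 ≤ B) (e : Exp)
    (he : e.ok = true) : ∀ (k : ℕ) (γ ρ : List ℕ) (τ : Store), Agree σ τ →
    (∀ y ∈ γ, y < 50 + k) → γ.map τ.var = ρ →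
    ∃ t τ', Run (e.comp k γ) τ t τ' ∧ t ≤ e.time.eval B ∧ τ'.var (50 + k) = e.eval σ ρ ∧
      (∀ x < 50 + k, τ'.var x = τ.var x) ∧ τ'.tab = τ.tab := by
  induction e with
  | const c =>
    intro k γ ρ τ hA hγ hρ
    refine ⟨_, _, .assign _ _ _, by simp [Exp.time, Term.cost], by simp [Store.setVar, Term.eval, Exp.eval], ?_, rfl⟩
    intro x hx
    simp [Store.setVar, hx.ne]
  | var y =>
    intro k γ ρ τ hA hγ hρ
    refine ⟨_, _, .assign _ _ _, by simp [Exp.time, Term.cost], ?_, ?_, rfl⟩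
    · simp only [Exp.ok, decide_eq_true_eq] at he
      simp [Store.setVar, Term.eval, Exp.eval, hA.1 y he]
    intro x hx
    simp [Store.setVar, hx.ne]
  | bvar i =>
    intro k γ ρ τ hA hγ hρ
    refine ⟨_, _, .assign _ _ _, ?_, ?_, ?_, rfl⟩
    · simp only [Exp.time, bvarTerm]
      split <;> simp [Term.cost]
    · subst hρ
      simp only [Store.setVar, if_true, Exp.eval, bvarTerm, List.getD, List.getElem?_map]
      cases γ[i]? <;> simp [Term.eval]
    intro x hx
    simp [Store.setVar, hx.ne]
  | cell t a b iha ihb | add a b iha ihb | sub a b iha ihb =>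
    intro k γ ρ τ hA hγ hρ
    simp only [Exp.ok, Bool.and_eq_true] at he
    obtain ⟨t₁, τ₁, hr₁, ht₁, hv₁, hx₁, htab₁⟩ := iha he.1 k γ ρ τ hA hγ hρ
    have hA₁ : Agree σ τ₁ := ⟨fun x hx => (hx₁ x (by omega)).trans (hA.1 x hx), htab₁.trans hA.2⟩
    obtain ⟨t₂, τ₂, hr₂, ht₂, hv₂, hx₂, htab₂⟩ := ihb he.2 (k + 1) γ ρ τ₁ hA₁
      (fun y hy => (hγ y hy).trans (by omega))
      (by rw [← hρ]; exact List.map_congr_left fun y hy => hx₁ y (hγ y hy))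
    refine ⟨_, _, .seq hr₁ (.seq hr₂ (.assign _ _ _)), ?_, ?_, ?_, ?_⟩
    · simp [Exp.time, Term.cost]
      omega
    · simp [Store.setVar, Term.eval, Exp.eval, hv₂, hx₂ (50 + k) (by omega), hv₁, htab₂, htab₁, hA.2]
    · intro x hx
      simp [Store.setVar, hx.ne, hx₂ x (by omega), hx₁ x hx]
    · simp [Store.setVar, htab₂, htab₁]
  | sum b a iha =>
    intro k γ ρ τ hA hγ hρ
    simp only [Exp.ok, Bool.and_eq_true, Bool.or_eq_true, beq_iff_eq] at he
    have hb : b < 50 := by omega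
    have hbB : σ.var b ≤ B := by rcases he.1 with rfl | rfl <;> assumption
    set τ₀ := (τ.setVar (50 + k) 0).setVar (50 + (k + 1)) 0 with hτ₀
    -- The running total is in `50 + k`, the index in `50 + (k + 1)`, and the summand is evaluated
    -- above them. The two updates cost `8` and the test `4`, which gives the `12` in `Exp.time`.
    have key := run_while (b := .sub (.var b) (.var (50 + (k + 1))))
      (p := .seq (a.comp (k + 2) ((50 + (k + 1)) :: γ))
          (.seq (.assign (50 + k) (.add (.var (50 + k)) (.var (50 + (k + 2)))))
            (.assign (50 + (k + 1)) (.add (.var (50 + (k + 1))) (.const 1)))))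
      (σ.var b) (a.time.eval B + 8)
      (fun i τ' => τ'.var (50 + k) = ∑ j ∈ Finset.range i, a.eval σ (j :: ρ) ∧
        τ'.var (50 + (k + 1)) = i ∧ (∀ x < 50 + k, τ'.var x = τ.var x) ∧ τ'.tab = τ.tab)
      ?_ ?_ τ₀ ?_
    · obtain ⟨t, τ', hr, ht, hv, -, hx, htab⟩ := key
      refine ⟨_, τ', .seq (.assign _ _ _) (.seq (.assign _ _ _) hr), ?_, hv, hx, htab⟩
      simp only [Exp.time, Polynomial.eval_add, Polynomial.eval_mul, Polynomial.eval_X,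
        Polynomial.eval_ofNat, Term.cost] at ht ⊢
      have : σ.var b * (1 + 1 + 1 + 1 + (Polynomial.eval B a.time + 8)) ≤
        B * (Polynomial.eval B a.time + 12) := Nat.mul_le_mul hbB (by omega)
      omega
    · rintro i hi τ₁ ⟨hv, hi', hx, htab⟩
      refine ⟨by simp [Term.eval, hx b (by omega), hA.1 b hb, hi']; omega, ?_⟩
      obtain ⟨t, τ', hr, ht, hv', hx', htab'⟩ := iha he.2 (k + 2) ((50 + (k + 1)) :: γ) (i :: ρ) τ₁
        ⟨fun x h => (hx x (by omega)).trans (hA.1 x h), htab.trans hA.2⟩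
        (by
          intro y hy
          rcases List.mem_cons.1 hy with rfl | hy
          · omega
          · exact (hγ y hy).trans (by omega))
        (by
          rw [List.map_cons, hi', ← hρ]
          exact congrArg _ (List.map_congr_left fun y hy => hx y (hγ y hy)))
      refine ⟨_, _, .seq hr (.seq (.assign _ _ _) (.assign _ _ _)), ?_, ?_, ?_, ?_, ?_⟩
      · simp [Term.cost]
        omega
      · simp [Store.setVar, Term.eval, hv', hx' (50 + k) (by omega), hv, Finset.sum_range_succ]
      · simp [Store.setVar, Term.eval, hx' (50 + (k + 1)) (by omega), hi']
      · intro x h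
        simp [Store.setVar, h.ne, (show x ≠ 50 + (k + 1) by omega), hx' x (by omega), hx x h]
      · simp [Store.setVar, htab', htab]
    · rintro τ' ⟨-, h, hx, -⟩
      simp [Term.eval, h, hx b (by omega), hA.1 b hb]
    · refine ⟨by simp [hτ₀, Store.setVar], by simp [hτ₀, Store.setVar], ?_, by simp [hτ₀, Store.setVar]⟩
      intro x h
      simp [hτ₀, Store.setVar, h.ne, (show x ≠ 50 + (k + 1) by omega)]

/-- Loop programs. `loop x b p` repeats `p` for `x = 0, 1, …` below the value of variable `b`. -/
inductive Stmt : Type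
  | skip
  | assign (x : ℕ) (a : Exp)
  | write (t : ℕ) (i j a : Exp)
  | seq (p q : Stmt)
  | ite (b : Exp) (p q : Stmt)
  | loop (x b : ℕ) (p : Stmt)

/-- Apply `f` for `x = 0, …, k - 1`. -/
def iterLoop (f : Store → Store) (x : ℕ) : ℕ → Store → Store
  | 0, σ => σ
  | k + 1, σ => f ((iterLoop f x k σ).setVar x k)

/-- The effect of a loop program. -/
def Stmt.denote : Stmt → Store → Store
  | skip, σ => σ
  | assign x a, σ => σ.setVar x (a.eval σ [])
  | write t i j a, σ => σ.setTab t (i.eval σ []) (j.eval σ []) (a.eval σ [])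
  | seq p q, σ => q.denote (p.denote σ)
  | ite b p q, σ => if b.eval σ [] ≠ 0 then p.denote σ else q.denote σ
  | loop x b p, σ => iterLoop p.denote x (σ.var b) σ

/-- Variables `0` and `2`, which bound the loops, are not assigned, and the scratch space is not
used. -/
def Stmt.ok : Stmt → Bool
  | skip => true
  | assign x a => x < 50 && x != 0 && x != 2 && a.ok
  | write _ i j a => i.ok && j.ok && a.ok
  | seq p q => p.ok && q.ok
  | ite b p q => b.ok && p.ok && q.ok
  | loop x b p => x < 50 && x != 0 && x != 2 && (b == 0 || b == 2) && p.ok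

/-- The compiled program, with scratch space from variable `50 + k` on. -/
def Stmt.comp : Stmt → ℕ → Prog
  | skip, _ => .skip
  | assign x a, k => .seq (a.comp k []) (.assign x (.var (50 + k)))
  | write t i j a, k => .seq (i.comp k []) (.seq (j.comp (k + 1) []) (.seq (a.comp (k + 2) [])
      (.write t (.var (50 + k)) (.var (50 + (k + 1))) (.var (50 + (k + 2))))))
  | seq p q, k => .seq (p.comp k) (q.comp k)
  | ite b p q, k => .seq (b.comp k []) (.ite (.var (50 + k)) (p.comp k) (q.comp k))
  | loop x b p, k => .seq (.assign (50 + k) (.const 0))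
      (.while (.sub (.var b) (.var (50 + k)))
        (.seq (.assign x (.var (50 + k))) (.seq (p.comp (k + 1))
          (.assign (50 + k) (.add (.var (50 + k)) (.const 1))))))

open Polynomial in
/-- The running time of the compiled program, as a polynomial in a bound on the lengths of the
loops. -/
noncomputable def Stmt.time : Stmt → Polynomial ℕ
  | skip => 1
  | assign _ a => a.time + 2
  | write _ i j a => i.time + j.time + a.time + 4
  | seq p q => p.time + q.time
  | ite b p q => b.time + p.time + q.time + 2
  | loop _ _ p => X * (p.time + 10) + 6

/-- The variables that are assigned. -/
def Stmt.modV : Stmt → List ℕ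
  | skip => []
  | assign x _ => [x]
  | write _ _ _ _ => []
  | seq p q => p.modV ++ q.modV
  | ite _ p q => p.modV ++ q.modV
  | loop x _ p => x :: p.modV

/-- The tables that are written to. -/
def Stmt.modT : Stmt → List ℕ
  | skip => []
  | assign _ _ => []
  | write t _ _ _ => [t]
  | seq p q => p.modT ++ q.modT
  | ite _ p q => p.modT ++ q.modT
  | loop _ _ p => p.modT

/-! ### Frame properties and correctness of the compiled loop programs. -/

theorem iterLoop_var {f : Store → Store} {x y : ℕ} (hxy : y ≠ x)
    (hf : ∀ σ, (f σ).var y = σ.var y) (k : ℕ) (σ : Store) :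
    (iterLoop f x k σ).var y = σ.var y := by
  induction k with
  | zero => rfl
  | succ k ih => simp [iterLoop, hf, Store.setVar, hxy, ih]

theorem iterLoop_tab {f : Store → Store} {x t : ℕ}
    (hf : ∀ σ, (f σ).tab t = σ.tab t) (k : ℕ) (σ : Store) :
    (iterLoop f x k σ).tab t = σ.tab t := by
  induction k with
  | zero => rfl
  | succ k ih => simp [iterLoop, hf, Store.setVar, ih]

theorem Stmt.denote_var (p : Stmt) {y : ℕ} (hy : y ∉ p.modV) (σ : Store) :
    (p.denote σ).var y = σ.var y := by
  induction p generalizing σ with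
  | skip => rfl
  | assign x a => simp_all [denote, modV, Store.setVar]
  | write t i j a => rfl
  | seq p q ihp ihq => simp_all [denote, modV]
  | ite b p q ihp ihq =>
    simp only [modV, List.mem_append, not_or] at hy
    simp only [denote]
    split
    · exact ihp hy.1 σ
    · exact ihq hy.2 σ
  | loop x b p ih =>
    simp only [modV, List.mem_cons, not_or] at hy
    exact iterLoop_var hy.1 (ih hy.2) _ _

theorem Stmt.denote_tab (p : Stmt) {t : ℕ} (ht : t ∉ p.modT) (σ : Store) :
    (p.denote σ).tab t = σ.tab t := by
  induction p generalizing σ with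
  | skip => rfl
  | assign x a => rfl
  | write t' i j a =>
    simp only [modT, List.mem_singleton] at ht
    simp [denote, Store.setTab, ht]
  | seq p q ihp ihq => simp_all [denote, modT]
  | ite b p q ihp ihq =>
    simp only [modT, List.mem_append, not_or] at ht
    simp only [denote]
    split
    · exact ihp ht.1 σ
    · exact ihq ht.2 σ
  | loop x b p ih => exact iterLoop_tab (ih ht) _ _

/-- Keeps the bounds on the lengths of loops and sums valid throughout the run. -/
theorem Stmt.notMem_modV_of_ok {p : Stmt} (hp : p.ok = true) : 0 ∉ p.modV ∧ 2 ∉ p.modV := by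
  induction p with
  | skip => simp [modV]
  | assign x a => simp_all [ok, modV]; omega
  | write t i j a => simp [modV]
  | seq p q ihp ihq => simp_all [ok, modV]
  | ite b p q ihp ihq => simp_all [ok, modV]
  | loop x b p ih => simp_all [ok, modV]; omega

/-- Each loop counts in its own scratch cell `50 + k`, which the body, compiled from `k + 1` on,
preserves; the visible loop variable is only a copy, so the body may overwrite it. -/
theorem Stmt.comp_run {B : ℕ} (p : Stmt) (hp : p.ok = true) : ∀ (k : ℕ) (σ τ : Store),
    σ.var 0 ≤ B → σ.var 2 ≤ B → Agree σ τ →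
    ∃ t τ', Run (p.comp k) τ t τ' ∧ t ≤ p.time.eval B ∧ Agree (p.denote σ) τ' ∧
      (∀ x < k, τ'.var (50 + x) = τ.var (50 + x)) := by
  induction p with
  | skip => exact fun k σ τ _ _ hA => ⟨_, _, .skip _, by simp [time], hA, fun _ _ => rfl⟩
  | assign x a =>
    intro k σ τ h0 h2 hA
    simp only [ok, Bool.and_eq_true, decide_eq_true_eq] at hp
    obtain ⟨t, τ', hr, ht, hv, hx, htab⟩ := a.comp_run h0 h2 hp.2 k [] [] τ hA (by simp) rfl
    refine ⟨_, _, .seq hr (.assign _ _ _), by simp [time, Term.cost]; omega, ⟨?_, ?_⟩, ?_⟩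
    · intro y hy
      simp only [Store.setVar, denote, Term.eval, hv]
      split
      · rfl
      · rw [hx y (by omega), hA.1 y hy]
    · simp [Store.setVar, denote, htab, hA.2]
    · intro y hy
      simp [Store.setVar, (show 50 + y ≠ x by omega), hx (50 + y) (by omega)]
  | write tb i j a =>
    intro k σ τ h0 h2 hA
    simp only [ok, Bool.and_eq_true] at hp
    obtain ⟨t₁, τ₁, hr₁, ht₁, hv₁, hx₁, htab₁⟩ := i.comp_run h0 h2 hp.1.1 k [] [] τ hA (by simp) rfl
    have hA₁ : Agree σ τ₁ := ⟨fun x hx => (hx₁ x (by omega)).trans (hA.1 x hx), htab₁.trans hA.2⟩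
    obtain ⟨t₂, τ₂, hr₂, ht₂, hv₂, hx₂, htab₂⟩ :=
      j.comp_run h0 h2 hp.1.2 (k + 1) [] [] τ₁ hA₁ (by simp) rfl
    have hA₂ : Agree σ τ₂ := ⟨fun x hx => (hx₂ x (by omega)).trans (hA₁.1 x hx), htab₂.trans hA₁.2⟩
    obtain ⟨t₃, τ₃, hr₃, ht₃, hv₃, hx₃, htab₃⟩ :=
      a.comp_run h0 h2 hp.2 (k + 2) [] [] τ₂ hA₂ (by simp) rfl
    refine ⟨_, _, .seq hr₁ (.seq hr₂ (.seq hr₃ (.write _ _ _ _ _))),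
      by simp [time, Term.cost]; omega, ⟨?_, ?_⟩, ?_⟩
    · intro y hy
      simp [Store.setTab, denote, hx₃ y (by omega), hx₂ y (by omega), hx₁ y (by omega), hA.1 y hy]
    · simp only [Store.setTab, denote, Term.eval, hv₃, hx₃ (50 + (k + 1)) (by omega), hv₂,
        hx₃ (50 + k) (by omega), hx₂ (50 + k) (by omega), hv₁, htab₃, htab₂, htab₁, hA.2]
    · intro y hy
      simp [Store.setTab, hx₃ (50 + y) (by omega), hx₂ (50 + y) (by omega), hx₁ (50 + y) (by omega)]
  | seq p q ihp ihq =>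
    intro k σ τ h0 h2 hA
    simp only [ok, Bool.and_eq_true] at hp
    have hm := notMem_modV_of_ok hp.1
    obtain ⟨t₁, τ₁, hr₁, ht₁, hA₁, hx₁⟩ := ihp hp.1 k σ τ h0 h2 hA
    obtain ⟨t₂, τ₂, hr₂, ht₂, hA₂, hx₂⟩ := ihq hp.2 k (p.denote σ) τ₁
      (by rwa [p.denote_var hm.1]) (by rwa [p.denote_var hm.2]) hA₁
    exact ⟨_, _, .seq hr₁ hr₂, by simp [time]; omega, hA₂,
      fun x hx => (hx₂ x hx).trans (hx₁ x hx)⟩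
  | ite b p q ihp ihq =>
    intro k σ τ h0 h2 hA
    simp only [ok, Bool.and_eq_true] at hp
    obtain ⟨t, τ', hr, ht, hv, hx, htab⟩ := b.comp_run h0 h2 hp.1.1 k [] [] τ hA (by simp) rfl
    have hA' : Agree σ τ' := ⟨fun x h => (hx x (by omega)).trans (hA.1 x h), htab.trans hA.2⟩
    by_cases hb : b.eval σ [] = 0
    · obtain ⟨t₁, τ₁, hr₁, ht₁, hA₁, hx₁⟩ := ihq hp.2 k σ τ' h0 h2 hA'
      refine ⟨_, _, .seq hr (.ite_false (by simpa [Term.eval] using hv.trans hb) hr₁),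
        by simp [time, Term.cost]; omega, by simpa [denote, hb] using hA₁, ?_⟩
      exact fun x h => (hx₁ x h).trans (hx _ (by omega))
    · obtain ⟨t₁, τ₁, hr₁, ht₁, hA₁, hx₁⟩ := ihp hp.1.2 k σ τ' h0 h2 hA'
      refine ⟨_, _, .seq hr (.ite_true (by simpa [Term.eval, hv] using hb) hr₁),
        by simp [time, Term.cost]; omega, by simpa [denote, hb] using hA₁, ?_⟩
      exact fun x h => (hx₁ x h).trans (hx _ (by omega))
  | loop x b p ih =>
    intro k σ τ h0 h2 hA
    simp only [ok, Bool.and_eq_true, Bool.or_eq_true, beq_iff_eq, decide_eq_true_eq, bne_iff_ne,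
      ne_eq] at hp
    obtain ⟨⟨⟨⟨hx50, hx0⟩, hx2⟩, hb⟩, hp⟩ := hp
    have hb50 : b < 50 := by omega
    have hm := notMem_modV_of_ok hp
    have hbB : σ.var b ≤ B := by rcases hb with rfl | rfl <;> assumption
    have hkeep : ∀ i, (iterLoop p.denote x i σ).var 0 = σ.var 0 ∧
        (iterLoop p.denote x i σ).var 2 = σ.var 2 := fun i =>
      ⟨iterLoop_var (Ne.symm hx0) (p.denote_var hm.1) i σ,
        iterLoop_var (Ne.symm hx2) (p.denote_var hm.2) i σ⟩
    have hkeepb : ∀ i, (iterLoop p.denote x i σ).var b = σ.var b := by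
      rcases hb with rfl | rfl
      · exact fun i => (hkeep i).1
      · exact fun i => (hkeep i).2
    have key := run_while (b := .sub (.var b) (.var (50 + k)))
      (p := .seq (.assign x (.var (50 + k))) (.seq (p.comp (k + 1))
          (.assign (50 + k) (.add (.var (50 + k)) (.const 1)))))
      (σ.var b) (p.time.eval B + 6)
      (fun i τ' => Agree (iterLoop p.denote x i σ) τ' ∧ τ'.var (50 + k) = i ∧
        (∀ y < k, τ'.var (50 + y) = τ.var (50 + y)))
      ?_ ?_ (τ.setVar (50 + k) 0) ?_
    · obtain ⟨t, τ', hr, ht, hA', -, hx⟩ := key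
      refine ⟨_, τ', .seq (.assign _ _ _) hr, ?_, hA', hx⟩
      simp only [Stmt.time, Polynomial.eval_add, Polynomial.eval_mul, Polynomial.eval_X,
        Polynomial.eval_ofNat, Term.cost] at ht ⊢
      have : σ.var b * (1 + 1 + 1 + 1 + (Polynomial.eval B p.time + 6)) ≤
        B * (Polynomial.eval B p.time + 10) := Nat.mul_le_mul hbB (by omega)
      omega
    · rintro i hi τ₁ ⟨hA₁, hi', hx⟩
      refine ⟨by simp [Term.eval, hi', hA₁.1 b hb50, hkeepb]; omega, ?_⟩
      obtain ⟨t₂, τ₂, hr₂, ht₂, hA₂, hx₂⟩ := ih hp (k + 1) ((iterLoop p.denote x i σ).setVar x i)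
        (τ₁.setVar x i) (by simpa [Store.setVar, Ne.symm hx0, (hkeep i).1] using h0)
        (by simpa [Store.setVar, Ne.symm hx2, (hkeep i).2] using h2)
        ⟨fun y hy => by
          simp only [Store.setVar]
          split
          · rfl
          · exact hA₁.1 y hy, hA₁.2⟩
      refine ⟨_, _, .seq (.assign _ _ _)
        (.seq (by simpa [Term.eval, hi'] using hr₂) (.assign _ _ _)), ?_, ⟨?_, ?_⟩, ?_, ?_⟩
      · simp [Term.cost]
        omega
      · intro y hy
        simp [Store.setVar, (show y ≠ 50 + k by omega), iterLoop, hA₂.1 y hy]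
      · simp [Store.setVar, iterLoop, hA₂.2]
      · simp [Store.setVar, Term.eval, hx₂ k (by omega), (show 50 + k ≠ x by omega), hi']
      · intro y hy
        simp [Store.setVar, hy.ne, hx₂ y (by omega), (show 50 + y ≠ x by omega), hx y hy]
    · rintro τ' ⟨hA', h, -⟩
      simp [Term.eval, h, hA'.1 b hb50, hkeepb]
    · refine ⟨⟨?_, by simp [Store.setVar, iterLoop, hA.2]⟩, by simp [Store.setVar], ?_⟩
      · intro y hy
        simp [Store.setVar, iterLoop, (show y ≠ 50 + k by omega), hA.1 y hy]
      · intro y hy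
        simp [Store.setVar, hy.ne]

/-- A search problem is solvable in polynomial time if it is solved by a loop program that works
with `n * n` in variable `2` and leaves in variable `3` whether there is a solution. -/
theorem solvableInPolyTime_of_stmt
    {S : ∀ {n : ℕ}, PrefProfile n → ℕ → Matching n → Prop} (p : Stmt) (hp : p.ok = true)
    (h : ∀ (n : ℕ) (P : PrefProfile n) (d : ℕ),
      let σ := p.denote ((inputStore P d).setVar 2 (n * n))
      (σ.var 3 = 1 ∧ ∃ M : Matching n, S P d M ∧ ∀ u : Fin n, σ.tab 2 0 u =
        match M u with
        | none => 0
        | some w => (w : ℕ) + 1) ∨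
      (σ.var 3 = 0 ∧ ¬ ∃ M : Matching n, S P d M)) :
    SolvableInPolyTime S := by
  -- In the absence of multiplication, `n * n` is computed as a sum of `n` copies of `n`. Both
  -- possible loop bounds are at most `n + n * n`, which is the polynomial substituted into
  -- `p.time`.
  refine ⟨.seq ((Exp.sum 0 (.var 0)).comp 0 []) (.seq (.assign 2 (.var 50))
    (.seq (p.comp 0) (.assign 0 (.var 3)))),
    (Exp.sum 0 (.var 0)).time + 2 + p.time.comp (Polynomial.X + Polynomial.X * Polynomial.X) + 2,
    fun n P d => ?_⟩
  set σ := inputStore P d with hσ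
  have h0 : σ.var 0 = n := rfl
  have h2 : σ.var 2 = 0 := rfl
  obtain ⟨t₁, τ₁, hr₁, ht₁, hv₁, hx₁, htab₁⟩ := (Exp.sum 0 (.var 0)).comp_run (B := n) (σ := σ)
    h0.le (by omega) rfl 0 [] [] σ ⟨fun _ _ => rfl, rfl⟩ (by simp) rfl
  obtain ⟨t₂, τ₂, hr₂, ht₂, hA₂, -⟩ := p.comp_run (B := n + n * n) hp 0 (σ.setVar 2 (n * n))
    (τ₁.setVar 2 (n * n)) (by simp [Store.setVar, h0]) (by simp [Store.setVar])
    ⟨fun y hy => by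
      simp only [Store.setVar]
      split
      · rfl
      · exact hx₁ y (by omega), htab₁⟩
  have hv : τ₁.var 50 = n * n := by simpa [Exp.eval, h0] using hv₁
  refine ⟨_, τ₂.setVar 0 (τ₂.var 3), .seq hr₁ (.seq (.assign _ _ _)
    (.seq (by simpa [Term.eval, hv] using hr₂) (.assign _ _ _))), ?_, ?_⟩
  · simp only [Term.cost, Polynomial.eval_add, Polynomial.eval_comp, Polynomial.eval_mul,
      Polynomial.eval_X, Polynomial.eval_ofNat]
    omega
  · rcases h n P d with ⟨h3, M, hM, ho⟩ | ⟨h3, hno⟩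
    · refine .inl ⟨M, hM, by simpa [Store.setVar, hA₂.1 3] using h3, fun u => ?_⟩
      exact (congrFun (congrFun (congrFun hA₂.2 2) 0) u).trans (ho u)
    · exact .inr ⟨hno, by simpa [Store.setVar, ReportsNone, hA₂.1 3] using h3⟩

end RAM

/-! ## Robust matchings -/

namespace PrefList

variable {n : ℕ}

theorem rank_lt_length {l : PrefList n} {x : Fin n} : l.rank x < l.1.length ↔ l.Accepts x :=
  List.idxOf_lt_length_iff

theorem rank_inj {l : PrefList n} {x y : Fin n} (hx : l.Accepts x) (h : l.rank x = l.rank y) :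
    x = y :=
  (List.idxOf_inj hx).1 h

theorem getElem?_rank {l : PrefList n} {x : Fin n} (hx : l.Accepts x) :
    l.1[l.rank x]? = some x := by
  simp [rank, List.getElem?_eq_getElem (List.idxOf_lt_length_iff.2 hx)]

theorem getElem?_eq_some_iff {l : PrefList n} {x : Fin n} {k : ℕ} :
    l.1[k]? = some x ↔ l.Accepts x ∧ l.rank x = k := by
  constructor
  · intro h
    obtain ⟨hk, rfl⟩ := List.getElem?_eq_some_iff.1 h
    exact ⟨List.getElem_mem _, l.2.idxOf_getElem _ _⟩
  · rintro ⟨h, rfl⟩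
    exact getElem?_rank h

theorem length_le (l : PrefList n) : l.1.length ≤ n := by
  simpa using l.2.length_le_card

theorem swapDist_self (l : PrefList n) : l.swapDist l = 0 := by
  simp only [swapDist, implies_true, if_true]
  norm_cast
  rw [Finset.card_eq_zero, Finset.filter_eq_empty_iff]
  rintro p - ⟨⟨_, _, h⟩, ⟨_, _, h'⟩⟩
  omega

/-- The distance to any list in which `b` has overtaken `a`. -/
theorem le_swapDist {l l' : PrefList n} {a b : Fin n} (hac : ∀ x, l.Accepts x ↔ l'.Accepts x)
    (ha : l.Accepts a) (hb : l.Accepts b)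
    (hlt' : l'.rank b < l'.rank a) : ((l.rank b - l.rank a : ℕ) : ℕ∞) ≤ l.swapDist l' := by
  rw [swapDist, if_pos hac]
  norm_cast
  have hget : ∀ k : Fin (l.rank b - l.rank a), ∃ z, l.Accepts z ∧ l.rank z = l.rank a + k := by
    intro k
    have hk : l.rank a + k < l.1.length := by
      have := rank_lt_length.2 hb
      omega
    exact ⟨l.1[l.rank a + k], getElem?_eq_some_iff.1 (List.getElem?_eq_getElem hk)⟩
  choose z hz hzr using hget
  -- Each agent `z k` with rank from that of `a` up to just before that of `b` contributes an
  -- inverted pair: either `b` has overtaken `z k`, or `z k` is not behind `b` in `l'` and hence has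
  -- overtaken `a`. The agent `a` itself falls under the first case, so no pair is named twice.
  have key := Finset.card_le_card_of_injOn (s := (Finset.univ : Finset (Fin (l.rank b - l.rank a))))
    (t := Finset.univ.filter fun p : Fin n × Fin n =>
      l.Prefers p.1 p.2 ∧ l'.Prefers p.2 p.1)
    (fun k => if l'.rank b < l'.rank (z k) then (z k, b) else (a, z k)) ?_ ?_
  · simpa using key
  · intro k _
    have h1 := hzr k
    have hk := k.2
    simp only [Finset.coe_filter, Finset.mem_univ, true_and, Set.mem_ofPred_eq]
    split_ifs with h
    · exact ⟨⟨hz k, hb, show l.rank (z k) < l.rank b by omega⟩, (hac _).1 hb, (hac _).1 (hz k), h⟩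
    · refine ⟨⟨ha, hz k, ?_⟩, (hac _).1 (hz k), (hac _).1 ha,
        show l'.rank (z k) < l'.rank a by omega⟩
      change l.rank a < l.rank (z k)
      by_contra hcon
      have : z k = a := rank_inj (hz k) (by omega)
      rw [this] at h
      exact h hlt'
  · intro k _ k' _ h
    have h1 := hzr k
    have h1' := hzr k'
    have hk := k.2
    have hk' := k'.2
    simp only at h
    apply Fin.ext
    split_ifs at h <;> simp only [Prod.mk.injEq] at h <;> obtain ⟨e1, e2⟩ := h
    · rw [e1] at h1; omega
    · rw [← e2] at h1'; omega
    · rw [e2] at h1; omega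
    · rw [e2] at h1; omega

/-- The distance to some list in which `b` has overtaken `a`. -/
theorem exists_swapDist_le (l : PrefList n) {a b : Fin n} (ha : l.Accepts a) (hb : l.Accepts b)
    (hlt : l.rank a < l.rank b) : ∃ l' : PrefList n, (∀ x, l.Accepts x ↔ l'.Accepts x) ∧
      l'.rank b < l'.rank a ∧ l.swapDist l' ≤ ((l.rank b - l.rank a : ℕ) : ℕ∞) := by
  classical
  -- Doubling the ranks makes room for `b` immediately before `a`; sorting by `key` moves `b` there
  -- and keeps the order of all others.
  set key : Fin n → ℕ := fun x => if x = b then 2 * l.rank a else 2 * l.rank x + 1 with hkey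
  have hkb : key b = 2 * l.rank a := by simp [hkey]
  have hkx : ∀ x, x ≠ b → key x = 2 * l.rank x + 1 := fun x hx => by simp [hkey, hx]
  set s := l.1.mergeSort (fun x y => decide (key x ≤ key y)) with hs
  have hperm : s.Perm l.1 := List.mergeSort_perm _ _
  have hmem : ∀ x, x ∈ s ↔ x ∈ l.1 := fun x => hperm.mem_iff
  have hnd : s.Nodup := hperm.nodup_iff.2 l.2
  have hinj : ∀ x ∈ l.1, ∀ y ∈ l.1, key x = key y → x = y := by
    intro x hx y hy h
    by_cases hxb : x = b <;> by_cases hyb : y = b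
    · rw [hxb, hyb]
    · rw [hxb, hkb, hkx y hyb] at h; omega
    · rw [hyb, hkb, hkx x hxb] at h; omega
    · rw [hkx x hxb, hkx y hyb] at h
      exact rank_inj hx (by omega)
  have hsorted : s.Pairwise (fun x y => key x ≤ key y) := by
    have := List.pairwise_mergeSort (le := fun x y => decide (key x ≤ key y))
      (by intro x y z; simp; omega) (by intro x y; simp; omega) l.1
    simpa using this
  have hrank : ∀ x ∈ l.1, ∀ y ∈ l.1, s.idxOf x < s.idxOf y → key x < key y := by
    intro x hx y hy h
    have hx' := List.idxOf_lt_length_iff.2 ((hmem x).2 hx)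
    have hy' := List.idxOf_lt_length_iff.2 ((hmem y).2 hy)
    have := List.pairwise_iff_getElem.1 hsorted _ _ hx' hy' h
    simp only [List.getElem_idxOf] at this
    refine lt_of_le_of_ne this fun e => ?_
    rw [hinj x hx y hy e] at h
    omega
  have hab : a ≠ b := by rintro rfl; omega
  refine ⟨⟨s, hnd⟩, fun x => (hmem x).symm, ?_, ?_⟩
  · by_contra hcon
    have hle : s.idxOf a ≤ s.idxOf b := not_lt.1 hcon
    have hne : s.idxOf a ≠ s.idxOf b := fun e => hab ((List.idxOf_inj ((hmem a).2 ha)).1 e)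
    have := hrank a ha b hb (by omega)
    rw [hkb, hkx a hab] at this
    omega
  · rw [swapDist, if_pos fun x => (hmem x).symm]
    norm_cast
    -- Every inverted pair has the form `(x, b)` with `x` ranked from `a` up to just before `b`, so
    -- it is determined by the rank of `x`.
    have := Finset.card_le_card_of_injOn (s := Finset.univ.filter fun p : Fin n × Fin n =>
        l.Prefers p.1 p.2 ∧ PrefList.Prefers ⟨s, hnd⟩ p.2 p.1)
      (t := Finset.Ico (l.rank a) (l.rank b)) (fun p => l.rank p.1) ?_ ?_
    · simpa using this
    all_goals
      have hp : ∀ p : Fin n × Fin n, l.Prefers p.1 p.2 ∧ PrefList.Prefers ⟨s, hnd⟩ p.2 p.1 →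
          l.Accepts p.1 ∧ p.2 = b ∧ l.rank a ≤ l.rank p.1 ∧ l.rank p.1 < l.rank b := by
        rintro ⟨x, y⟩ ⟨⟨hx, hy, hxy⟩, -, -, hyx⟩
        simp only at hx hy hxy hyx ⊢
        have hk := hrank y hy x hx hyx
        have hne : x ≠ b := by
          rintro rfl
          rw [hkb, hkx y (by rintro rfl; omega)] at hk
          omega
        rw [hkx x hne] at hk
        by_cases hyb : y = b
        · subst hyb
          rw [hkb] at hk
          exact ⟨hx, rfl, by omega, hxy⟩
        · rw [hkx y hyb] at hk
          omega
    · intro p hp'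
      have := hp p (by simpa using hp')
      simpa using this.2.2
    · intro p hp' q hq' h
      have h1 := hp p (by simpa using hp')
      have h2 := hp q (by simpa using hq')
      exact Prod.ext (rank_inj h1.1 h) (h1.2.1.trans h2.2.1.symm)

theorem rank_partner_le_length (l : PrefList n) (o : Option (Fin n)) :
    l.partnerRank o ≤ l.1.length := by
  cases o
  · exact le_rfl
  · exact List.idxOf_le_length

end PrefList

/-! ### Robustness as a condition on the margins of unmatched pairs. -/

namespace PrefProfile

variable {n : ℕ}

/-- The rank of the partner of `u ∈ U`. -/
def posU (P : PrefProfile n) (M : Matching n) (u : Fin n) : ℕ := (P.prefU u).partnerRank (M u)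

/-- The rank of the partner of `w ∈ W`. -/
def posW (P : PrefProfile n) (M : Matching n) (w : Fin n) : ℕ := (P.prefW w).partnerRank (M.symm w)

theorem posU_of_mem {P : PrefProfile n} {M : Matching n} {u w : Fin n} (h : w ∈ M u) :
    P.posU M u = (P.prefU u).rank w := by
  rw [posU, Option.mem_def.1 h]
  rfl

theorem posW_of_mem {P : PrefProfile n} {M : Matching n} {u w : Fin n} (h : w ∈ M u) :
    P.posW M w = (P.prefW w).rank u := by
  rw [posW, Option.mem_def.1 ((M.mem_iff_mem).2 h)]
  rfl

/-- The cheapest way to make a pair block a matching is to let both agents promote each other past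
their partners. -/
theorem robust_iff {P : PrefProfile n} {d : ℕ} {M : Matching n} :
    P.Robust d M ↔ (∀ u w, w ∈ M u → P.Mutual u w) ∧ ∀ u w, P.Mutual u w → w ∉ M u →
      d < ((P.prefU u).rank w - P.posU M u) + ((P.prefW w).rank u - P.posW M w) := by
  classical
  constructor
  · intro h
    have hself : P.swapDist P ≤ (d : ℕ∞) := by simp [swapDist, PrefList.swapDist_self]
    refine ⟨(h P hself).1, fun u w huw hM => ?_⟩
    by_contra! hcon
    -- No swap is needed if the owner is unmatched or already prefers `b` to the partner; the
    -- truncated difference is `0` in both cases.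
    have promote : ∀ (l : PrefList n) (o : Option (Fin n)) (b : Fin n), l.Accepts b →
        (∀ a ∈ o, l.Accepts a) → b ∉ o → ∃ l' : PrefList n, (∀ x, l.Accepts x ↔ l'.Accepts x) ∧
          (∀ a ∈ o, l'.rank b < l'.rank a) ∧
          l.swapDist l' ≤ ((l.rank b - l.partnerRank o : ℕ) : ℕ∞) := by
      intro l o b hb ho hbo
      cases o with
      | none => exact ⟨l, fun _ => Iff.rfl, by simp, by simp [PrefList.swapDist_self]⟩
      | some a =>
        have ha := ho a rfl
        rcases lt_trichotomy (l.rank a) (l.rank b) with hlt | heq | hlt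
        · obtain ⟨l', h1, h2, h3⟩ := l.exists_swapDist_le ha hb hlt
          exact ⟨l', h1, by rintro _ ⟨⟩; exact h2, h3⟩
        · exact absurd (congrArg some (PrefList.rank_inj ha heq)) hbo
        · exact ⟨l, fun _ => Iff.rfl, by rintro _ ⟨⟩; exact hlt, by simp [PrefList.swapDist_self]⟩
    obtain ⟨l, hl1, hl2, hl3⟩ := promote (P.prefU u) (M u) w huw.1
      (fun a ha => ((h P hself).1 u a ha).1) hM
    obtain ⟨m, hm1, hm2, hm3⟩ := promote (P.prefW w) (M.symm w) u huw.2
      (fun a ha => ((h P hself).1 a w (M.mem_iff_mem.1 ha)).2) (fun h => hM (M.mem_iff_mem.1 h))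
    have hsum : ∀ (f : Fin n → PrefList n) (i : Fin n) (l : PrefList n),
        ∑ j, (f j).swapDist (Function.update f i l j) = (f i).swapDist l := by
      intro f i l
      rw [Finset.sum_eq_single i]
      · simp
      · intro j _ hj
        simp [Function.update_of_ne hj, PrefList.swapDist_self]
      · simp
    have hdist : P.swapDist ⟨Function.update P.prefU u l, Function.update P.prefW w m⟩ ≤ (d : ℕ∞) := by
      rw [swapDist, hsum, hsum]
      refine (add_le_add hl3 hm3).trans ?_
      exact_mod_cast hcon
    refine (h _ hdist).2 u w ⟨?_, hM, ?_, ?_⟩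
    · exact ⟨by simpa using (hl1 w).1 huw.1, by simpa using (hm1 u).1 huw.2⟩
    · simpa using hl2
    · simpa using hm2
  · rintro ⟨hmut, hcost⟩ Q hQ
    have hU : ∀ u, (P.prefU u).swapDist (Q.prefU u) ≤ ∑ u, (P.prefU u).swapDist (Q.prefU u) :=
      fun u => Finset.single_le_sum (f := fun u => (P.prefU u).swapDist (Q.prefU u))
        (fun _ _ => zero_le) (Finset.mem_univ u)
    have hW : ∀ w, (P.prefW w).swapDist (Q.prefW w) ≤ ∑ w, (P.prefW w).swapDist (Q.prefW w) :=
      fun w => Finset.single_le_sum (f := fun w => (P.prefW w).swapDist (Q.prefW w))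
        (fun _ _ => zero_le) (Finset.mem_univ w)
    have hfin : ∀ l l' : PrefList n, l.swapDist l' ≤ (d : ℕ∞) →
        ∀ x, l.Accepts x ↔ l'.Accepts x := by
      intro l l' h
      by_contra hcon
      rw [PrefList.swapDist, if_neg hcon] at h
      simp at h
    have hUac := fun u => hfin _ _ (((hU u).trans le_self_add).trans hQ)
    have hWac := fun w => hfin _ _ (((hW w).trans le_add_self).trans hQ)
    refine ⟨fun u w h => ⟨(hUac u w).1 (hmut u w h).1, (hWac w u).1 (hmut u w h).2⟩, ?_⟩
    rintro u w ⟨hQm, hM, h1, h2⟩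
    have hPm : P.Mutual u w := ⟨(hUac u w).2 hQm.1, (hWac w u).2 hQm.2⟩
    have hlt := hcost u w hPm hM
    have bound : ∀ (l l' : PrefList n) (o : Option (Fin n)) (b : Fin n),
        (∀ x, l.Accepts x ↔ l'.Accepts x) → l.Accepts b → (∀ a ∈ o, l.Accepts a) →
        (∀ a, a ∈ o → l'.rank b < l'.rank a) →
        ((l.rank b - l.partnerRank o : ℕ) : ℕ∞) ≤ l.swapDist l' := by
      intro l l' o b hac hb ho hlt
      cases o with
      | none =>
        -- For an unmatched owner `partnerRank` is the length of the list, which exceeds every rank,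
        -- so the margin is truncated to `0`.
        have := PrefList.rank_lt_length.2 hb
        have h0 : l.rank b - l.partnerRank none = 0 := by simp only [PrefList.partnerRank]; omega
        rw [h0]
        simp
      | some a => exact PrefList.le_swapDist hac (ho a rfl) hb (hlt a rfl)
    have b1 := bound _ _ (M u) w (hUac u) hPm.1 (fun a ha => (hmut u a ha).1) h1
    have b2 := bound _ _ (M.symm w) u (hWac w) hPm.2
      (fun a ha => (hmut a w (M.mem_iff_mem.1 ha)).2) h2
    have hle := (add_le_add (b1.trans (hU u)) (b2.trans (hW w))).trans hQ
    have : ((P.prefU u).rank w - P.posU M u) + ((P.prefW w).rank u - P.posW M w) ≤ d := by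
      exact_mod_cast hle
    omega

end PrefProfile

/-! ### Deferred acceptance with slack `d`. -/

namespace PrefProfile

variable {n : ℕ}

theorem Robust.mutual {P : PrefProfile n} {d : ℕ} {M : Matching n} (h : P.Robust d M) {u w : Fin n}
    (huw : w ∈ M u) : P.Mutual u w :=
  (robust_iff.1 h).1 u w huw

theorem Robust.lt_add {P : PrefProfile n} {d : ℕ} {M : Matching n} (h : P.Robust d M) {u w : Fin n}
    (huw : P.Mutual u w) (hM : w ∉ M u) :
    d < ((P.prefU u).rank w - P.posU M u) + ((P.prefW w).rank u - P.posW M w) :=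
  (robust_iff.1 h).2 u w huw hM

/-- The positions of `U` determine a robust matching: an unmatched agent has the length of its list
as position, where the lookup yields `none`. -/
theorem Robust.getElem?_posU {P : PrefProfile n} {d : ℕ} {M : Matching n} (h : P.Robust d M)
    (u : Fin n) : (P.prefU u).1[P.posU M u]? = M u := by
  cases hM : M u with
  | none => simp [posU, hM, PrefList.partnerRank]
  | some w =>
    have := h.mutual (Option.mem_def.2 hM)
    rw [posU_of_mem (Option.mem_def.2 hM), PrefList.getElem?_rank this.1]

theorem posU_le_length (P : PrefProfile n) (M : Matching n) (u : Fin n) :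
    P.posU M u ≤ (P.prefU u).1.length :=
  PrefList.rank_partner_le_length _ _

theorem posU_le (P : PrefProfile n) (M : Matching n) (u : Fin n) : P.posU M u ≤ n :=
  (P.posU_le_length M u).trans (PrefList.length_le _)

theorem posW_of_unmatched {P : PrefProfile n} {M : Matching n} {w : Fin n} (h : ∀ u, w ∉ M u) :
    P.posW M w = (P.prefW w).1.length := by
  have : M.symm w = none := by
    rw [Option.eq_none_iff_forall_not_mem]
    exact fun u hu => h u (M.mem_iff_mem.1 hu)
  rw [posW, this]
  rfl

theorem posU_of_unmatched {P : PrefProfile n} {M : Matching n} {u : Fin n} (h : ∀ w, w ∉ M u) :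
    P.posU M u = (P.prefU u).1.length := by
  have : M u = none := by
    rw [Option.eq_none_iff_forall_not_mem]
    exact h
  rw [posU, this]
  rfl

/-- The matching contains no forbidden pair. -/
def Avoids (M : Matching n) (F : Fin n → Fin n → Prop) : Prop := ∀ u w, w ∈ M u → ¬ F u w

/-- If each `u'` gets at best the partner in position `x u'` of the list, then `u` and `w` cannot
be partners in a `d`-robust matching that avoids `F`. -/
def Rejected (P : PrefProfile n) (d : ℕ) (F : Fin n → Fin n → Prop) (x : Fin n → ℕ)
    (u w : Fin n) : Prop :=
  ¬ (P.prefW w).Accepts u ∨ F u w ∨ ∃ u', u' ≠ u ∧ P.Mutual u' w ∧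
    ((P.prefU u').rank w - x u') + ((P.prefW w).rank u' - (P.prefW w).rank u) ≤ d

/-- No agent is rejected by the partner in position `x`. -/
def Stuck (P : PrefProfile n) (d : ℕ) (F : Fin n → Fin n → Prop) (x : Fin n → ℕ) : Prop :=
  ∀ u w, (P.prefU u).1[x u]? = some w → ¬ P.Rejected d F x u w

/-- No agent can be made to block together with an agent that is not in any position `x`. -/
def Covered (P : PrefProfile n) (d : ℕ) (x : Fin n → ℕ) : Prop :=
  ∀ u w, P.Mutual u w → (∃ u', (P.prefU u').1[x u']? = some w) ∨ d < (P.prefU u).rank w - x u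

/-- If equality held, `u` and `w` would be partners in `M`. The margin of `u'` in `M` is at most the
one computed from `x u'`, so the pair `{u', w}` would violate robustness. -/
theorem lt_posU_of_rejected {P : PrefProfile n} {d : ℕ} {F : Fin n → Fin n → Prop}
    {x : Fin n → ℕ} {M : Matching n} (hM : P.Robust d M) (hF : Avoids M F)
    (hx : ∀ u, x u ≤ P.posU M u) {u w : Fin n} (hw : (P.prefU u).1[x u]? = some w)
    (hr : P.Rejected d F x u w) : x u < P.posU M u := by
  refine lt_of_le_of_ne (hx u) fun he => ?_
  rw [he, hM.getElem?_posU] at hw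
  have hmem : w ∈ M u := hw
  rcases hr with hr | hr | ⟨u', hne, hmut, hle⟩
  · exact hr (hM.mutual hmem).2
  · exact hF u w hmem hr
  · have hn : w ∉ M u' := fun h => hne (M.inj h hmem)
    have := hM.lt_add hmut hn
    rw [posW_of_mem hmem] at this
    have := hx u'
    omega

/-- When two agents point to the same `w`, both have margin `0` there, so the one that `w` likes
less is rejected because of the other. -/
theorem Stuck.inj {P : PrefProfile n} {d : ℕ} {F : Fin n → Fin n → Prop} {x : Fin n → ℕ}
    (h : P.Stuck d F x) {u u' w : Fin n} (hu : (P.prefU u).1[x u]? = some w)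
    (hu' : (P.prefU u').1[x u']? = some w) : u = u' := by
  by_contra hne
  have key : ∀ u u', u' ≠ u → (P.prefU u).1[x u]? = some w → (P.prefU u').1[x u']? = some w →
      (P.prefW w).rank u < (P.prefW w).rank u' := by
    intro u u' hne hu hu'
    by_contra hcon
    have h' := h u' w hu'
    obtain ⟨ha', hr'⟩ := PrefList.getElem?_eq_some_iff.1 hu'
    refine h u w hu (.inr (.inr ⟨u', hne, ⟨ha', ?_⟩, by omega⟩))
    by_contra hacc
    exact h' (.inl hacc)
  have h1 := key u u' (Ne.symm hne) hu hu'
  have h2 := key u' u hne hu' hu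
  omega

/-- For `w` with a partner, absence of rejection is precisely the margin condition for pairs
containing `w`. For unmatched `w` the margin of `w` is `0`, and `Covered` supplies what remains. -/
theorem Stuck.exists_robust {P : PrefProfile n} {d : ℕ} {F : Fin n → Fin n → Prop} {x : Fin n → ℕ}
    (h : P.Stuck d F x) (hc : P.Covered d x) (hx : ∀ u, x u ≤ (P.prefU u).1.length) :
    ∃ M : Matching n, P.Robust d M ∧ Avoids M F ∧ (∀ u, M u = (P.prefU u).1[x u]?) ∧
      ∀ u, P.posU M u = x u := by
  classical
  let M : Matching n :=
    { toFun := fun u => (P.prefU u).1[x u]?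
      invFun := fun w => if h : ∃ u, (P.prefU u).1[x u]? = some w then some h.choose else none
      inv := by
        intro u w
        by_cases hw : ∃ u, (P.prefU u).1[x u]? = some w
        · simp only [hw, dif_pos, Option.some.injEq]
          constructor
          · rintro rfl
            exact hw.choose_spec
          · exact fun hu => h.inj hw.choose_spec hu
        · simp only [hw, dif_neg, not_false_eq_true, reduceCtorEq, false_iff]
          exact fun hu => hw ⟨u, hu⟩ }
  have hM : ∀ u w, w ∈ M u ↔ (P.prefU u).1[x u]? = some w := fun u w => Iff.rfl
  have hpos : ∀ u, P.posU M u = x u := by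
    intro u
    cases hu : (P.prefU u).1[x u]? with
    | none =>
      have h1 := List.getElem?_eq_none_iff.1 hu
      rw [posU_of_unmatched fun w hw => by rw [hM, hu] at hw; simp at hw]
      exact le_antisymm h1 (hx u)
    | some w => rw [posU_of_mem ((hM u w).2 hu), (PrefList.getElem?_eq_some_iff.1 hu).2]
  have hmut : ∀ u w, w ∈ M u → P.Mutual u w := by
    intro u w hw
    refine ⟨(PrefList.getElem?_eq_some_iff.1 ((hM u w).1 hw)).1, ?_⟩
    by_contra hacc
    exact h u w hw (.inl hacc)
  refine ⟨M, robust_iff.2 ⟨hmut, fun u w huw hn => ?_⟩,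
    fun u w hw hF => h u w hw (.inr (.inl hF)), fun _ => rfl, hpos⟩
  rw [hpos]
  by_cases hw : ∃ u', (P.prefU u').1[x u']? = some w
  · obtain ⟨u', hu'⟩ := hw
    rw [posW_of_mem ((hM u' w).2 hu')]
    by_contra hcon
    exact h u' w hu' (.inr (.inr ⟨u, by rintro rfl; exact hn hu', huw, by omega⟩))
  · rcases hc u w huw with h' | h'
    · exact absurd h' hw
    · omega

/-- A counting argument shows that the agents of `W` held at `x` are exactly those matched in `M`.
An agent `w` not held is then unmatched in `M`, so robustness of `M` leaves the whole margin to `u`,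
and passing from `M` to the smaller `x u` only increases it. -/
theorem Stuck.covered {P : PrefProfile n} {d : ℕ} {F : Fin n → Fin n → Prop} {x : Fin n → ℕ}
    (h : P.Stuck d F x) {M : Matching n} (hM : P.Robust d M) (hx : ∀ u, x u ≤ P.posU M u) :
    P.Covered d x := by
  classical
  have hB : ∀ u : {u // ∃ w, (P.prefU u).1[x u]? = some w},
      ∃ a : {a // ∃ w, w ∈ M a}, ∃ w, (P.prefU u.1).1[x u.1]? = some w ∧ w ∈ M a.1 := by
    rintro ⟨u, w, hw⟩
    by_contra hcon
    have hun : ∀ a, w ∉ M a := fun a ha => hcon ⟨⟨a, w, ha⟩, w, hw, ha⟩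
    obtain ⟨hacc, hr⟩ := PrefList.getElem?_eq_some_iff.1 hw
    have hmut : P.Mutual u w := ⟨hacc, by
      by_contra hacc
      exact h u w hw (.inl hacc)⟩
    have := hM.lt_add hmut (hun u)
    rw [posW_of_unmatched hun] at this
    have := PrefList.rank_lt_length.2 hmut.2
    have := hx u
    omega
  -- `φ` sends an agent holding `w` at `x` to the partner of `w` in `M`. Such a partner exists,
  -- since otherwise the holder and `w` would both have margin `0` in `M`.
  choose φ g hg hφ using hB
  have hinj : Function.Injective φ := by
    intro u v huv
    have h1 := hφ u
    have h2 := hφ v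
    rw [huv] at h1
    have hgg : g u = g v := Option.mem_unique h1 h2
    have h3 := hg u
    rw [hgg] at h3
    exact Subtype.ext (h.inj h3 (hg v))
  -- An agent matched in `M` has its position in `M` inside its list, hence `x` is inside the list
  -- as well. Thus `φ` is an injection into a set that is not larger, and so surjective.
  have hcard : Nat.card {a // ∃ w, w ∈ M a} ≤ Nat.card {u // ∃ w, (P.prefU u).1[x u]? = some w} := by
    refine Nat.card_le_card_of_injective (fun a => ⟨a.1, ?_⟩) (fun a b hab => ?_)
    · obtain ⟨a, w, hw⟩ := a
      have h1 := PrefList.rank_lt_length.2 (hM.mutual hw).1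
      have h2 := posU_of_mem (P := P) hw
      have h3 := hx a
      exact ⟨_, List.getElem?_eq_getElem (show x a < (P.prefU a).1.length by omega)⟩
    · simpa [Subtype.ext_iff] using hab
  have hsurj : Function.Surjective φ := (hinj.bijective_of_nat_card_le hcard).2
  intro u w huw
  by_cases hw : ∃ a, w ∈ M a
  · obtain ⟨a, ha⟩ := hw
    obtain ⟨v, hv⟩ := hsurj ⟨a, w, ha⟩
    have h1 := hφ v
    rw [hv] at h1
    exact .inl ⟨v, by rw [hg v, Option.mem_unique h1 ha]⟩
  · right
    have hun : ∀ a, w ∉ M a := fun a ha => hw ⟨a, ha⟩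
    have := hM.lt_add huw (hun u)
    rw [posW_of_unmatched hun] at this
    have := PrefList.rank_lt_length.2 huw.2
    have := hx u
    omega

/-! ### The lattice of robust matchings -/

/-- In `M'` the pair `{u, w}` is not matched and `u` has margin `0`, so `w` must have positive
margin. -/
theorem Robust.posW_lt {P : PrefProfile n} {d : ℕ} {M M' : Matching n} (h : P.Robust d M)
    (h' : P.Robust d M') {u w : Fin n} (hw : w ∈ M u) (hlt : P.posU M u < P.posU M' u) :
    P.posW M' w < P.posW M w := by
  have hn : w ∉ M' u := fun hw' => by
    rw [posU_of_mem hw, posU_of_mem hw'] at hlt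
    omega
  have := h'.lt_add (h.mutual hw) hn
  rw [posU_of_mem hw] at hlt
  rw [posW_of_mem hw]
  omega

theorem Robust.posU_lt {P : PrefProfile n} {d : ℕ} {M M' : Matching n} (h : P.Robust d M)
    (h' : P.Robust d M') {u w : Fin n} (hw : w ∈ M' u) (hlt : P.posW M' w < P.posW M w) :
    P.posU M u < P.posU M' u := by
  have hn : w ∉ M u := fun hw' => by
    rw [posW_of_mem hw, posW_of_mem hw'] at hlt
    omega
  have := h.lt_add (h'.mutual hw) hn
  rw [posW_of_mem hw] at hlt
  rw [posU_of_mem hw]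
  omega

/-- The agents of `U` strictly better off in `M` inject via `M` into the agents of `W` strictly
better off in `M'`, and these inject back via `M'`. By finiteness the first injection is onto. -/
theorem Robust.exists_of_posW_lt {P : PrefProfile n} {d : ℕ} {M M' : Matching n}
    (h : P.Robust d M) (h' : P.Robust d M') {w : Fin n} (hlt : P.posW M' w < P.posW M w) :
    ∃ u, w ∈ M u ∧ P.posU M u < P.posU M' u := by
  classical
  have hA : ∀ u : {u // P.posU M u < P.posU M' u}, ∃ w : {w // P.posW M' w < P.posW M w},
      w.1 ∈ M u.1 := by
    rintro ⟨u, hu⟩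
    by_cases hw : ∃ w, w ∈ M u
    · obtain ⟨w, hw⟩ := hw
      exact ⟨⟨w, h.posW_lt h' hw hu⟩, hw⟩
    · rw [posU_of_unmatched fun w hw' => hw ⟨w, hw'⟩] at hu
      have := P.posU_le_length M' u
      omega
  have hB : ∀ w : {w // P.posW M' w < P.posW M w}, ∃ u : {u // P.posU M u < P.posU M' u},
      w.1 ∈ M' u.1 := by
    rintro ⟨w, hw⟩
    by_cases hu : ∃ u, w ∈ M' u
    · obtain ⟨u, hu⟩ := hu
      exact ⟨⟨u, h.posU_lt h' hu hw⟩, hu⟩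
    · rw [posW_of_unmatched fun u hu' => hu ⟨u, hu'⟩] at hw
      have : P.posW M w ≤ _ := PrefList.rank_partner_le_length _ _
      omega
  choose φ hφ using hA
  choose ψ hψ using hB
  have hφi : Function.Injective φ := by
    intro u v huv
    have h1 := hφ u
    rw [huv] at h1
    exact Subtype.ext (M.inj h1 (hφ v))
  have hψi : Function.Injective ψ := by
    intro u v huv
    have h1 := hψ u
    rw [huv] at h1
    exact Subtype.ext (Option.mem_unique h1 (hψ v))
  obtain ⟨u, hu⟩ := (hφi.bijective_of_nat_card_le (Nat.card_le_card_of_injective ψ hψi)).2 ⟨w, hlt⟩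
  have h1 := hφ u
  rw [hu] at h1
  exact ⟨u.1, h1, u.2⟩

/-- Otherwise `Robust.exists_of_posW_lt` gives a partner of `w` in `M`, necessarily `u`, that is
strictly better off in `M`. -/
theorem Robust.posW_le {P : PrefProfile n} {d : ℕ} {M M' : Matching n} (h : P.Robust d M)
    (h' : P.Robust d M') {u w : Fin n} (hw : w ∈ M u) (hle : P.posU M' u ≤ P.posU M u) :
    P.posW M w ≤ P.posW M' w := by
  by_contra hcon
  obtain ⟨v, hv, hlt⟩ := h.exists_of_posW_lt h' (not_le.1 hcon)
  rw [M.inj hv hw] at hlt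
  omega

/-- All robust matchings match the same agents. -/
theorem Robust.matched {P : PrefProfile n} {d : ℕ} {M M' : Matching n} (h : P.Robust d M)
    (h' : P.Robust d M') {w : Fin n} (hw : ∃ u, w ∈ M u) : ∃ u, w ∈ M' u := by
  by_contra hcon
  have h1 := posW_of_unmatched (P := P) fun u hu => hcon ⟨u, hu⟩
  obtain ⟨u, hu⟩ := hw
  have h2 := PrefList.rank_lt_length.2 (h.mutual hu).2
  rw [← posW_of_mem hu] at h2
  obtain ⟨v, hv, -⟩ := h'.exists_of_posW_lt h (w := w) (by omega)
  exact hcon ⟨v, hv⟩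

/-- The pointwise maximum of the positions is stuck and covered, so `Stuck.exists_robust` applies.
Whoever gets `w` in the maximum is the partner that `w` likes best among its partners in `M` and
`M'`. -/
theorem Robust.exists_sup {P : PrefProfile n} {d : ℕ} {M M' : Matching n} (h : P.Robust d M)
    (h' : P.Robust d M') : ∃ M'' : Matching n, P.Robust d M'' ∧
      (∀ u, P.posU M'' u = max (P.posU M u) (P.posU M' u)) ∧
      ∀ w, P.posW M'' w ≤ P.posW M w ∧ P.posW M'' w ≤ P.posW M' w := by
  have hstuck : P.Stuck d (fun _ _ => False) (fun u => max (P.posU M u) (P.posU M' u)) := by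
    have key : ∀ M M' : Matching n, P.Robust d M → P.Robust d M' → ∀ u w,
        P.posU M' u ≤ P.posU M u → (P.prefU u).1[P.posU M u]? = some w →
        ¬ P.Rejected d (fun _ _ => False) (fun u => max (P.posU M u) (P.posU M' u)) u w := by
      intro M M' h h' u w hle hw
      rw [h.getElem?_posU] at hw
      have hmem : w ∈ M u := hw
      have hWle := h.posW_le h' hmem hle
      rintro (hr | hr | ⟨v, hne, hmut, hcost⟩)
      · exact hr (h.mutual hmem).2
      · exact hr
      · simp only at hcost
        rcases le_total (P.posU M' v) (P.posU M v) with hv | hv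
        · rw [max_eq_left hv] at hcost
          have := h.lt_add hmut fun hv => hne (M.inj hv hmem)
          rw [posW_of_mem hmem] at this
          omega
        · rw [max_eq_right hv] at hcost
          rw [posW_of_mem hmem] at hWle
          -- If `w` is the partner of `v` in `M'`, the comparisons in both directions give `u` and
          -- `v` the same rank for `w`, so they coincide. Otherwise the margin condition of `M'`
          -- applies, and `w` has at least that margin in `M`.
          by_cases hvM : w ∈ M' v
          · have h1 := h'.posW_le h hvM hv
            rw [posW_of_mem hmem, posW_of_mem hvM] at h1
            rw [posW_of_mem hvM] at hWle
            exact hne (PrefList.rank_inj hmut.2 (by omega))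
          · have := h'.lt_add hmut hvM
            omega
    intro u w hw
    simp only at hw
    rcases le_total (P.posU M' u) (P.posU M u) with hu | hu
    · rw [max_eq_left hu] at hw
      exact key M M' h h' u w hu hw
    · rw [max_eq_right hu] at hw
      have := key M' M h' h u w hu hw
      simpa only [max_comm] using this
  have hcov : P.Covered d (fun u => max (P.posU M u) (P.posU M' u)) := by
    intro u w huw
    by_cases hw : ∃ v, w ∈ M v
    · left
      -- The partner that `w` prefers is no better off with `w` than in the other matching, and so
      -- keeps `w` in the maximum.
      have hit : ∀ M M' : Matching n, P.Robust d M → P.Robust d M' → ∀ u, w ∈ M u →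
          P.posW M w ≤ P.posW M' w →
          (P.prefU u).1[max (P.posU M u) (P.posU M' u)]? = some w := by
        intro M M' h h' u hu hle
        have : P.posU M' u ≤ P.posU M u := by
          by_contra hcon
          have := h.posW_lt h' hu (not_le.1 hcon)
          omega
        rw [max_eq_left this, h.getElem?_posU]
        exact hu
      rcases le_total (P.posW M w) (P.posW M' w) with hle | hle
      · obtain ⟨v, hv⟩ := hw
        exact ⟨v, hit M M' h h' v hv hle⟩
      · obtain ⟨v, hv⟩ := h.matched h' hw
        exact ⟨v, by simpa only [max_comm] using hit M' M h' h v hv hle⟩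
    · right
      have h1 : ∀ v, w ∉ M v := fun v hv => hw ⟨v, hv⟩
      have h2 : ∀ v, w ∉ M' v := fun v hv => hw (h'.matched h ⟨v, hv⟩)
      have c1 := h.lt_add huw (h1 u)
      have c2 := h'.lt_add huw (h2 u)
      rw [posW_of_unmatched h1] at c1
      rw [posW_of_unmatched h2] at c2
      have := PrefList.rank_lt_length.2 huw.2
      simp only
      omega
  obtain ⟨M'', hM'', -, hget, hpos⟩ := hstuck.exists_robust hcov
    (fun u => max_le (P.posU_le_length M u) (P.posU_le_length M' u))
  refine ⟨M'', hM'', hpos, fun w => ?_⟩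
  by_cases hw : ∃ u, w ∈ M'' u
  · obtain ⟨u, hu⟩ := hw
    have hu' := hu
    rw [Option.mem_def, hget] at hu
    rw [posW_of_mem hu']
    rcases le_total (P.posU M' u) (P.posU M u) with hle | hle
    · rw [max_eq_left hle, h.getElem?_posU] at hu
      have := h.posW_le h' hu hle
      rw [posW_of_mem hu] at this ⊢
      exact ⟨le_rfl, this⟩
    · rw [max_eq_right hle, h'.getElem?_posU] at hu
      have := h'.posW_le h hu hle
      rw [posW_of_mem hu] at this ⊢
      exact ⟨this, le_rfl⟩
  · have h1 : ∀ u, w ∉ M u := fun u hu => hw (h.matched hM'' ⟨u, hu⟩)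
    have h2 : ∀ u, w ∉ M' u := fun u hu => hw (h'.matched hM'' ⟨u, hu⟩)
    rw [posW_of_unmatched h1, posW_of_unmatched h2,
      posW_of_unmatched fun u hu => hw ⟨u, hu⟩]
    exact ⟨le_rfl, le_rfl⟩

end PrefProfile

/-! ### Minimum egalitarian cost -/

/-- A matching `mu` of `p < N` to `q < N` along `Adj` (where `mu p = q + 1` if `p` is matched to
`q`), together with a set `reach` that certifies that `mu` is a maximum matching. -/
structure MatchingCert (N : ℕ) (Adj : ℕ → ℕ → Prop) (act : ℕ → Prop) (mu : ℕ → ℕ)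
    (reach : ℕ → Prop) : Prop where
  adj : ∀ p < N, ∀ q, mu p = q + 1 → q < N ∧ Adj p q
  inj : ∀ p < N, ∀ p' < N, ∀ q, mu p = q + 1 → mu p' = q + 1 → p = p'
  reach_act : ∀ p < N, reach p → act p
  unmatched : ∀ p < N, act p → mu p = 0 → reach p
  closed : ∀ p < N, ∀ q < N, reach p → Adj p q → ∃ v < N, reach v ∧ mu v = q + 1

/-- Let the set `Y` require its neighbours `A`; the set `Z` contains at least `reach`, and requires
only neighbours `C` of `reach`. Then `Z` is at least as good as `Y`. -/
theorem MatchingCert.card_add_card_le {N : ℕ} {Adj : ℕ → ℕ → Prop} {act : ℕ → Prop} {mu : ℕ → ℕ}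
    {reach : ℕ → Prop} (h : MatchingCert N Adj act mu reach) {Y Z A C : Finset ℕ}
    (hY : ∀ p ∈ Y, p < N ∧ act p) (hA : ∀ p ∈ Y, ∀ q, q < N → Adj p q → q ∈ A)
    (hZ : ∀ p < N, reach p → p ∈ Z) (hC : ∀ q ∈ C, q < N ∧ ∃ p < N, reach p ∧ Adj p q) :
    C.card + Y.card ≤ A.card + Z.card := by
  classical
  -- The matched members of `Y` inject into `A` along `mu`, while the unmatched ones lie in `reach`.
  -- Since `C` injects into the matched members of `reach`, both parts together are bounded by
  -- `A.card` plus the size of `reach`.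
  have h1 : (Y.filter fun p => mu p ≠ 0).card ≤ A.card := by
    refine Finset.card_le_card_of_injOn (fun p => mu p - 1) ?_ ?_
    · intro p hp
      simp only [Finset.coe_filter, Set.mem_ofPred_eq] at hp
      obtain ⟨hq, ha⟩ := h.adj p (hY p hp.1).1 (mu p - 1) (by omega)
      exact hA p hp.1 _ hq ha
    · intro p hp p' hp' he
      simp only [Finset.coe_filter, Set.mem_ofPred_eq] at hp hp' he
      exact h.inj p (hY p hp.1).1 p' (hY p' hp'.1).1 (mu p - 1) (by omega) (by omega)
  set R := (Finset.range N).filter fun p => reach p with hR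
  have h2 : C.card ≤ (R.filter fun p => mu p ≠ 0).card := by
    have hex : ∀ q ∈ C, ∃ v < N, reach v ∧ mu v = q + 1 := by
      intro q hq
      obtain ⟨hqN, p, hp, hr, ha⟩ := hC q hq
      exact h.closed p hp q hqN hr ha
    choose! v hv using hex
    refine Finset.card_le_card_of_injOn v ?_ ?_
    · intro q hq
      have := hv q hq
      simp only [hR, Finset.coe_filter, Finset.mem_filter, Finset.mem_range, Set.mem_ofPred_eq]
      exact ⟨⟨this.1, this.2.1⟩, by omega⟩
    · intro q hq q' hq' he
      have h1 := hv q hq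
      have h2 := hv q' hq'
      rw [he] at h1
      omega
  have h3 : (Y.filter fun p => ¬ mu p ≠ 0).card ≤ (R.filter fun p => ¬ mu p ≠ 0).card := by
    refine Finset.card_le_card fun p hp => ?_
    simp only [Finset.mem_filter, not_not, hR, Finset.mem_range] at hp ⊢
    exact ⟨⟨(hY p hp.1).1, h.unmatched p (hY p hp.1).1 (hY p hp.1).2 hp.2⟩, hp.2⟩
  have h4 : R.card ≤ Z.card := by
    refine Finset.card_le_card fun p hp => ?_
    simp only [Finset.mem_filter, hR, Finset.mem_range] at hp
    exact hZ p hp.1 hp.2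
  have h5 := Y.card_filter_add_card_filter_not (fun p => mu p ≠ 0)
  have h6 := R.card_filter_add_card_filter_not (fun p => mu p ≠ 0)
  omega

theorem card_filter_range_mul (m n : ℕ) (Q : ℕ → Prop) [DecidablePred Q] :
    ((Finset.range (m * n)).filter Q).card =
      ∑ w ∈ Finset.range m, ((Finset.range n).filter fun j => Q (w * n + j)).card := by
  simp only [Finset.card_filter]
  induction m with
  | zero => simp
  | succ m ih => rw [Nat.succ_mul, Finset.sum_range_add, ih, Finset.sum_range_succ]

/-! ### The egalitarian cost as a selection problem for rank bounds. -/

namespace PrefProfile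

variable {n : ℕ}

/-- Agent `p / n` of `W` must not get a partner of rank more than `p % n`. -/
def forb (P : PrefProfile n) (p : ℕ) (u w : Fin n) : Prop :=
  (w : ℕ) = p / n ∧ p % n < (P.prefW w).rank u

open Classical in
/-- The rank bounds for agents of `W` that the matching complies with. -/
noncomputable def bounds (P : PrefProfile n) (M : Matching n) : Finset ℕ :=
  (Finset.range (n * n)).filter fun p => Avoids M (P.forb p)

theorem div_mod_of_fin (w j : Fin n) :
    ((w : ℕ) * n + j) / n = w ∧ ((w : ℕ) * n + j) % n = j := by
  have := j.2
  have hn : 0 < n := by omega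
  constructor
  · rw [mul_comm, Nat.mul_add_div hn, Nat.div_eq_of_lt j.2, add_zero]
  · rw [mul_comm, Nat.mul_add_mod, Nat.mod_eq_of_lt j.2]

/-- A matched `w` with partner of rank `r` obeys `n - r` of its `n` bounds, which together with `r`
makes `n`. An unmatched `w` obeys all of them and contributes the length of its list; by
`Robust.matched` it is unmatched in both matchings. -/
theorem Robust.card_bounds_add {P : PrefProfile n} {d : ℕ} {M M' : Matching n}
    (h : P.Robust d M) (h' : P.Robust d M') :
    (P.bounds M).card + ∑ w, P.posW M w = (P.bounds M').card + ∑ w, P.posW M' w := by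
  classical
  have hcard : ∀ M, (P.bounds M).card =
      ∑ w : Fin n, ((Finset.univ : Finset (Fin n)).filter fun j : Fin n =>
        ∀ u, w ∈ M u → (P.prefW w).rank u ≤ j).card := by
    intro M
    rw [bounds, card_filter_range_mul,
      ← Fin.sum_univ_eq_sum_range (fun w => ((Finset.range n).filter _).card)]
    refine Finset.sum_congr rfl fun w _ => ?_
    simp only [Finset.card_filter]
    rw [← Fin.sum_univ_eq_sum_range
      (fun j => if Avoids M (P.forb ((w : ℕ) * n + j)) then 1 else 0)]
    refine Finset.sum_congr rfl fun j _ => ?_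
    congr 1
    obtain ⟨e1, e2⟩ := div_mod_of_fin w j
    simp only [Avoids, forb, e1, e2, Fin.val_inj, eq_iff_iff, not_and, not_lt]
    exact ⟨fun H u hu => H u w hu rfl, fun H u w' hu e => by subst e; exact H u hu⟩
  rw [hcard, hcard, ← Finset.sum_add_distrib, ← Finset.sum_add_distrib]
  refine Finset.sum_congr rfl fun w _ => ?_
  have hm : ∀ M : Matching n, P.Robust d M → (∃ u, w ∈ M u) →
      ((Finset.univ : Finset (Fin n)).filter fun j : Fin n =>
        ∀ u, w ∈ M u → (P.prefW w).rank u ≤ j).card + P.posW M w = n := by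
    rintro M h ⟨u, hu⟩
    have hlt := PrefList.rank_lt_length.2 (h.mutual hu).2
    have hle := PrefList.length_le (P.prefW w)
    rw [posW_of_mem hu]
    have : ((Finset.univ : Finset (Fin n)).filter fun j : Fin n =>
        ∀ u, w ∈ M u → (P.prefW w).rank u ≤ j) =
        Finset.Ici ⟨(P.prefW w).rank u, by omega⟩ := by
      ext j
      simp only [Finset.mem_filter, Finset.mem_univ, true_and, Finset.mem_Ici, Fin.le_def]
      exact ⟨fun H => H u hu, fun H v hv => by rwa [M.inj hv hu]⟩
    rw [this, Fin.card_Ici]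
    simp only
    omega
  by_cases hw : ∃ u, w ∈ M u
  · rw [hm M h hw, hm M' h' (h.matched h' hw)]
  · have h1 : ∀ u, w ∉ M u := fun u hu => hw ⟨u, hu⟩
    have h2 : ∀ u, w ∉ M' u := fun u hu => hw (h'.matched h ⟨u, hu⟩)
    rw [posW_of_unmatched h1, posW_of_unmatched h2]
    simp [h1, h2]

open Classical in
-- The number `q = u * n + i` encodes the step of `u` past position `i`. For each `u` the counted
-- steps form the interval from `x₀ u` to its position; all of them have `i < n`, as positions are
-- at most `n`.
theorem sum_posU_eq {P : PrefProfile n} {M : Matching n} {x₀ : ℕ → ℕ}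
    (hx₀ : ∀ u : Fin n, x₀ u ≤ P.posU M u) :
    ∑ u, P.posU M u = ∑ u : Fin n, x₀ u + ((Finset.range (n * n)).filter fun q =>
      x₀ (q / n) ≤ q % n ∧ ∃ u : Fin n, (u : ℕ) = q / n ∧ q % n < P.posU M u).card := by
  rw [card_filter_range_mul, ← Fin.sum_univ_eq_sum_range
    (fun w => ((Finset.range n).filter _).card), ← Finset.sum_add_distrib]
  refine Finset.sum_congr rfl fun u _ => ?_
  have : (Finset.range n).filter (fun i => x₀ (((u : ℕ) * n + i) / n) ≤ ((u : ℕ) * n + i) % n ∧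
      ∃ v : Fin n, (v : ℕ) = ((u : ℕ) * n + i) / n ∧ ((u : ℕ) * n + i) % n < P.posU M v) =
      Finset.Ico (x₀ u) (P.posU M u) := by
    ext i
    have hle := P.posU_le M u
    simp only [Finset.mem_filter, Finset.mem_range, Finset.mem_Ico]
    constructor
    · rintro ⟨hi, h1, v, hv, h2⟩
      obtain ⟨e1, e2⟩ := div_mod_of_fin u ⟨i, hi⟩
      simp only at e1 e2
      rw [e1, Fin.val_inj] at hv
      subst hv
      rw [e1, e2] at h1
      rw [e2] at h2
      exact ⟨h1, h2⟩
    · rintro ⟨h1, h2⟩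
      have hi : i < n := by omega
      obtain ⟨e1, e2⟩ := div_mod_of_fin u ⟨i, hi⟩
      simp only at e1 e2
      exact ⟨hi, by rwa [e1, e2], u, e1.symm, by rwa [e2]⟩
  rw [this, Nat.card_Ico]
  have := hx₀ u
  omega

/-- The matching in which each agent of `U` gets the worst of the partners in given matchings. -/
theorem exists_iSup {P : PrefProfile n} {d : ℕ} {M₀ : Matching n} (h₀ : P.Robust d M₀)
    (X : ℕ → ℕ → ℕ) (s : Finset ℕ) (hs : ∀ p ∈ s, ∃ M : Matching n, P.Robust d M ∧
      Avoids M (P.forb p) ∧ ∀ u : Fin n, P.posU M u = X p u) :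
    ∃ M : Matching n, P.Robust d M ∧ (∀ p ∈ s, Avoids M (P.forb p)) ∧
      ∀ (u : Fin n) (i : ℕ), i < P.posU M u ↔ i < P.posU M₀ u ∨ ∃ p ∈ s, i < X p u := by
  classical
  induction s using Finset.induction_on with
  | empty => exact ⟨M₀, h₀, by simp, by simp⟩
  | insert p s hp ih =>
    obtain ⟨M, hM, hav, hpos⟩ := ih fun p hp => hs p (Finset.mem_insert_of_mem hp)
    obtain ⟨M', hM', hav', hpos'⟩ := hs p (Finset.mem_insert_self p s)
    obtain ⟨M'', hM'', hpos'', hW⟩ := hM.exists_sup hM'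
    -- In the join each `w` is at least as well off as before, so no rank bound gets lost.
    have keep : ∀ (M : Matching n), P.Robust d M → (∀ w, P.posW M'' w ≤ P.posW M w) → ∀ p,
        Avoids M (P.forb p) → Avoids M'' (P.forb p) := by
      rintro M hM hle p hav u w hw ⟨h1, h2⟩
      obtain ⟨v, hv⟩ := hM''.matched hM ⟨u, hw⟩
      have := hle w
      rw [posW_of_mem hw, posW_of_mem hv] at this
      exact hav v w hv ⟨h1, by omega⟩
    refine ⟨M'', hM'', ?_, fun u i => ?_⟩
    · intro p' hp'
      rcases Finset.mem_insert.1 hp' with rfl | hp'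
      · exact keep M' hM' (fun w => (hW w).2) _ hav'
      · exact keep M hM (fun w => (hW w).1) _ (hav p' hp')
    · rw [hpos'', lt_max_iff, hpos, hpos', Finset.exists_mem_insert, or_assoc]
      exact or_congr_right or_comm

/-- From the least robust matchings under the various rank bounds for agents of `W`, and a maximum
matching between the bounds and the positions of agents of `U`, one gets a robust matching of
minimum egalitarian cost. -/
theorem exists_isMinEgalRobust {P : PrefProfile n} {d : ℕ} {x₀ : ℕ → ℕ} {X : ℕ → ℕ → ℕ}
    {act reach : ℕ → Prop} {Adj : ℕ → ℕ → Prop} {mu : ℕ → ℕ}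
    (h₀ : ∃ M : Matching n, P.Robust d M ∧ ∀ u : Fin n, P.posU M u = x₀ u)
    (hleast : ∀ M : Matching n, P.Robust d M → ∀ u : Fin n, x₀ u ≤ P.posU M u)
    (hact : ∀ p < n * n, act p → ∃ M : Matching n, P.Robust d M ∧ Avoids M (P.forb p) ∧
      ∀ u : Fin n, P.posU M u = X p u)
    (hX : ∀ p < n * n, ∀ M : Matching n, P.Robust d M → Avoids M (P.forb p) →
      act p ∧ ∀ u : Fin n, X p u ≤ P.posU M u)
    (hAdj : ∀ p < n * n, ∀ q < n * n,
      Adj p q ↔ act p ∧ x₀ (q / n) ≤ q % n ∧ q % n < X p (q / n))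
    (hcert : MatchingCert (n * n) Adj act mu reach) :
    ∃ M : Matching n, P.IsMinEgalRobust d M ∧ ∀ (u : Fin n) (i : ℕ),
      i < P.posU M u ↔ i < x₀ u ∨ ∃ p < n * n, reach p ∧ i < X p u := by
  classical
  obtain ⟨M₀, hM₀, hpos₀⟩ := h₀
  obtain ⟨M, hM, hav, hpos⟩ := exists_iSup hM₀ X ((Finset.range (n * n)).filter reach) (by
    intro p hp
    simp only [Finset.mem_filter, Finset.mem_range] at hp
    exact hact p hp.1 (hcert.reach_act p hp.1 hp.2))
  simp only [Finset.mem_filter, Finset.mem_range, and_assoc, and_imp, hpos₀] at hav hpos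
  refine ⟨M, ⟨hM, fun M' hM' => ?_⟩, hpos⟩
  have e1 := sum_posU_eq (hleast M hM)
  have e2 := sum_posU_eq (hleast M' hM')
  have e3 := hM.card_bounds_add hM'
  have hdiv : ∀ q < n * n, q / n < n := fun q hq => Nat.div_lt_of_lt_mul hq
  -- `Y` holds the bounds obeyed by the competitor and `A` its steps; `Z` and `C` are the same for
  -- the join over `reach`. By `e1`, `e2` and `e3` the inequality for these four sets is the
  -- comparison of costs.
  have key := hcert.card_add_card_le (Y := P.bounds M') (Z := P.bounds M)
    (A := (Finset.range (n * n)).filter fun q =>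
      x₀ (q / n) ≤ q % n ∧ ∃ u : Fin n, (u : ℕ) = q / n ∧ q % n < P.posU M' u)
    (C := (Finset.range (n * n)).filter fun q =>
      x₀ (q / n) ≤ q % n ∧ ∃ u : Fin n, (u : ℕ) = q / n ∧ q % n < P.posU M u) ?_ ?_ ?_ ?_
  · change ∑ u, P.posU M u + ∑ w, P.posW M w ≤ ∑ u, P.posU M' u + ∑ w, P.posW M' w
    omega
  · intro p hp
    simp only [bounds, Finset.mem_filter, Finset.mem_range] at hp
    exact ⟨hp.1, (hX p hp.1 M' hM' hp.2).1⟩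
  · intro p hp q hq ha
    simp only [bounds, Finset.mem_filter, Finset.mem_range] at hp ⊢
    obtain ⟨h1, h2, h3⟩ := (hAdj p hp.1 q hq).1 ha
    exact ⟨hq, h2, ⟨q / n, hdiv q hq⟩, rfl, 
      h3.trans_le ((hX p hp.1 M' hM' hp.2).2 ⟨q / n, hdiv q hq⟩)⟩
  · intro p hp hr
    simp only [bounds, Finset.mem_filter, Finset.mem_range]
    exact ⟨hp, hav p hp hr⟩
  · intro q hq
    simp only [Finset.mem_filter, Finset.mem_range] at hq
    obtain ⟨hq, h1, u, hu, h2⟩ := hq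
    refine ⟨hq, ?_⟩
    rcases (hpos u _).1 h2 with h3 | ⟨p, hp, hr, h3⟩
    · rw [hu] at h3
      omega
    · exact ⟨p, hp, hr, (hAdj p hp q hq).2 ⟨hcert.reach_act p hp hr, h1, by rwa [← hu]⟩⟩

end PrefProfile

/-! ## Reasoning about loop programs -/

namespace RAM

namespace Exp

/-- The test succeeds. -/
def Holds (σ : Store) (e : Exp) (ρ : List ℕ) : Prop := e.eval σ ρ ≠ 0

/-- Negation. -/
def not (a : Exp) : Exp := .sub (.const 1) a

/-- Conjunction. -/
def and (a b : Exp) : Exp := (a.not.add b.not).not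

/-- The test `a ≤ b`. -/
def le (a b : Exp) : Exp := (a.sub b).not

/-- The test `a = b`. -/
def eq (a b : Exp) : Exp := ((a.sub b).add (b.sub a)).not

/-- The truth value of a test, as `0` or `1`. -/
def bool (a : Exp) : Exp := a.not.not

variable (σ : Store) (ρ : List ℕ) (a b : Exp)

@[simp] theorem eval_const (k : ℕ) : (const k).eval σ ρ = k := rfl
@[simp] theorem eval_var (x : ℕ) : (var x).eval σ ρ = σ.var x := rfl
@[simp] theorem eval_bvar_zero (k : ℕ) : (bvar 0).eval σ (k :: ρ) = k := rfl
@[simp] theorem eval_bvar_one (k l : ℕ) : (bvar 1).eval σ (k :: l :: ρ) = l := rfl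
@[simp] theorem eval_cell (t : ℕ) : (cell t a b).eval σ ρ = σ.tab t (a.eval σ ρ) (b.eval σ ρ) := rfl
@[simp] theorem eval_add : (add a b).eval σ ρ = a.eval σ ρ + b.eval σ ρ := rfl
@[simp] theorem eval_sub : (sub a b).eval σ ρ = a.eval σ ρ - b.eval σ ρ := rfl
@[simp] theorem eval_sum (x : ℕ) : (sum x a).eval σ ρ =
    ∑ k ∈ Finset.range (σ.var x), a.eval σ (k :: ρ) := rfl

@[simp] theorem holds_not : a.not.Holds σ ρ ↔ ¬ a.Holds σ ρ := by
  simp only [Holds, not, eval_sub, eval_const]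
  omega

@[simp] theorem holds_add : (a.add b).Holds σ ρ ↔ a.Holds σ ρ ∨ b.Holds σ ρ := by
  simp only [Holds, eval_add]
  omega

@[simp] theorem holds_and : (a.and b).Holds σ ρ ↔ a.Holds σ ρ ∧ b.Holds σ ρ := by
  simp [and]

@[simp] theorem holds_sub : (a.sub b).Holds σ ρ ↔ b.eval σ ρ < a.eval σ ρ := by
  simp only [Holds, eval_sub]
  omega

@[simp] theorem holds_le : (a.le b).Holds σ ρ ↔ a.eval σ ρ ≤ b.eval σ ρ := by
  simp [le]

@[simp] theorem holds_eq : (a.eq b).Holds σ ρ ↔ a.eval σ ρ = b.eval σ ρ := by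
  simp only [eq, holds_not, holds_add, holds_sub]
  omega

@[simp] theorem holds_cell (t : ℕ) : (cell t a b).Holds σ ρ ↔
    σ.tab t (a.eval σ ρ) (b.eval σ ρ) ≠ 0 := Iff.rfl

@[simp] theorem holds_var (x : ℕ) : (var x).Holds σ ρ ↔ σ.var x ≠ 0 := Iff.rfl

@[simp] theorem holds_sum (x : ℕ) : (sum x a).Holds σ ρ ↔ ∃ k < σ.var x, a.Holds σ (k :: ρ) := by
  simp [Holds, Finset.sum_eq_zero_iff]

open Classical in
@[simp] theorem eval_bool : a.bool.eval σ ρ = if a.Holds σ ρ then 1 else 0 := by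
  by_cases h : a.Holds σ ρ
  · have h' : a.eval σ ρ ≠ 0 := h
    simp only [bool, not, eval_sub, eval_const, if_pos h]
    omega
  · have h' : a.eval σ ρ = 0 := not_not.1 h
    simp [bool, not, h, h']

open Classical in
@[simp] theorem eval_le : (a.le b).eval σ ρ = if a.eval σ ρ ≤ b.eval σ ρ then 1 else 0 := by
  simp only [le, not, eval_sub, eval_const]
  split_ifs <;> omega

/-- The quotient of variable `x` by `n`. -/
def divN (x : ℕ) : Exp := .sum 0 (.le (.add (.var 0) (.sum 0 (.bvar 1))) (.var x))

/-- The remainder of variable `x` modulo `n`. -/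
def modN (x : ℕ) : Exp := .sub (.var x) (.sum 0 (divN x))

/-- The quotient counts the `k` with `(k + 1) * n ≤ x`; the hypothesis makes it less than `n`, so
counting over `k < n` misses none. -/
theorem eval_divN {x : ℕ} (h : σ.var x < σ.var 0 * σ.var 0) :
    (divN x).eval σ ρ = σ.var x / σ.var 0 := by
  classical
  have hn : 0 < σ.var 0 := by
    by_contra hcon
    simp [Nat.le_zero.1 (not_lt.1 hcon)] at h
  have hlt : σ.var x / σ.var 0 < σ.var 0 := Nat.div_lt_of_lt_mul h
  simp only [divN, eval_sum, eval_le, eval_add, eval_var, eval_bvar_one, Finset.sum_const,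
    Finset.card_range, smul_eq_mul, ← Finset.card_filter]
  have : (Finset.range (σ.var 0)).filter (fun k => σ.var 0 + σ.var 0 * k ≤ σ.var x) =
      Finset.range (σ.var x / σ.var 0) := by
    ext k
    simp only [Finset.mem_filter, Finset.mem_range]
    have hk : k < σ.var x / σ.var 0 ↔ σ.var 0 + σ.var 0 * k ≤ σ.var x := by
      rw [← Nat.succ_le_iff, Nat.le_div_iff_mul_le hn, Nat.succ_mul, Nat.mul_comm k, Nat.add_comm]
    rw [hk]
    constructor
    · exact fun hk => hk.2
    · intro hk
      refine ⟨?_, hk⟩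
      by_contra hcon
      have := Nat.mul_le_mul_left (σ.var 0) (not_lt.1 hcon)
      omega
  rw [this, Finset.card_range]

theorem eval_modN {x : ℕ} (h : σ.var x < σ.var 0 * σ.var 0) :
    (modN x).eval σ ρ = σ.var x % σ.var 0 := by
  simp only [modN, eval_sub, eval_var, eval_sum, eval_divN σ _ h, Finset.sum_const,
    Finset.card_range, smul_eq_mul]
  have := Nat.div_add_mod (σ.var x) (σ.var 0)
  omega

end Exp

@[simp] theorem Store.setVar_var (σ : Store) (x v y : ℕ) :
    (σ.setVar x v).var y = if y = x then v else σ.var y := rfl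

@[simp] theorem Store.setVar_tab (σ : Store) (x v : ℕ) : (σ.setVar x v).tab = σ.tab := rfl

@[simp] theorem Store.setTab_var (σ : Store) (t i j v : ℕ) : (σ.setTab t i j v).var = σ.var := rfl

@[simp] theorem Store.setTab_tab (σ : Store) (t i j v t' i' j' : ℕ) :
    (σ.setTab t i j v).tab t' i' j' = if t' = t ∧ i' = i ∧ j' = j then v else σ.tab t' i' j' := rfl

namespace Stmt

theorem denote_ite_pos {b : Exp} {p q : Stmt} {σ : Store} (h : b.Holds σ []) :
    (ite b p q).denote σ = p.denote σ :=
  if_pos h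

theorem denote_ite_neg {b : Exp} {p q : Stmt} {σ : Store} (h : ¬ b.Holds σ []) :
    (ite b p q).denote σ = q.denote σ :=
  if_neg h

theorem denote_seq (p q : Stmt) (σ : Store) : (seq p q).denote σ = q.denote (p.denote σ) := rfl

theorem denote_assign (x : ℕ) (a : Exp) (σ : Store) :
    (assign x a).denote σ = σ.setVar x (a.eval σ []) := rfl

theorem denote_write (t : ℕ) (i j a : Exp) (σ : Store) :
    (write t i j a).denote σ = σ.setTab t (i.eval σ []) (j.eval σ []) (a.eval σ []) := rfl

/-- The invariant rule. What the body of the loop does not modify may be taken to be as before the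
loop. -/
theorem denote_loop (p : Stmt) (x b : ℕ) (σ : Store) (Inv : ℕ → Store → Prop) (h0 : Inv 0 σ)
    (hs : ∀ i < σ.var b, ∀ τ : Store, (∀ y, y ∉ x :: p.modV → τ.var y = σ.var y) →
      (∀ t, t ∉ p.modT → τ.tab t = σ.tab t) → Inv i τ → Inv (i + 1) (p.denote (τ.setVar x i))) :
    Inv (σ.var b) ((loop x b p).denote σ) := by
  suffices h : ∀ i ≤ σ.var b, Inv i (iterLoop p.denote x i σ) from h _ le_rfl
  intro i
  induction i with
  | zero => exact fun _ => h0
  | succ i ih =>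
    intro hi
    refine hs i (by omega) _ (fun y hy => ?_) (fun t ht => ?_) (ih (by omega))
    · simp only [List.mem_cons, not_or] at hy
      exact iterLoop_var hy.1 (p.denote_var hy.2) i σ
    · exact iterLoop_tab (p.denote_tab ht) i σ

/-- The memories in `h` may differ from `σ` only in the loop variable and in row `r` of table `t`,
so the value written may depend on other rows of the same table. -/
theorem denote_fillRow {t x b : ℕ} {e a : Exp} {σ : Store} (r : ℕ) (f : ℕ → ℕ)
    (h : ∀ τ : Store, (∀ y, y ≠ x → τ.var y = σ.var y) → (∀ t', t' ≠ t → τ.tab t' = σ.tab t') →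
      (∀ i, i ≠ r → τ.tab t i = σ.tab t i) → ∀ k < σ.var b, τ.var x = k →
      e.eval τ [] = r ∧ a.eval τ [] = f k) (i j : ℕ) :
    ((loop x b (write t e (.var x) a)).denote σ).tab t i j =
      if i = r ∧ j < σ.var b then f j else σ.tab t i j := by
  have := denote_loop (write t e (.var x) a) x b σ (fun k τ => ∀ i j, τ.tab t i j =
      if i = r ∧ j < k then f j else σ.tab t i j) (by simp) ?_
  · exact this i j
  · intro k hk τ hv ht hI i j
    obtain ⟨h1, h2⟩ := h (τ.setVar x k) (fun y hy => by simpa [hy] using hv y (by simpa [modV] using hy))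
      (fun t' ht' => ht t' (by simpa [modT] using ht'))
      (fun i hi => by ext j; simp [hI, hi]) k hk (by simp)
    rw [denote_write, h1, h2]
    by_cases h : i = r ∧ j = k
    · simp [h]
    · have h' : ¬ (True ∧ i = r ∧ j = k) := by simpa using h
      simp only [Store.setTab_tab, Exp.eval_var, Store.setVar_var, if_true, if_neg h',
        Store.setVar_tab, hI]
      congr 1
      rw [eq_iff_iff]
      constructor
      · rintro ⟨h3, h4⟩
        exact ⟨h3, by omega⟩
      · rintro ⟨h3, h4⟩
        refine ⟨h3, ?_⟩
        have : j ≠ k := fun h5 => h ⟨h3, h5⟩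
        omega

theorem denote_fill {t x y b c : ℕ} {a : Exp} {σ : Store} (hxy : x ≠ y) (hc : c ≠ x ∧ c ≠ y)
    (f : ℕ → ℕ → ℕ)
    (h : ∀ τ : Store, (∀ z, z ≠ x → z ≠ y → τ.var z = σ.var z) →
      (∀ t', t' ≠ t → τ.tab t' = σ.tab t') → τ.var x < σ.var b → τ.var y < σ.var c →
      a.eval τ [] = f (τ.var x) (τ.var y)) (i j : ℕ) :
    ((loop x b (loop y c (write t (.var x) (.var y) a))).denote σ).tab t i j =
      if i < σ.var b ∧ j < σ.var c then f i j else σ.tab t i j := by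
  have := denote_loop (loop y c (write t (.var x) (.var y) a)) x b σ (fun k τ => ∀ i j, τ.tab t i j =
      if i < k ∧ j < σ.var c then f i j else σ.tab t i j) (by simp) ?_
  · exact this i j
  · intro k hk τ hv ht hI i j
    have hc' : (τ.setVar x k).var c = σ.var c := by
      simpa [hc.1] using hv c (by simp [modV, hc.1, hc.2])
    rw [denote_fillRow k (f k), hc']
    · by_cases h : i = k
      · subst h
        simp [hI]
      · have hl : i < k + 1 ↔ i < k := by omega
        simp [hI, h, hl]
    · intro τ' hv' ht' _ l hl hy
      have hx : τ'.var x = k := by rw [hv' x hxy]; simp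
      refine ⟨hx, ?_⟩
      rw [h τ' _ _ (by rwa [hx]) (by rw [hy]; rwa [hc'] at hl), hx, hy]
      · intro z hzx hzy
        rw [hv' z hzy, Store.setVar_var, if_neg hzx, hv z (by simp [modV, hzx, hzy])]
      · intro t' h'
        rw [ht' t' h', Store.setVar_tab, ht t' (by simpa [modT] using h')]

end Stmt

end RAM

namespace RAM

variable {n : ℕ}

/-! ## Tables of ranks -/

theorem entry_eq_succ_iff {l : PrefList n} {j : ℕ} {y : Fin n} :
    entry l j = y + 1 ↔ l.1[j]? = some y := by
  unfold entry
  cases l.1[j]? with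
  | none => simp
  | some z => simp [Fin.val_inj]

theorem entry_ne_zero_iff {l : PrefList n} {j : ℕ} :
    entry l j ≠ 0 ↔ ∃ y : Fin n, l.1[j]? = some y ∧ entry l j = y + 1 := by
  unfold entry
  cases l.1[j]? with
  | none => simp
  | some z => simp

/-- One plus the rank of an acceptable agent, and `0` for other agents. -/
def rankEntry (l : PrefList n) (y : Fin n) : ℕ := if l.Accepts y then l.rank y + 1 else 0

theorem rankEntry_ne_zero_iff {l : PrefList n} {y : Fin n} : rankEntry l y ≠ 0 ↔ l.Accepts y := by
  unfold rankEntry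
  split_ifs with h <;> simp [h]

theorem rankEntry_of_accepts {l : PrefList n} {y : Fin n} (h : l.Accepts y) :
    rankEntry l y = l.rank y + 1 :=
  if_pos h

/-- Computes the ranks into table `t'` from the lists in table `t`. -/
def rankStmt (t t' : ℕ) : Stmt :=
  .loop 8 0 (.loop 9 0 (.write t' (.var 8) (.var 9) (.sum 0 (Exp.bool (.sum 0
    (.and (.le (.bvar 1) (.bvar 0)) (.eq (.cell t (.var 8) (.bvar 0)) (.add (.var 9) (.const 1)))))))))

/-- The index of `w` in the list is obtained by counting: exactly the `x` from `0` to the rank have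
an occurrence of `w` at some `k ≥ x`. This count is one plus the rank, and `0` if `w` does not
occur. -/
theorem rankStmt_spec {t t' : ℕ} (htt : t ≠ t') {σ : Store} (f : Fin n → PrefList n)
    (h0 : σ.var 0 = n) (hf : ∀ (u : Fin n) (j : ℕ), σ.tab t u j = entry (f u) j) (u w : Fin n) :
    ((rankStmt t t').denote σ).tab t' u w = rankEntry (f u) w := by
  classical
  rw [rankStmt, Stmt.denote_fill (by decide) (by decide)
    (fun i j => if h : i < n ∧ j < n then rankEntry (f ⟨i, h.1⟩) ⟨j, h.2⟩ else 0)]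
  · simp [h0]
  · intro τ hv ht hi hj
    rw [h0] at hi hj
    have h0' : τ.var 0 = n := by rw [hv 0 (by decide) (by decide), h0]
    simp only [Exp.eval_sum, Exp.eval_bool, Exp.holds_sum, Exp.holds_and, Exp.holds_le,
      Exp.eval_bvar_zero, Exp.eval_bvar_one, Exp.holds_eq, Exp.eval_cell, Exp.eval_var,
      Exp.eval_add, Exp.eval_const, ht t htt, h0', hi, hj, and_self, dif_pos]
    rw [← Finset.card_filter]
    have key : ∀ j, σ.tab t (τ.var 8) j = τ.var 9 + 1 ↔
        (f ⟨τ.var 8, hi⟩).Accepts ⟨τ.var 9, hj⟩ ∧ (f ⟨τ.var 8, hi⟩).rank ⟨τ.var 9, hj⟩ = j :=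
      fun j => by
        rw [← PrefList.getElem?_eq_some_iff, ← entry_eq_succ_iff, ← hf]
    simp only [key]
    unfold rankEntry
    split_ifs with hacc
    · have hlt := (PrefList.rank_lt_length.2 hacc).trans_le (PrefList.length_le _)
      have : (Finset.range n).filter (fun x => ∃ k < n, x ≤ k ∧
          (f ⟨τ.var 8, hi⟩).Accepts ⟨τ.var 9, hj⟩ ∧ (f ⟨τ.var 8, hi⟩).rank ⟨τ.var 9, hj⟩ = k) =
          Finset.range ((f ⟨τ.var 8, hi⟩).rank ⟨τ.var 9, hj⟩ + 1) := by
        ext x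
        simp only [Finset.mem_filter, Finset.mem_range]
        constructor
        · rintro ⟨-, k, -, h, -, rfl⟩
          omega
        · exact fun h => ⟨by omega, _, hlt, by omega, hacc, rfl⟩
      rw [this, Finset.card_range]
    · simp [hacc]

/-- The memory holds the instance and the ranks. -/
structure Base (P : PrefProfile n) (d : ℕ) (σ : Store) : Prop where
  size : σ.var 0 = n
  bound : σ.var 1 = d
  sq : σ.var 2 = n * n
  listU : ∀ (u : Fin n) (j : ℕ), σ.tab 0 u j = entry (P.prefU u) j
  rankU : ∀ u w : Fin n, σ.tab 3 u w = rankEntry (P.prefU u) w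
  rankW : ∀ w u : Fin n, σ.tab 4 w u = rankEntry (P.prefW w) u

theorem Base.of_eq {P : PrefProfile n} {d : ℕ} {σ τ : Store} (h : Base P d σ)
    (hv : ∀ x < 3, τ.var x = σ.var x) (ht : ∀ t < 5, τ.tab t = σ.tab t) : Base P d τ where
  size := (hv 0 (by decide)).trans h.size
  bound := (hv 1 (by decide)).trans h.bound
  sq := (hv 2 (by decide)).trans h.sq
  listU u j := by rw [ht 0 (by decide), h.listU]
  rankU u w := by rw [ht 3 (by decide), h.rankU]
  rankW w u := by rw [ht 4 (by decide), h.rankW]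

/-- Both side conditions are closed by `rfl` for a concrete program. -/
theorem Base.denote {P : PrefProfile n} {d : ℕ} {σ : Store} (h : Base P d σ) (p : Stmt)
    (hp : (p.modV.all fun x => 3 ≤ x) = true) (hq : (p.modT.all fun t => 5 ≤ t) = true) :
    Base P d (p.denote σ) := by
  simp only [List.all_eq_true, decide_eq_true_eq] at hp hq
  exact h.of_eq (fun x hx => p.denote_var (fun hm => by have := hp x hm; omega) σ)
    (fun t ht => p.denote_tab (fun hm => by have := hq t hm; omega) σ)

/-- Computes the ranks. -/
def initStmt : Stmt := .seq (rankStmt 0 3) (rankStmt 1 4)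

theorem initStmt_spec (P : PrefProfile n) (d : ℕ) :
    Base P d (initStmt.denote ((inputStore P d).setVar 2 (n * n))) := by
  set σ := (inputStore P d).setVar 2 (n * n) with hσ
  have h0 : σ.var 0 = n := rfl
  have hU : ∀ (u : Fin n) (j : ℕ), σ.tab 0 u j = entry (P.prefU u) j := by
    intro u j
    simp [hσ, inputStore]
  have hW : ∀ (w : Fin n) (j : ℕ), σ.tab 1 w j = entry (P.prefW w) j := by
    intro u j
    simp [hσ, inputStore]
  have v1 : ∀ y, y ≠ 8 → y ≠ 9 → ((rankStmt 0 3).denote σ).var y = σ.var y := fun y h8 h9 =>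
    Stmt.denote_var _ (by simp [rankStmt, Stmt.modV, h8, h9]) σ
  have t1 : ∀ t, t ≠ 3 → ((rankStmt 0 3).denote σ).tab t = σ.tab t := fun t ht =>
    Stmt.denote_tab _ (by simp [rankStmt, Stmt.modT, ht]) σ
  have v2 : ∀ y, y ≠ 8 → y ≠ 9 → (initStmt.denote σ).var y = σ.var y := fun y h8 h9 =>
    Stmt.denote_var _ (by simp [initStmt, rankStmt, Stmt.modV, h8, h9]) σ
  have t2 : ∀ t, t ≠ 4 → (initStmt.denote σ).tab t = ((rankStmt 0 3).denote σ).tab t := fun t ht =>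
    (rankStmt 1 4).denote_tab (by simp [rankStmt, Stmt.modT, ht]) _
  constructor
  · rw [v2 0 (by decide) (by decide)]; rfl
  · rw [v2 1 (by decide) (by decide)]; rfl
  · rw [v2 2 (by decide) (by decide)]; rfl
  · intro u j
    rw [t2 0 (by decide), t1 0 (by decide), hU]
  · intro u w
    rw [t2 3 (by decide), rankStmt_spec (by decide) P.prefU h0 hU]
  · intro w u
    exact rankStmt_spec (by decide) P.prefW (by rw [v1 0 (by decide) (by decide), h0])
      (fun w j => by rw [t1 1 (by decide), hW]) w u

/-! ## Least robust matchings -/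

/-- Position of agent `u` of `U` in the current row of table `6`. -/
def posExp (u : Exp) : Exp := .cell 6 (.var 4) u

/-- The agent in the current position of agent `var 8` of `U`. -/
def candExp : Exp := .sub (.cell 0 (.var 8) (posExp (.var 8))) (.const 1)

/-- The amount by which an agent of `U` in the current position falls short of blocking. -/
def gapExp (u w : Exp) : Exp := .sub (.sub (.cell 3 u w) (.const 1)) (posExp u)

/-- Tests if agent `var 8` of `U` is rejected in the current position, where agent `var 5` of `W`
refuses ranks above `var 6`. -/
def rejExp : Exp :=
  .and (.cell 0 (.var 8) (posExp (.var 8))) (.add (.not (.cell 4 candExp (.var 8)))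
    (.add (.and (.eq candExp (.var 5)) (.sub (.cell 4 candExp (.var 8)) (.add (.var 6) (.const 1))))
      (.sum 0 (.and (.not (.eq (.bvar 0) (.var 8))) (.and (.cell 3 (.bvar 0) candExp)
        (.and (.cell 4 candExp (.bvar 0)) (.le (.add (gapExp (.bvar 0) candExp)
          (.sub (.cell 4 candExp (.bvar 0)) (.cell 4 candExp (.var 8)))) (.var 1))))))))

/-- Tests if the current positions are covered. -/
def coverExp : Exp :=
  .not (.sum 0 (.sum 0 (.and (.cell 3 (.bvar 1) (.bvar 0)) (.and (.cell 4 (.bvar 0) (.bvar 1))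
    (.and (.not (.sum 0 (.eq (.cell 0 (.bvar 0) (posExp (.bvar 0)))
      (.add (.bvar 1) (.const 1))))) (.le (gapExp (.bvar 1) (.bvar 0)) (.var 1)))))))

/-- Moves agent `var 8` of `U` on if rejected. -/
def moveStmt : Stmt :=
  .ite rejExp (.write 6 (.var 4) (.var 8) (.add (posExp (.var 8)) (.const 1))) .skip

/-- Computes the positions in the least robust matching in which agent `var 5` of `W` has a partner
of rank at most `var 6` into row `var 4` of table `6`, and whether there is one into table `7`. -/
def leastStmt : Stmt :=
  .seq (.loop 7 0 (.write 6 (.var 4) (.var 7) (.const 0)))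
    (.seq (.loop 7 2 (.loop 8 0 moveStmt))
      (.write 7 (.const 0) (.var 4) (.bool coverExp)))

/-- Agent `w₀` of `W` refuses ranks above `j₀`. -/
def refuses (P : PrefProfile n) (w₀ j₀ : ℕ) (u w : Fin n) : Prop :=
  (w : ℕ) = w₀ ∧ j₀ < (P.prefW w).rank u

/-- Ranks are stored with `1` added. The shift cancels in the difference of two entries, and is
undone explicitly where a rank is compared with a position or with `var 6`. -/
theorem holds_rejExp {P : PrefProfile n} {d : ℕ} {σ : Store} (h : Base P d σ) (u : Fin n)
    (h8 : σ.var 8 = u) : rejExp.Holds σ [] ↔ ∃ w, (P.prefU u).1[σ.tab 6 (σ.var 4) u]? = some w ∧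
      P.Rejected d (refuses P (σ.var 5) (σ.var 6)) (fun u => σ.tab 6 (σ.var 4) u) u w := by
  simp only [rejExp, posExp, gapExp, candExp, Exp.holds_and, Exp.holds_cell, Exp.holds_add,
    Exp.holds_not, Exp.holds_eq, Exp.holds_sub, Exp.holds_sum, Exp.holds_le, Exp.eval_cell,
    Exp.eval_var, Exp.eval_sub, Exp.eval_const, Exp.eval_add, Exp.eval_bvar_zero, h8, h.listU,
    h.size, h.bound]
  constructor
  · rintro ⟨h1, h2⟩
    obtain ⟨w, hw, he⟩ := entry_ne_zero_iff.1 h1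
    refine ⟨w, hw, ?_⟩
    rw [he] at h2
    simp only [Nat.add_sub_cancel, h.rankW, not_not] at h2
    by_cases hacc : (P.prefW w).Accepts u
    · rcases h2 with h2 | ⟨h2, h3⟩ | ⟨k, hk, h2, h3, h4, h5⟩
      · exact absurd h2 (rankEntry_ne_zero_iff.2 hacc)
      · rw [rankEntry_of_accepts hacc] at h3
        exact .inr (.inl ⟨h2, by omega⟩)
      · lift k to Fin n using hk
        rw [h.rankU, rankEntry_ne_zero_iff] at h3
        rw [h.rankW, rankEntry_ne_zero_iff] at h4
        rw [h.rankU, h.rankW, rankEntry_of_accepts h3, rankEntry_of_accepts h4,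
          rankEntry_of_accepts hacc] at h5
        exact .inr (.inr ⟨k, fun e => h2 (by rw [e]), ⟨h3, h4⟩, by
          simp only
          omega⟩)
    · exact .inl hacc
  · rintro ⟨w, hw, hr⟩
    have he := entry_eq_succ_iff.2 hw
    rw [he]
    simp only [Nat.add_sub_cancel, h.rankW, not_not]
    refine ⟨by simp, ?_⟩
    by_cases hacc : (P.prefW w).Accepts u
    · rcases hr with hr | ⟨hr, hr'⟩ | ⟨u', hne, ⟨h3, h4⟩, hle⟩
      · exact absurd hacc hr
      · rw [rankEntry_of_accepts hacc]
        exact .inr (.inl ⟨hr, by omega⟩)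
      · refine .inr (.inr ⟨u', u'.2, by rwa [Fin.val_inj], ?_, ?_, ?_⟩)
        · rwa [h.rankU, rankEntry_ne_zero_iff]
        · rwa [h.rankW, rankEntry_ne_zero_iff]
        · rw [h.rankU, h.rankW, rankEntry_of_accepts h3, rankEntry_of_accepts h4,
            rankEntry_of_accepts hacc]
          simp only at hle
          omega
    · left
      by_contra hcon
      exact hacc (rankEntry_ne_zero_iff.1 hcon)

theorem holds_coverExp {P : PrefProfile n} {d : ℕ} {σ : Store} (h : Base P d σ) :
    coverExp.Holds σ [] ↔ P.Covered d (fun u => σ.tab 6 (σ.var 4) u) := by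
  simp only [coverExp, posExp, gapExp, Exp.holds_and, Exp.holds_cell,
    Exp.holds_not, Exp.holds_eq, Exp.holds_sum, Exp.holds_le, Exp.eval_cell,
    Exp.eval_var, Exp.eval_sub, Exp.eval_const, Exp.eval_add, Exp.eval_bvar_zero,
    Exp.eval_bvar_one, h.size, h.bound]
  constructor
  · intro H u w huw
    by_contra! hcon
    refine H ⟨u, u.2, w, w.2, ?_, ?_, ?_, ?_⟩
    · rw [h.rankU, rankEntry_ne_zero_iff]; exact huw.1
    · rw [h.rankW, rankEntry_ne_zero_iff]; exact huw.2
    · rintro ⟨k, hk, he⟩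
      lift k to Fin n using hk
      rw [h.listU, entry_eq_succ_iff] at he
      exact hcon.1 k he
    · rw [h.rankU, rankEntry_of_accepts huw.1]
      exact hcon.2
  · rintro H ⟨u, hu, w, hw, h1, h2, h3, h4⟩
    lift u to Fin n using hu
    lift w to Fin n using hw
    rw [h.rankU, rankEntry_ne_zero_iff] at h1
    rw [h.rankW, rankEntry_ne_zero_iff] at h2
    rw [h.rankU, rankEntry_of_accepts h1] at h4
    rcases H u w ⟨h1, h2⟩ with ⟨v, hv⟩ | hlt
    · exact h3 ⟨v, v.2, by rw [h.listU, entry_eq_succ_iff]; exact hv⟩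
    · simp only at hlt
      omega

/-- The positions are those of the least robust matching that avoids `F` if the flag is `1`, and
there is no such matching if it is `0`. -/
def LeastSpec (P : PrefProfile n) (d : ℕ) (F : Fin n → Fin n → Prop) (x : ℕ → ℕ) (flag : ℕ) : Prop :=
  (flag = 1 ∧ (∃ M : Matching n, P.Robust d M ∧ PrefProfile.Avoids M F ∧
      (∀ u, M u = (P.prefU u).1[x u]?) ∧ ∀ u : Fin n, P.posU M u = x u) ∧
    ∀ M : Matching n, P.Robust d M → PrefProfile.Avoids M F → ∀ u : Fin n, x u ≤ P.posU M u) ∨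
  (flag = 0 ∧ ∀ M : Matching n, P.Robust d M → ¬ PrefProfile.Avoids M F)

/-- Positions that are within the lists and not beyond those in any robust matching that avoids
`F`. -/
def Valid (P : PrefProfile n) (d : ℕ) (F : Fin n → Fin n → Prop) (x : ℕ → ℕ) : Prop :=
  (∀ u : Fin n, x u ≤ (P.prefU u).1.length) ∧
    ∀ M : Matching n, P.Robust d M → PrefProfile.Avoids M F → ∀ u : Fin n, x u ≤ P.posU M u

theorem moveStmt_spec {P : PrefProfile n} {d : ℕ} {σ : Store} (h : Base P d σ) (u : Fin n)
    (h8 : σ.var 8 = u) {F : Fin n → Fin n → Prop} (hF : F = refuses P (σ.var 5) (σ.var 6))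
    (hv : Valid P d F (σ.tab 6 (σ.var 4))) :
    (moveStmt.denote σ = σ ∧ ∀ w, (P.prefU u).1[σ.tab 6 (σ.var 4) u]? = some w →
      ¬ P.Rejected d F (fun u => σ.tab 6 (σ.var 4) u) u w) ∨
    ((∃ w, (P.prefU u).1[σ.tab 6 (σ.var 4) u]? = some w ∧
      P.Rejected d F (fun u => σ.tab 6 (σ.var 4) u) u w) ∧
      moveStmt.denote σ = σ.setTab 6 (σ.var 4) u (σ.tab 6 (σ.var 4) u + 1) ∧
      Valid P d F ((moveStmt.denote σ).tab 6 (σ.var 4))) := by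
  subst hF
  by_cases hr : rejExp.Holds σ []
  · right
    have he : moveStmt.denote σ = σ.setTab 6 (σ.var 4) u (σ.tab 6 (σ.var 4) u + 1) := by
      rw [moveStmt, Stmt.denote_ite_pos hr, Stmt.denote_write]
      simp [posExp, h8]
    obtain ⟨w, hw, hrej⟩ := (holds_rejExp h u h8).1 hr
    refine ⟨⟨w, hw, hrej⟩, he, ?_⟩
    rw [he]
    constructor
    · intro v
      simp only [Store.setTab_tab, true_and, Fin.val_inj]
      split_ifs with hvu
      · rw [hvu]
        exact (List.getElem?_eq_some_iff.1 hw).1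
      · exact hv.1 v
    · intro M hM hav v
      simp only [Store.setTab_tab, true_and, Fin.val_inj]
      split_ifs with hvu
      · rw [hvu]
        exact PrefProfile.lt_posU_of_rejected hM hav (hv.2 M hM hav) hw hrej
      · exact hv.2 M hM hav v
  · left
    refine ⟨by rw [moveStmt, Stmt.denote_ite_neg hr]; rfl, fun w hw hrej => ?_⟩
    exact hr ((holds_rejExp h u h8).2 ⟨w, hw, hrej⟩)

/-- A pass that moves nobody has tested every agent at the initial positions, which are therefore
stuck; any move increases the sum of the positions. -/
theorem moveLoop_spec {P : PrefProfile n} {d : ℕ} {σ : Store} (h : Base P d σ)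
    {F : Fin n → Fin n → Prop} (hF : F = refuses P (σ.var 5) (σ.var 6))
    (hv : Valid P d F (σ.tab 6 (σ.var 4))) :
    let σ' := (Stmt.loop 8 0 moveStmt).denote σ
    Valid P d F (σ'.tab 6 (σ.var 4)) ∧ (∀ i, i ≠ σ.var 4 → σ'.tab 6 i = σ.tab 6 i) ∧
      ((σ'.tab 6 = σ.tab 6 ∧ P.Stuck d F (fun u => σ.tab 6 (σ.var 4) u)) ∨
        (¬ P.Stuck d F (fun u => σ.tab 6 (σ.var 4) u) ∧
          ∑ u : Fin n, σ.tab 6 (σ.var 4) u + 1 ≤ ∑ u : Fin n, σ'.tab 6 (σ.var 4) u)) := by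
  have := Stmt.denote_loop moveStmt 8 0 σ (fun k τ => Valid P d F (τ.tab 6 (σ.var 4)) ∧
    (∀ i, i ≠ σ.var 4 → τ.tab 6 i = σ.tab 6 i) ∧
      ((τ.tab 6 = σ.tab 6 ∧ ∀ u : Fin n, (u : ℕ) < k → ∀ w,
          (P.prefU u).1[σ.tab 6 (σ.var 4) u]? = some w →
          ¬ P.Rejected d F (fun u => σ.tab 6 (σ.var 4) u) u w) ∨
        (¬ P.Stuck d F (fun u => σ.tab 6 (σ.var 4) u) ∧
          ∑ u : Fin n, σ.tab 6 (σ.var 4) u + 1 ≤ ∑ u : Fin n, τ.tab 6 (σ.var 4) u)))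
    ⟨hv, fun _ _ => rfl, .inl ⟨rfl, by simp⟩⟩ ?_
  · obtain ⟨h1, h2, h3⟩ := this
    rw [h.size] at h3
    exact ⟨h1, h2, h3.imp_left fun h3 => ⟨h3.1, fun u w hw => h3.2 u u.2 w hw⟩⟩
  · rintro i hi τ hτv hτt ⟨h1, h2, h3⟩
    rw [h.size] at hi
    have hv' : ∀ y, y ≠ 8 → (τ.setVar 8 i).var y = σ.var y := by
      intro y hy
      rw [Store.setVar_var, if_neg hy]
      exact hτv y (by simp [moveStmt, Stmt.modV, hy])
    have hB : Base P d (τ.setVar 8 i) := h.of_eq (fun x hx => hv' x (by omega))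
      (fun t ht => hτt t (by simp [moveStmt, Stmt.modT]; omega))
    have hstep := moveStmt_spec hB ⟨i, hi⟩ (by simp) (F := F)
      (by rw [hF, hv' 5 (by decide), hv' 6 (by decide)])
      (by simpa only [hv' 4 (by decide), Store.setVar_tab] using h1)
    simp only [hv' 4 (by decide), Store.setVar_tab] at hstep
    rcases hstep with ⟨he, hno⟩ | ⟨⟨w, hw, hr⟩, he, hval⟩
    · rw [he]
      refine ⟨h1, h2, h3.imp_left fun h3 => ⟨h3.1, fun u hu => ?_⟩⟩
      rcases Nat.lt_succ_iff_lt_or_eq.1 hu with hlt | heq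
      · exact h3.2 u hlt
      · subst heq
        rw [h3.1] at hno
        exact hno
    · refine ⟨hval, ?_, ?_⟩
      · intro i' hi'
        rw [← h2 i' hi', he]
        ext j
        simp [hi']
      · right
        have hsum : ∑ u : Fin n, τ.tab 6 (σ.var 4) u + 1 ≤
            ∑ u : Fin n, (moveStmt.denote (τ.setVar 8 i)).tab 6 (σ.var 4) u := by
          refine Nat.succ_le_of_lt (Finset.sum_lt_sum (fun u _ => ?_) ⟨⟨i, hi⟩, Finset.mem_univ _, ?_⟩)
          · rw [he, Store.setTab_tab]
            split_ifs with hc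
            · simp [hc.2.2]
            · exact le_rfl
          · simp [he]
        -- Up to the first move the positions are the initial ones, so a first move shows that those
        -- were not stuck.
        rcases h3 with h3 | h3
        · rw [h3.1] at hw hr hsum
          exact ⟨fun hs => hs _ _ hw hr, hsum⟩
        · exact ⟨h3.1, by omega⟩

/-- The sum of the positions is a potential bounded by `n * n`, so `n * n` passes suffice to get
stuck. The coverage test then tells whether an admissible robust matching exists. -/
theorem leastStmt_spec {P : PrefProfile n} {d : ℕ} {σ : Store} (h : Base P d σ)
    {F : Fin n → Fin n → Prop} (hF : F = refuses P (σ.var 5) (σ.var 6)) :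
    let σ' := leastStmt.denote σ
    LeastSpec P d F (σ'.tab 6 (σ.var 4)) (σ'.tab 7 0 (σ.var 4)) ∧
      ∀ i, i ≠ σ.var 4 → σ'.tab 6 i = σ.tab 6 i ∧ σ'.tab 7 0 i = σ.tab 7 0 i := by
  intro σ'
  set σ₁ := (Stmt.loop 7 0 (.write 6 (.var 4) (.var 7) (.const 0))).denote σ with hσ₁
  set σ₂ := (Stmt.loop 7 2 (.loop 8 0 moveStmt)).denote σ₁ with hσ₂
  have hσ' : σ' = (Stmt.write 7 (.const 0) (.var 4) (.bool coverExp)).denote σ₂ := rfl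
  have hfill := Stmt.denote_fillRow (t := 6) (x := 7) (b := 0) (e := .var 4) (a := .const 0)
    (σ := σ) (σ.var 4) (fun _ => 0) (fun τ hv _ _ _ _ _ => ⟨hv 4 (by decide), rfl⟩)
  rw [← hσ₁, h.size] at hfill
  have v1 : ∀ y, y ≠ 7 → σ₁.var y = σ.var y := fun y hy =>
    Stmt.denote_var _ (by simp [Stmt.modV, hy]) σ
  have B1 : Base P d σ₁ := h.denote _ rfl rfl
  have v2 : ∀ y, y ≠ 7 → y ≠ 8 → σ₂.var y = σ.var y := fun y hy hy' =>
    (Stmt.denote_var _ (by simp [Stmt.modV, moveStmt, hy, hy']) σ₁).trans (v1 y hy)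
  have t2 : σ₂.tab 7 = σ.tab 7 :=
    (Stmt.denote_tab _ (by simp [Stmt.modT, moveStmt]) σ₁).trans
      (Stmt.denote_tab _ (by simp [Stmt.modT]) σ)
  have B2 : Base P d σ₂ := B1.denote _ rfl rfl
  have key := Stmt.denote_loop (.loop 8 0 moveStmt) 7 2 σ₁ (fun k τ =>
    Valid P d F (τ.tab 6 (σ.var 4)) ∧ (∀ i, i ≠ σ.var 4 → τ.tab 6 i = σ.tab 6 i) ∧
      (P.Stuck d F (fun u => τ.tab 6 (σ.var 4) u) ∨ k ≤ ∑ u : Fin n, τ.tab 6 (σ.var 4) u))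
    ?_ ?_
  · rw [← hσ₂, B1.sq] at key
    obtain ⟨hval, hrows, hstuck⟩ := key
    have hstuck' : P.Stuck d F (fun u => σ₂.tab 6 (σ.var 4) u) := by
      rcases hstuck with hstuck | hbig
      · exact hstuck
      -- If all passes moved someone, the potential has reached `n * n`; then no position is below
      -- `n`, and every agent is past the end of its list.
      · intro u w hw
        have hle : ∀ u : Fin n, σ₂.tab 6 (σ.var 4) u ≤ n := fun u =>
          (hval.1 u).trans (PrefList.length_le _)
        have hlt : σ₂.tab 6 (σ.var 4) u < n :=
          (List.getElem?_eq_some_iff.1 hw).1.trans_le (PrefList.length_le _)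
        have := Finset.sum_lt_sum (s := (Finset.univ : Finset (Fin n)))
          (fun u _ => hle u) ⟨u, Finset.mem_univ u, hlt⟩
        simp only [Finset.sum_const, Finset.card_univ, Fintype.card_fin, smul_eq_mul] at this
        omega
    have hcov := holds_coverExp B2
    rw [v2 4 (by decide) (by decide)] at hcov
    have e4 : σ₂.var 4 = σ.var 4 := v2 4 (by decide) (by decide)
    have e6 : σ'.tab 6 = σ₂.tab 6 := by
      rw [hσ']
      exact Stmt.denote_tab _ (by simp [Stmt.modT]) σ₂
    constructor
    · rw [e6]
      have e7 : σ'.tab 7 0 (σ.var 4) = (Exp.bool coverExp).eval σ₂ [] := by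
        rw [hσ', Stmt.denote_write]
        simp [e4]
      rw [e7, Exp.eval_bool]
      split_ifs with hc
      · exact .inl ⟨rfl, hstuck'.exists_robust (hcov.1 hc) hval.1, hval.2⟩
      · exact .inr ⟨rfl, fun M hM hav => hc (hcov.2 (hstuck'.covered hM (hval.2 M hM hav)))⟩
    · intro i hi
      refine ⟨by rw [e6, hrows i hi], ?_⟩
      rw [hσ', Stmt.denote_write]
      simp [e4, hi, t2]
  · refine ⟨⟨fun u => ?_, fun M _ _ u => ?_⟩, fun i hi => ?_, .inr (by simp)⟩
    · simp [hfill]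
    · simp [hfill]
    · ext j
      simp [hfill, hi]
  · rintro k hk τ hv ht ⟨h1, h2, h3⟩
    have v3 : ∀ y, y ≠ 7 → y ≠ 8 → (τ.setVar 7 k).var y = σ.var y := by
      intro y h7 h8
      rw [Store.setVar_var, if_neg h7, hv y (by simp [Stmt.modV, moveStmt, h7, h8]), v1 y h7]
    have B3 : Base P d (τ.setVar 7 k) := B1.of_eq
      (fun x hx => by rw [v3 x (by omega) (by omega), v1 x (by omega)])
      (fun t ht' => ht t (by simp [Stmt.modT, moveStmt]; omega))
    have := moveLoop_spec B3 (F := F)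
      (by rw [hF, v3 5 (by decide) (by decide), v3 6 (by decide) (by decide)])
      (by rw [v3 4 (by decide) (by decide)]; exact h1)
    simp only [v3 4 (by decide) (by decide), Store.setVar_tab] at this
    obtain ⟨g1, g2, g3⟩ := this
    refine ⟨g1, fun i hi => (g2 i hi).trans (h2 i hi), ?_⟩
    rcases g3 with ⟨g3, g4⟩ | ⟨g3, g4⟩
    · left
      rw [g3]
      exact g4
    · right
      rcases h3 with h3 | h3
      · exact absurd h3 g3
      · omega

end RAM

namespace RAM

/-! ## Loops that make progress or leave the data unchanged -/

/-- If every pass through the body either changes nothing, as its test fails, or increases the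
measure, then so does the loop. -/
theorem progress_loop {α : Type*} {p : Stmt} {x b N : ℕ} {I : Store → Prop} {D : Store → α}
    {Fail : ℕ → α → Prop} {m : α → ℕ} (hI : ∀ σ k, I σ → I (σ.setVar x k))
    (hD : ∀ σ k, D (σ.setVar x k) = D σ) (hb : ∀ σ, I σ → σ.var b = N)
    (hp : ∀ σ, I σ → σ.var x < N → I (p.denote σ) ∧
      ((D (p.denote σ) = D σ ∧ Fail (σ.var x) (D σ)) ∨
        (¬ Fail (σ.var x) (D σ) ∧ m (D σ) < m (D (p.denote σ))))) (σ : Store) (hσ : I σ) :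
    I ((Stmt.loop x b p).denote σ) ∧
      ((D ((Stmt.loop x b p).denote σ) = D σ ∧ ∀ i < N, Fail i (D σ)) ∨
        (¬ (∀ i < N, Fail i (D σ)) ∧ m (D σ) < m (D ((Stmt.loop x b p).denote σ)))) := by
  have := p.denote_loop x b σ (fun k τ => I τ ∧ ((D τ = D σ ∧ ∀ i < k, Fail i (D σ)) ∨
    (¬ (∀ i < N, Fail i (D σ)) ∧ m (D σ) < m (D τ)))) ⟨hσ, .inl ⟨rfl, by simp⟩⟩ ?_
  · rwa [hb σ hσ] at this
  · rintro i hi τ - - ⟨h1, h2⟩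
    rw [hb σ hσ] at hi
    have hx : (τ.setVar x i).var x = i := by simp
    obtain ⟨h3, h4⟩ := hp (τ.setVar x i) (hI τ i h1) (by rwa [hx])
    rw [hx, hD] at h4
    refine ⟨h3, ?_⟩
    rcases h2 with ⟨h2, h2'⟩ | h2 <;> rcases h4 with ⟨h4, h4'⟩ | ⟨h4, h4'⟩
    · left
      refine ⟨h4.trans h2, fun j hj => ?_⟩
      rcases Nat.lt_succ_iff_lt_or_eq.1 hj with hlt | rfl
      · exact h2' j hlt
      · rwa [h2] at h4'
    · rw [h2] at h4 h4'
      exact .inr ⟨fun hall => h4 (hall i hi), h4'⟩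
    · exact .inr ⟨h2.1, by rw [h4]; exact h2.2⟩
    · exact .inr ⟨h2.1, h2.2.trans h4'⟩

/-- Repeating a program that makes progress as long as some test succeeds. -/
theorem progress_iterate {α : Type*} {p : Stmt} {x b : ℕ} {I : Store → Prop} {D : Store → α}
    {Done : α → Prop} {m : α → ℕ} (hI : ∀ σ k, I σ → I (σ.setVar x k))
    (hD : ∀ σ k, D (σ.setVar x k) = D σ)
    (hp : ∀ σ, I σ → I (p.denote σ) ∧ ((D (p.denote σ) = D σ ∧ Done (D σ)) ∨
      (¬ Done (D σ) ∧ m (D σ) < m (D (p.denote σ))))) (σ : Store) (hσ : I σ) :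
    I ((Stmt.loop x b p).denote σ) ∧ (Done (D ((Stmt.loop x b p).denote σ)) ∨
      σ.var b ≤ m (D ((Stmt.loop x b p).denote σ))) := by
  refine p.denote_loop x b σ (fun k τ => I τ ∧ (Done (D τ) ∨ k ≤ m (D τ))) ⟨hσ, .inr (by simp)⟩ ?_
  rintro i - τ - - ⟨h1, h2⟩
  obtain ⟨h3, h4⟩ := hp (τ.setVar x i) (hI τ i h1)
  rw [hD] at h4
  refine ⟨h3, ?_⟩
  rcases h4 with ⟨h4, h5⟩ | ⟨h4, h5⟩
  · left
    rwa [h4]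
  · rcases h2 with h2 | h2
    · exact absurd h2 h4
    · right
      omega

/-! ## Maximum bipartite matching -/

/-- A matching of active numbers `p < N` to numbers `q < N` along `A`. -/
structure IsMatching (N : ℕ) (A : ℕ → ℕ → ℕ) (act : ℕ → Prop) (ρ : ℕ → ℕ) : Prop where
  adj : ∀ p < N, ∀ q, ρ p = q + 1 → q < N ∧ A p q ≠ 0 ∧ act p
  inj : ∀ p < N, ∀ p' < N, ∀ q, ρ p = q + 1 → ρ p' = q + 1 → p = p'

/-- The number `q` is matched. -/
def Hit (N : ℕ) (ρ : ℕ → ℕ) (q : ℕ) : Prop := ∃ v < N, ρ v = q + 1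

open Classical in
/-- The number of matched pairs. -/
noncomputable def matchingSize (N : ℕ) (ρ : ℕ → ℕ) : ℕ :=
  ((Finset.range N).filter fun q => Hit N ρ q).card

theorem matchingSize_le (N : ℕ) (ρ : ℕ → ℕ) : matchingSize N ρ ≤ N := by
  classical
  exact (Finset.card_filter_le _ _).trans (Finset.card_range N).le

/-- The matching `ρ` has been obtained from `mu` by exchanging pairs within `reach`, so that it
leaves `p` free. -/
structure Frees (N : ℕ) (A : ℕ → ℕ → ℕ) (act : ℕ → Prop) (mu : ℕ → ℕ) (reach : ℕ → Prop)
    (p : ℕ) (ρ : ℕ → ℕ) : Prop where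
  matching : IsMatching N A act ρ
  free : ρ p = 0
  act : act p
  hit : ∀ q, Hit N ρ q ↔ Hit N mu q
  outside : ∀ v < N, ¬ reach v → ρ v = mu v

section exchange

variable {N : ℕ} {A : ℕ → ℕ → ℕ} {act : ℕ → Prop} {mu : ℕ → ℕ} {reach reach' : ℕ → Prop}
  {p q v : ℕ} {ρ ρ' : ℕ → ℕ}

/-- One edge of an alternating path: `p` takes over the partner `q` of `v`, which leaves `v` free
and the set of matched `q` unchanged. -/
theorem Frees.exchange (h : Frees N A act mu reach p ρ) (hp : p < N) (hv : v < N) (hq : q < N)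
    (ha : A p q ≠ 0) (hpv : ρ v = q + 1) (hreach : ∀ z < N, reach z → reach' z) (hrp : reach' p)
    (hrv : reach' v) (hρ' : ∀ z < N, ρ' z = if z = v then 0 else if z = p then q + 1 else ρ z) :
    Frees N A act mu reach' v ρ' := by
  have hne : p ≠ v := by
    rintro rfl
    rw [h.free] at hpv
    omega
  refine ⟨⟨?_, ?_⟩, by simp [hρ' v hv], (h.matching.adj v hv q hpv).2.2, fun q' => ?_, ?_⟩
  · intro z hz q' hzq
    rw [hρ' z hz] at hzq
    split_ifs at hzq with h1 h2
    · obtain rfl : q = q' := by omega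
      exact ⟨hq, by rwa [h2], by rw [h2]; exact h.act⟩
    · exact h.matching.adj z hz q' hzq
  · intro z hz z' hz' q' h1 h2
    rw [hρ' z hz] at h1
    rw [hρ' z' hz'] at h2
    split_ifs at h1 h2 with h3 h4 h5 h6 h7 h8
    · rw [h4, h6]
    · exact absurd (h.matching.inj z' hz' v hv q (by omega) hpv) h5
    · exact absurd (h.matching.inj z hz v hv q (by omega) hpv) h3
    · exact h.matching.inj z hz z' hz' q' h1 h2
  · rw [← h.hit q']
    constructor
    · rintro ⟨z, hz, hzq⟩
      rw [hρ' z hz] at hzq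
      split_ifs at hzq with h1 h2
      · exact ⟨v, hv, by omega⟩
      · exact ⟨z, hz, hzq⟩
    · rintro ⟨z, hz, hzq⟩
      by_cases hzv : z = v
      · refine ⟨p, hp, ?_⟩
        rw [hρ' p hp, if_neg hne, if_pos rfl, ← hpv, ← hzv, hzq]
      · refine ⟨z, hz, ?_⟩
        have hzp : z ≠ p := by
          rintro rfl
          rw [h.free] at hzq
          omega
        rw [hρ' z hz, if_neg hzv, if_neg hzp, hzq]
  · intro z hz hnr
    rw [hρ' z hz, if_neg, if_neg, h.outside z hz fun hr => hnr (hreach z hz hr)]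
    · rintro rfl
      exact hnr hrp
    · rintro rfl
      exact hnr hrv

theorem Frees.mono (h : Frees N A act mu reach p ρ) (hreach : ∀ z < N, reach z → reach' z) :
    Frees N A act mu reach' p ρ :=
  ⟨h.matching, h.free, h.act, h.hit, fun v hv hr => h.outside v hv fun hr' => hr (hreach v hv hr')⟩

theorem IsMatching.congr (h : IsMatching N A act ρ) (hρ : ∀ z < N, ρ' z = ρ z) :
    IsMatching N A act ρ' :=
  ⟨fun p hp q hq => h.adj p hp q (by rw [← hρ p hp, hq]),
    fun p hp p' hp' q hq hq' => h.inj p hp p' hp' q (by rw [← hρ p hp, hq]) (by rw [← hρ p' hp', hq'])⟩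

/-- The end of an augmenting path: the free `p` takes an unmatched `q`, and everything matched by
`mu` remains matched. -/
theorem Frees.augment (h : Frees N A act mu reach p ρ) (hp : p < N) (hq : q < N)
    (ha : A p q ≠ 0) (hno : ¬ Hit N ρ q)
    (hρ' : ∀ z < N, ρ' z = if z = p then q + 1 else ρ z) :
    IsMatching N A act ρ' ∧ matchingSize N mu < matchingSize N ρ' := by
  classical
  refine ⟨⟨?_, ?_⟩, ?_⟩
  · intro z hz q' hzq
    rw [hρ' z hz] at hzq
    split_ifs at hzq with h2
    · obtain rfl : q = q' := by omega
      exact ⟨hq, by rwa [h2], by rw [h2]; exact h.act⟩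
    · exact h.matching.adj z hz q' hzq
  · intro z hz z' hz' q' h1 h2
    rw [hρ' z hz] at h1
    rw [hρ' z' hz'] at h2
    split_ifs at h1 h2 with h3 h4 h5
    · rw [h3, h4]
    · exact absurd ⟨z', hz', by omega⟩ hno
    · exact absurd ⟨z, hz, by omega⟩ hno
    · exact h.matching.inj z hz z' hz' q' h1 h2
  · refine Finset.card_lt_card (Finset.ssubset_iff_subset_ne.2 ⟨fun q' hq' => ?_, fun he => ?_⟩)
    · simp only [Finset.mem_filter, Finset.mem_range] at hq' ⊢
      refine ⟨hq'.1, ?_⟩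
      obtain ⟨z, hz, hzq⟩ := (h.hit q').2 hq'.2
      refine ⟨z, hz, ?_⟩
      rw [hρ' z hz, if_neg, hzq]
      rintro rfl
      rw [h.free] at hzq
      omega
    · have : q ∈ (Finset.range N).filter fun q => Hit N mu q := by
        rw [he]
        simp only [Finset.mem_filter, Finset.mem_range]
        exact ⟨hq, p, hp, by rw [hρ' p hp, if_pos rfl]⟩
      simp only [Finset.mem_filter] at this
      exact hno ((h.hit q).2 this.2)

/-- If the set of reached numbers cannot be extended, and no reached number leads to an unmatched
one, then the matching is maximum. -/
theorem matchingCert_of_closed {ρs : ℕ → ℕ → ℕ} (hmu : IsMatching N A act mu)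
    (hfrees : ∀ p < N, reach p → Frees N A act mu reach p (ρs p))
    (hunm : ∀ p < N, act p → mu p = 0 → reach p)
    (hclosed : ∀ p < N, ∀ q < N, ∀ v < N, reach p → A p q ≠ 0 → ρs p v = q + 1 → reach v)
    (hhit : ∀ p < N, ∀ q < N, reach p → A p q ≠ 0 → Hit N (ρs p) q) :
    MatchingCert N (fun p q => A p q ≠ 0) act mu reach where
  adj p hp q hpq := ⟨(hmu.adj p hp q hpq).1, (hmu.adj p hp q hpq).2.1⟩
  inj := hmu.inj
  reach_act p hp hr := (hfrees p hp hr).act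
  unmatched := hunm
  closed p hp q hq hr ha := by
    have hf := hfrees p hp hr
    have hh := hhit p hp q hq hr ha
    obtain ⟨v, hv, hvq⟩ := hh
    -- If the partner `z` of `q` under `mu` were not reached, the exchange would not have touched
    -- it. It would then equal `v`, which is reached because the set is closed.
    obtain ⟨z, hz, hzq⟩ := (hf.hit q).1 ⟨v, hv, hvq⟩
    refine ⟨z, hz, ?_, hzq⟩
    by_contra hnr
    have h1 := hf.outside z hz hnr
    have h2 := hf.matching.inj z hz v hv q (by rw [h1, hzq]) hvq
    rw [h2] at hnr
    exact hnr (hclosed p hp q hq v hv hr ha hvq)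

end exchange

end RAM

/-! ### Programs for the augmenting path search. -/

namespace RAM

/-- Adds `var 12` to the reached numbers if `var 10` is reached, adjacent to `var 11`, and the
exchange then frees `var 12`. -/
def expandStmt : Stmt :=
  .ite (.and (.cell 12 (.const 0) (.var 10)) (.and (.cell 9 (.var 10) (.var 11))
      (.and (.eq (.cell 11 (.var 10) (.var 12)) (.add (.var 11) (.const 1)))
        (.not (.cell 12 (.const 0) (.var 12))))))
    (.seq (.loop 13 2 (.write 11 (.var 12) (.var 13) (.cell 11 (.var 10) (.var 13))))
      (.seq (.write 11 (.var 12) (.var 10) (.add (.var 11) (.const 1)))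
        (.seq (.write 11 (.var 12) (.var 12) (.const 0))
          (.write 12 (.const 0) (.var 12) (.const 1)))))
    .skip

/-- Adds `var 10` with partner `var 11` to the matching if `var 10` can be freed, and `var 11` is
not matched. -/
def augmentStmt : Stmt :=
  .ite (.and (.not (.var 20)) (.and (.cell 12 (.const 0) (.var 10)) (.and (.cell 9 (.var 10) (.var 11))
      (.not (.sum 2 (.eq (.cell 11 (.var 10) (.bvar 0)) (.add (.var 11) (.const 1))))))))
    (.seq (.loop 13 2 (.write 10 (.const 0) (.var 13) (.cell 11 (.var 10) (.var 13))))
      (.seq (.write 10 (.const 0) (.var 10) (.add (.var 11) (.const 1))) (.assign 20 (.const 1))))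
    .skip

/-- Enlarges the matching, or finds that it is maximum and sets `var 20` to `0`. -/
def phaseStmt : Stmt :=
  .seq (.assign 20 (.const 0))
    (.seq (.loop 13 2 (.write 12 (.const 0) (.var 13)
        (.bool (.and (.cell 7 (.const 0) (.var 13)) (.not (.cell 10 (.const 0) (.var 13)))))))
      (.seq (.loop 10 2 (.loop 11 2 (.write 11 (.var 10) (.var 11) (.cell 10 (.const 0) (.var 11)))))
        (.seq (.loop 14 2 (.loop 10 2 (.loop 11 2 (.loop 12 2 expandStmt))))
          (.loop 10 2 (.loop 11 2 augmentStmt)))))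

/-- Computes a maximum matching and the reached numbers. -/
def matchStmt : Stmt :=
  .seq (.loop 13 2 (.write 10 (.const 0) (.var 13) (.const 0)))
    (.seq (.assign 20 (.const 1))
      (.seq (.loop 15 2 (.ite (.var 20) phaseStmt .skip)) (.ite (.var 20) phaseStmt .skip)))

/-- The memory during the search for an augmenting path. -/
structure Search (N : ℕ) (A : ℕ → ℕ → ℕ) (act : ℕ → Prop) (mu : ℕ → ℕ) (σ : Store) : Prop where
  size : σ.var 2 = N
  adj : σ.tab 9 = A
  frees : ∀ p < N, σ.tab 12 0 p ≠ 0 →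
    Frees N A act mu (fun v => σ.tab 12 0 v ≠ 0) p (σ.tab 11 p)
  unmatched : ∀ p < N, act p → mu p = 0 → σ.tab 12 0 p ≠ 0

section search

variable {N : ℕ} {A : ℕ → ℕ → ℕ} {act : ℕ → Prop} {mu : ℕ → ℕ} {σ : Store}

theorem Search.setVar {x : ℕ} (hx : x ≠ 2) (h : Search N A act mu σ) (k : ℕ) :
    Search N A act mu (σ.setVar x k) :=
  ⟨by simpa [Ne.symm hx] using h.size, h.adj, h.frees, h.unmatched⟩

/-- The data modified by the search. -/
def searchData (σ : Store) : (ℕ → ℕ → ℕ) × (ℕ → ℕ) := (σ.tab 11, σ.tab 12 0)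

/-- The test of `expandStmt` fails. -/
def CannotExpand (A : ℕ → ℕ → ℕ) (p q v : ℕ) (D : (ℕ → ℕ → ℕ) × (ℕ → ℕ)) : Prop :=
  ¬ (D.2 p ≠ 0 ∧ A p q ≠ 0 ∧ D.1 p v = q + 1 ∧ D.2 v = 0)

/-- The number of reached numbers. -/
def reachSize (N : ℕ) (D : (ℕ → ℕ → ℕ) × (ℕ → ℕ)) : ℕ :=
  ((Finset.range N).filter fun p => D.2 p ≠ 0).card

/-- Row `p` of table `11` stores the whole matching that frees `p`, so no path has to be traced
back. Reaching a new number copies a row and applies `Frees.exchange`. -/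
theorem expandStmt_spec (h : Search N A act mu σ) (hp : σ.var 10 < N) (hq : σ.var 11 < N)
    (hv : σ.var 12 < N) :
    Search N A act mu (expandStmt.denote σ) ∧
      ((searchData (expandStmt.denote σ) = searchData σ ∧
          CannotExpand A (σ.var 10) (σ.var 11) (σ.var 12) (searchData σ)) ∨
        (¬ CannotExpand A (σ.var 10) (σ.var 11) (σ.var 12) (searchData σ) ∧
          reachSize N (searchData σ) < reachSize N (searchData (expandStmt.denote σ)))) := by
  unfold expandStmt
  set test : Exp := .and (.cell 12 (.const 0) (.var 10)) (.and (.cell 9 (.var 10) (.var 11))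
      (.and (.eq (.cell 11 (.var 10) (.var 12)) (.add (.var 11) (.const 1)))
        (.not (.cell 12 (.const 0) (.var 12))))) with htest
  have htest' : test.Holds σ [] ↔
      ¬ CannotExpand A (σ.var 10) (σ.var 11) (σ.var 12) (searchData σ) := by
    simp [htest, CannotExpand, searchData, h.adj]
  by_cases ht : test.Holds σ []
  swap
  · rw [Stmt.denote_ite_neg ht]
    exact ⟨h, .inl ⟨rfl, not_not.1 (fun hc => ht (htest'.2 hc))⟩⟩
  rw [Stmt.denote_ite_pos ht]
  have hcond := not_not.1 (htest'.1 ht)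
  obtain ⟨hrp, ha, hpv, hrv⟩ := hcond
  simp only [searchData] at hrp hpv hrv
  -- The source row of the copy differs from its target, so it stays intact during the loop.
  have hne : σ.var 12 ≠ σ.var 10 := fun e => by rw [e] at hrv; exact hrp hrv
  set σ₁ := (Stmt.loop 13 2 (.write 11 (.var 12) (.var 13) (.cell 11 (.var 10) (.var 13)))).denote σ
    with hσ₁
  have hfill := Stmt.denote_fillRow (t := 11) (x := 13) (b := 2) (e := .var 12)
    (a := .cell 11 (.var 10) (.var 13)) (σ := σ) (σ.var 12) (σ.tab 11 (σ.var 10))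
    (fun τ hv' ht' hr k hk hx => ⟨hv' 12 (by decide), by
      simp only [Exp.eval_cell, Exp.eval_var, hv' 10 (by decide), hr _ (Ne.symm hne), hx]⟩)
  rw [← hσ₁, h.size] at hfill
  have v1 : ∀ y, y ≠ 13 → σ₁.var y = σ.var y := fun y hy =>
    Stmt.denote_var _ (by simp [Stmt.modV, hy]) σ
  have t1 : ∀ t, t ≠ 11 → σ₁.tab t = σ.tab t := fun t ht =>
    Stmt.denote_tab _ (by simp [Stmt.modT, ht]) σ
  rw [Stmt.denote_seq, ← hσ₁]
  set σ₂ := (Stmt.seq (.write 11 (.var 12) (.var 10) (.add (.var 11) (.const 1)))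
        (.seq (.write 11 (.var 12) (.var 12) (.const 0))
          (.write 12 (.const 0) (.var 12) (.const 1)))).denote σ₁ with hσ₂
  have v2 : σ₂.var = σ₁.var := rfl
  have t2 : ∀ t, t ≠ 11 → t ≠ 12 → σ₂.tab t = σ₁.tab t := fun t h11 h12 =>
    Stmt.denote_tab _ (by simp [Stmt.modT, h11, h12]) σ₁
  have hrow : ∀ z < N, σ₂.tab 11 (σ.var 12) z =
      if z = σ.var 12 then 0 else if z = σ.var 10 then σ.var 11 + 1 else σ.tab 11 (σ.var 10) z := by
    intro z hz
    simp only [hσ₂, Stmt.denote_seq, Stmt.denote_write, Store.setTab_tab, Exp.eval_var,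
      Exp.eval_const, Store.setTab_var, v1 12 (by decide), v1 10 (by decide), v1 11 (by decide),
      Exp.eval_add]
    simp [hfill, hz]
  have hrows : ∀ i, i ≠ σ.var 12 → σ₂.tab 11 i = σ.tab 11 i := by
    intro i hi
    ext z
    simp only [hσ₂, Stmt.denote_seq, Stmt.denote_write, Store.setTab_tab, Exp.eval_var,
      Exp.eval_const, Store.setTab_var, v1 12 (by decide), v1 10 (by decide), v1 11 (by decide),
      Exp.eval_add]
    simp [hfill, hi]
  have hreach : ∀ z, σ₂.tab 12 0 z = if z = σ.var 12 then 1 else σ.tab 12 0 z := by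
    intro z
    simp only [hσ₂, Stmt.denote_seq, Stmt.denote_write, Store.setTab_tab, Exp.eval_var,
      Exp.eval_const, Store.setTab_var, v1 12 (by decide), v1 10 (by decide), v1 11 (by decide),
      Exp.eval_add]
    simp [t1 12 (by decide)]
  have hmono : ∀ z < N, σ.tab 12 0 z ≠ 0 → σ₂.tab 12 0 z ≠ 0 := by
    intro z _ hz
    rw [hreach]
    split_ifs
    · exact one_ne_zero
    · exact hz
  have hrv' : σ₂.tab 12 0 (σ.var 12) ≠ 0 := by simp [hreach]
  refine ⟨⟨by rw [v2, v1 2 (by decide), h.size],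
    by rw [t2 9 (by decide) (by decide), t1 9 (by decide), h.adj], ?_, ?_⟩, .inr ⟨htest'.1 ht, ?_⟩⟩
  · intro p' hp' hr
    by_cases hpe : p' = σ.var 12
    · rw [hpe]
      exact (h.frees _ hp hrp).exchange hp hv hq ha hpv hmono (hmono _ hp hrp) hrv' hrow
    · rw [hrows p' hpe]
      rw [hreach, if_neg hpe] at hr
      exact (h.frees p' hp' hr).mono hmono
  · exact fun p' hp' ha hm => hmono p' hp' (h.unmatched p' hp' ha hm)
  · refine Finset.card_lt_card (Finset.ssubset_iff_subset_ne.2 ⟨fun z hz => ?_, fun he => ?_⟩)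
    · have hz' := Finset.mem_filter.1 hz
      exact Finset.mem_filter.2 ⟨hz'.1, hmono z (Finset.mem_range.1 hz'.1) hz'.2⟩
    · have : σ.var 12 ∈ (Finset.range N).filter fun p => (searchData σ).2 p ≠ 0 := by
        rw [he]
        exact Finset.mem_filter.2 ⟨Finset.mem_range.2 hv, hrv'⟩
      exact (Finset.mem_filter.1 this).2 hrv

/-- `progress_loop` is applied once for each of the three inner loops, quantifying one more index of
`CannotExpand` each time; `progress_iterate` handles the outer repetition. -/
theorem expandLoop_spec (h : Search N A act mu σ) :
    let σ' := (Stmt.loop 14 2 (.loop 10 2 (.loop 11 2 (.loop 12 2 expandStmt)))).denote σ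
    Search N A act mu σ' ∧ ∀ p < N, ∀ q < N, ∀ v < N, σ'.tab 12 0 p ≠ 0 → A p q ≠ 0 →
      σ'.tab 11 p v = q + 1 → σ'.tab 12 0 v ≠ 0 := by
  have l1 : ∀ σ, Search N A act mu σ ∧ σ.var 10 < N ∧ σ.var 11 < N →
      (Search N A act mu ((Stmt.loop 12 2 expandStmt).denote σ)) ∧
      ((searchData ((Stmt.loop 12 2 expandStmt).denote σ) = searchData σ ∧
        ∀ v < N, CannotExpand A (σ.var 10) (σ.var 11) v (searchData σ)) ∨
      (¬ (∀ v < N, CannotExpand A (σ.var 10) (σ.var 11) v (searchData σ)) ∧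
        reachSize N (searchData σ) <
          reachSize N (searchData ((Stmt.loop 12 2 expandStmt).denote σ)))) := by
    rintro σ ⟨h, hp, hq⟩
    have := progress_loop (p := expandStmt) (x := 12) (b := 2) (N := N)
      (I := fun τ => Search N A act mu τ ∧ τ.var 10 = σ.var 10 ∧ τ.var 11 = σ.var 11)
      (D := searchData) (Fail := fun v D => CannotExpand A (σ.var 10) (σ.var 11) v D)
      (m := reachSize N) (fun τ k hI => ⟨hI.1.setVar (by decide) k, by simpa using hI.2⟩)
      (fun _ _ => rfl) (fun τ hI => hI.1.size) (fun τ hI hv => ?_) σ ⟨h, rfl, rfl⟩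
    · exact ⟨this.1.1, this.2⟩
    · obtain ⟨hI, h10, h11⟩ := hI
      have := expandStmt_spec hI (by omega) (by omega) hv
      rw [h10, h11] at this
      exact ⟨⟨this.1, (expandStmt.denote_var (by decide) τ).trans h10,
        (expandStmt.denote_var (by decide) τ).trans h11⟩, this.2⟩
  have l2 : ∀ σ, Search N A act mu σ ∧ σ.var 10 < N →
      (Search N A act mu ((Stmt.loop 11 2 (.loop 12 2 expandStmt)).denote σ)) ∧
      ((searchData ((Stmt.loop 11 2 (.loop 12 2 expandStmt)).denote σ) = searchData σ ∧
        ∀ q < N, ∀ v < N, CannotExpand A (σ.var 10) q v (searchData σ)) ∨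
      (¬ (∀ q < N, ∀ v < N, CannotExpand A (σ.var 10) q v (searchData σ)) ∧
        reachSize N (searchData σ) <
          reachSize N (searchData ((Stmt.loop 11 2 (.loop 12 2 expandStmt)).denote σ)))) := by
    rintro σ ⟨h, hp⟩
    have := progress_loop (p := .loop 12 2 expandStmt) (x := 11) (b := 2) (N := N)
      (I := fun τ => Search N A act mu τ ∧ τ.var 10 = σ.var 10)
      (D := searchData) (Fail := fun q D => ∀ v < N, CannotExpand A (σ.var 10) q v D)
      (m := reachSize N) (fun τ k hI => ⟨hI.1.setVar (by decide) k, by simpa using hI.2⟩)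
      (fun _ _ => rfl) (fun τ hI => hI.1.size) (fun τ hI hv => ?_) σ ⟨h, rfl⟩
    · exact ⟨this.1.1, this.2⟩
    · obtain ⟨hI, h10⟩ := hI
      have := l1 τ ⟨hI, by omega, hv⟩
      rw [h10] at this
      exact ⟨⟨this.1, (Stmt.denote_var _ (by decide) τ).trans h10⟩, this.2⟩
  have l3 : ∀ σ, Search N A act mu σ →
      (Search N A act mu ((Stmt.loop 10 2 (.loop 11 2 (.loop 12 2 expandStmt))).denote σ)) ∧
      ((searchData ((Stmt.loop 10 2 (.loop 11 2 (.loop 12 2 expandStmt))).denote σ) = searchData σ ∧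
        ∀ p < N, ∀ q < N, ∀ v < N, CannotExpand A p q v (searchData σ)) ∨
      (¬ (∀ p < N, ∀ q < N, ∀ v < N, CannotExpand A p q v (searchData σ)) ∧
        reachSize N (searchData σ) < reachSize N (searchData
          ((Stmt.loop 10 2 (.loop 11 2 (.loop 12 2 expandStmt))).denote σ)))) := by
    intro σ h
    exact progress_loop (p := .loop 11 2 (.loop 12 2 expandStmt)) (x := 10) (b := 2) (N := N)
      (I := fun τ => Search N A act mu τ)
      (D := searchData) (Fail := fun p D => ∀ q < N, ∀ v < N, CannotExpand A p q v D)
      (m := reachSize N) (fun τ k hI => hI.setVar (by decide) k)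
      (fun _ _ => rfl) (fun τ hI => hI.size) (fun τ hI hv => l2 τ ⟨hI, hv⟩) σ h
  intro σ'
  obtain ⟨h1, h2⟩ := progress_iterate (p := .loop 10 2 (.loop 11 2 (.loop 12 2 expandStmt)))
    (x := 14) (b := 2) (I := fun τ => Search N A act mu τ) (D := searchData)
    (Done := fun D => ∀ p < N, ∀ q < N, ∀ v < N, CannotExpand A p q v D) (m := reachSize N)
    (fun τ k hI => hI.setVar (by decide) k) (fun _ _ => rfl) l3 σ h
  refine ⟨h1, fun p hp q hq v hv hr ha hpv hrv => ?_⟩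
  rcases h2 with h2 | h2
  · exact h2 p hp q hq v hv ⟨hr, ha, hpv, hrv⟩
  -- If every round reached something new, all `N` numbers would be reached by now, against `hrv`.
  · rw [h.size] at h2
    have hlt : reachSize N (searchData σ') < N := by
      refine (Finset.card_lt_card (t := Finset.range N)
        (Finset.ssubset_iff_subset_ne.2 ⟨Finset.filter_subset _ _, fun he => ?_⟩)).trans_eq
          (Finset.card_range N)
      have : v ∈ (Finset.range N).filter fun p => (searchData σ').2 p ≠ 0 := by
        rw [he]
        exact Finset.mem_range.2 hv
      exact (Finset.mem_filter.1 this).2 hrv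
    exact absurd h2 (not_le.2 hlt)

/-- The matching is as it was if the flag is not set, and has been enlarged if it is set. -/
def Augmented (N : ℕ) (A : ℕ → ℕ → ℕ) (act : ℕ → Prop) (mu : ℕ → ℕ) (σ : Store) : Prop :=
  (σ.var 20 = 0 ∧ σ.tab 10 0 = mu) ∨
    (σ.var 20 = 1 ∧ IsMatching N A act (σ.tab 10 0) ∧
      matchingSize N mu < matchingSize N (σ.tab 10 0))

/-- The flag never decreases, so a final value `0` certifies that the test failed at every pass
because the number was hit. -/
theorem augmentStmt_spec (h : Search N A act mu σ) (hp : σ.var 10 < N) (hq : σ.var 11 < N)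
    (haug : Augmented N A act mu σ) :
    Augmented N A act mu (augmentStmt.denote σ) ∧ (augmentStmt.denote σ).var 20 ≥ σ.var 20 ∧
      ((augmentStmt.denote σ).var 20 = 0 → σ.tab 12 0 (σ.var 10) ≠ 0 → A (σ.var 10) (σ.var 11) ≠ 0 →
        Hit N (σ.tab 11 (σ.var 10)) (σ.var 11)) := by
  unfold augmentStmt
  set test : Exp := .and (.not (.var 20)) (.and (.cell 12 (.const 0) (.var 10))
      (.and (.cell 9 (.var 10) (.var 11))
      (.not (.sum 2 (.eq (.cell 11 (.var 10) (.bvar 0)) (.add (.var 11) (.const 1))))))) with htest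
  have htest' : test.Holds σ [] ↔ σ.var 20 = 0 ∧ σ.tab 12 0 (σ.var 10) ≠ 0 ∧
      A (σ.var 10) (σ.var 11) ≠ 0 ∧ ¬ Hit N (σ.tab 11 (σ.var 10)) (σ.var 11) := by
    simp [htest, h.adj, Hit, h.size]
  by_cases ht : test.Holds σ []
  swap
  · rw [Stmt.denote_ite_neg ht]
    refine ⟨haug, le_rfl, fun h20 hr ha => ?_⟩
    by_contra hno
    exact ht (htest'.2 ⟨h20, hr, ha, hno⟩)
  obtain ⟨h20, hr, ha, hno⟩ := htest'.1 ht
  rw [Stmt.denote_ite_pos ht]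
  set σ₁ := (Stmt.loop 13 2 (.write 10 (.const 0) (.var 13)
    (.cell 11 (.var 10) (.var 13)))).denote σ with hσ₁
  have hfill := Stmt.denote_fillRow (t := 10) (x := 13) (b := 2) (e := .const 0)
    (a := .cell 11 (.var 10) (.var 13)) (σ := σ) 0 (σ.tab 11 (σ.var 10))
    (fun τ hv' ht' hr k hk hx => ⟨rfl, by
      simp only [Exp.eval_cell, Exp.eval_var, hv' 10 (by decide), ht' 11 (by decide), hx]⟩)
  rw [← hσ₁, h.size] at hfill
  have v1 : ∀ y, y ≠ 13 → σ₁.var y = σ.var y := fun y hy =>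
    Stmt.denote_var _ (by simp [Stmt.modV, hy]) σ
  rw [Stmt.denote_seq, ← hσ₁]
  set σ₂ := (Stmt.seq (.write 10 (.const 0) (.var 10) (.add (.var 11) (.const 1)))
    (.assign 20 (.const 1))).denote σ₁ with hσ₂
  have e20 : σ₂.var 20 = 1 := by simp [hσ₂, Stmt.denote_seq, Stmt.denote_assign]
  have hrow : ∀ z < N, σ₂.tab 10 0 z =
      if z = σ.var 10 then σ.var 11 + 1 else σ.tab 11 (σ.var 10) z := by
    intro z hz
    simp only [hσ₂, Stmt.denote_seq, Stmt.denote_write, Stmt.denote_assign, Store.setTab_tab,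
      Exp.eval_var, Exp.eval_const, Store.setVar_tab, v1 10 (by decide), v1 11 (by decide),
      Exp.eval_add]
    simp [hfill, hz]
  refine ⟨.inr ⟨e20, (h.frees _ hp hr).augment hp hq ha hno hrow⟩, by omega, fun h0 => ?_⟩
  omega

theorem augmentLoop_spec (h : Search N A act mu σ) (h20 : σ.var 20 = 0) (hmu : σ.tab 10 0 = mu) :
    let σ' := (Stmt.loop 10 2 (.loop 11 2 augmentStmt)).denote σ
    Augmented N A act mu σ' ∧ (σ'.var 20 = 0 → ∀ p < N, ∀ q < N, σ.tab 12 0 p ≠ 0 → A p q ≠ 0 →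
      Hit N (σ.tab 11 p) q) := by
  -- Of the tables only `10` is written here, and `Search` does not refer to it, so the search data
  -- remain valid for the old matching `mu`.
  have keep : ∀ τ : Store, (∀ y, y ≠ 10 → y ≠ 11 → y ≠ 13 → y ≠ 20 → τ.var y = σ.var y) →
      (∀ t, t ≠ 10 → τ.tab t = σ.tab t) → Search N A act mu τ := by
    intro τ hv ht
    refine ⟨(hv 2 (by decide) (by decide) (by decide) (by decide)).trans h.size,
      (ht 9 (by decide)).trans h.adj, ?_, ?_⟩
    · rw [ht 11 (by decide), ht 12 (by decide)]
      exact h.frees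
    · rw [ht 12 (by decide)]
      exact h.unmatched
  have := Stmt.denote_loop (.loop 11 2 augmentStmt) 10 2 σ (fun k τ => Augmented N A act mu τ ∧
    (τ.var 20 = 0 → ∀ p < k, ∀ q < N, σ.tab 12 0 p ≠ 0 → A p q ≠ 0 →
      Hit N (σ.tab 11 p) q)) ⟨.inl ⟨h20, hmu⟩, by simp⟩ ?_
  · rwa [h.size] at this
  · rintro p hp τ hv ht ⟨h1, h2⟩
    rw [h.size] at hp
    have := Stmt.denote_loop augmentStmt 11 2 (τ.setVar 10 p) (fun k υ => Augmented N A act mu υ ∧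
      υ.var 20 ≥ τ.var 20 ∧ (υ.var 20 = 0 → ∀ q < k, σ.tab 12 0 p ≠ 0 → A p q ≠ 0 →
      Hit N (σ.tab 11 p) q)) ⟨h1, le_rfl, by simp⟩ ?_
    · obtain ⟨h3, h4, h5⟩ := this
      have hN : (τ.setVar 10 p).var 2 = N := (hv 2 (by decide)).trans h.size
      rw [hN] at h5
      refine ⟨h3, fun h0 p' hp' => ?_⟩
      rcases Nat.lt_succ_iff_lt_or_eq.1 hp' with hlt | rfl
      · exact h2 (by omega) p' hlt
      · exact fun q hq => h5 h0 q hq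
    · rintro q hq υ hv' ht' ⟨h3, h4, h5⟩
      have hN : (τ.setVar 10 p).var 2 = N := (hv 2 (by decide)).trans h.size
      rw [hN] at hq
      have e10 : (υ.setVar 11 q).var 10 = p := by
        rw [Store.setVar_var, if_neg (by decide), hv' 10 (by decide)]
        simp
      have e11 : (υ.setVar 11 q).var 11 = q := by simp
      have htab : ∀ t, t ≠ 10 → (υ.setVar 11 q).tab t = σ.tab t := fun t h' => by
        rw [Store.setVar_tab, ht' t (by simpa [augmentStmt, Stmt.modT] using h'),
          Store.setVar_tab, ht t (by simpa [augmentStmt, Stmt.modT] using h')]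
      have hS : Search N A act mu (υ.setVar 11 q) := keep _ (fun y a b c e => by
          rw [Store.setVar_var, if_neg b, hv' y (by simp [augmentStmt, Stmt.modV, b, c, e]),
            Store.setVar_var, if_neg a, hv y (by simp [augmentStmt, Stmt.modV, a, b, c, e])]) htab
      obtain ⟨g1, g2, g3⟩ := augmentStmt_spec hS (by omega) (by omega) h3
      rw [e10, e11, htab 12 (by decide), htab 11 (by decide)] at g3
      have g2' : (augmentStmt.denote (υ.setVar 11 q)).var 20 ≥ υ.var 20 := by simpa using g2
      refine ⟨g1, h4.trans g2', fun h0 q' hq' => ?_⟩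
      rcases Nat.lt_succ_iff_lt_or_eq.1 hq' with hlt | rfl
      · exact h5 (by omega) q' hlt
      · exact g3 h0

/-- If no reached number leads to an unmatched one, the closed reached set is a certificate by
`matchingCert_of_closed`; otherwise `Frees.augment` enlarges the matching. -/
theorem phaseStmt_spec (hN : σ.var 2 = N) (hA : σ.tab 9 = A)
    (hact : ∀ p < N, act p ↔ σ.tab 7 0 p ≠ 0) (hmu : IsMatching N A act (σ.tab 10 0)) :
    let σ' := phaseStmt.denote σ
    IsMatching N A act (σ'.tab 10 0) ∧
      ((σ'.var 20 = 0 ∧ MatchingCert N (fun p q => A p q ≠ 0) act (σ'.tab 10 0)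
          (fun p => σ'.tab 12 0 p ≠ 0)) ∨
        (σ'.var 20 = 1 ∧ matchingSize N (σ.tab 10 0) < matchingSize N (σ'.tab 10 0))) := by
  classical
  intro σ'
  set σ₁ := σ.setVar 20 0 with hσ₁
  set σ₂ := (Stmt.loop 13 2 (.write 12 (.const 0) (.var 13) (.bool (.and (.cell 7 (.const 0) (.var 13))
    (.not (.cell 10 (.const 0) (.var 13))))))).denote σ₁ with hσ₂
  set σ₃ := (Stmt.loop 10 2 (.loop 11 2 (.write 11 (.var 10) (.var 11)
    (.cell 10 (.const 0) (.var 11))))).denote σ₂ with hσ₃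
  set σ₄ := (Stmt.loop 14 2 (.loop 10 2 (.loop 11 2 (.loop 12 2 expandStmt)))).denote σ₃ with hσ₄
  have hσ' : σ' = (Stmt.loop 10 2 (.loop 11 2 augmentStmt)).denote σ₄ := rfl
  have v1 : ∀ y, y ≠ 20 → σ₁.var y = σ.var y := fun y hy => by simp [hσ₁, hy]
  have v2 : ∀ y, y ≠ 13 → σ₂.var y = σ₁.var y := fun y hy =>
    Stmt.denote_var _ (by simp [Stmt.modV, hy]) σ₁
  have t2 : ∀ t, t ≠ 12 → σ₂.tab t = σ.tab t := fun t ht =>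
    Stmt.denote_tab _ (by simp [Stmt.modT, ht]) σ₁
  have v3 : ∀ y, y ≠ 10 → y ≠ 11 → σ₃.var y = σ₂.var y := fun y hy hy' =>
    Stmt.denote_var _ (by simp [Stmt.modV, hy, hy']) σ₂
  have t3 : ∀ t, t ≠ 11 → σ₃.tab t = σ₂.tab t := fun t ht =>
    Stmt.denote_tab _ (by simp [Stmt.modT, ht]) σ₂
  have f2 := Stmt.denote_fillRow (t := 12) (x := 13) (b := 2) (e := .const 0)
    (a := .bool (.and (.cell 7 (.const 0) (.var 13)) (.not (.cell 10 (.const 0) (.var 13)))))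
    (σ := σ₁) 0 (fun p => if σ.tab 7 0 p ≠ 0 ∧ σ.tab 10 0 p = 0 then 1 else 0)
    (fun τ hv ht hr k hk hx => ⟨rfl, by
      simp [hx, ht 7 (by decide), ht 10 (by decide), hσ₁]⟩)
  rw [← hσ₂, v1 2 (by decide), hN] at f2
  have f3 := Stmt.denote_fill (t := 11) (x := 10) (y := 11) (b := 2) (c := 2)
    (a := .cell 10 (.const 0) (.var 11)) (σ := σ₂) (by decide) (by decide)
    (fun _ j => σ.tab 10 0 j)
    (fun τ hv ht hi hj => by simp [ht 10 (by decide), t2 10 (by decide)])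
  rw [← hσ₃, v2 2 (by decide), v1 2 (by decide), hN] at f3
  have hr3 : ∀ p < N, (σ₃.tab 12 0 p ≠ 0 ↔ act p ∧ σ.tab 10 0 p = 0) := by
    intro p hp
    rw [t3 12 (by decide), f2, if_pos ⟨rfl, hp⟩, hact p hp]
    simp
  -- The search starts from the active unmatched numbers, which the current matching leaves free;
  -- every row is a copy of it.
  have hS3 : Search N A act (σ.tab 10 0) σ₃ := by
    refine ⟨?_, ?_, ?_, ?_⟩
    · rw [v3 2 (by decide) (by decide), v2 2 (by decide), v1 2 (by decide), hN]
    · rw [t3 9 (by decide), t2 9 (by decide), hA]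
    · intro p hp hr
      have hrow : ∀ z < N, σ₃.tab 11 p z = σ.tab 10 0 z := fun z hz => by
        rw [f3, if_pos ⟨hp, hz⟩]
      obtain ⟨ha, h0⟩ := (hr3 p hp).1 hr
      refine ⟨hmu.congr hrow, by rw [hrow p hp, h0], ha, fun q => ?_, fun v hv _ => hrow v hv⟩
      exact exists_congr fun v => and_congr_right fun hv => by rw [hrow v hv]
    · exact fun p hp ha h0 => (hr3 p hp).2 ⟨ha, h0⟩
  obtain ⟨hS4, hclosed⟩ := expandLoop_spec hS3
  rw [← hσ₄] at hS4 hclosed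
  have v4 : σ₄.var 20 = 0 := by
    have : σ₄.var 20 = σ₃.var 20 := Stmt.denote_var _ (by decide) σ₃
    rw [this, v3 20 (by decide) (by decide), v2 20 (by decide)]
    simp [hσ₁]
  have t4 : σ₄.tab 10 = σ.tab 10 := by
    have : σ₄.tab 10 = σ₃.tab 10 := Stmt.denote_tab _ (by decide) σ₃
    rw [this, t3 10 (by decide), t2 10 (by decide)]
  obtain ⟨haug, hhit⟩ := augmentLoop_spec hS4 v4 (by rw [t4])
  rw [← hσ'] at haug hhit
  have t5 : σ'.tab 12 = σ₄.tab 12 := Stmt.denote_tab _ (by decide) σ₄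
  rcases haug with ⟨h0, he⟩ | ⟨h1, h2, h3⟩
  · rw [he]
    refine ⟨hmu, .inl ⟨h0, ?_⟩⟩
    rw [t5]
    exact matchingCert_of_closed hmu hS4.frees hS4.unmatched hclosed (hhit h0)
  · exact ⟨h2, .inr ⟨h1, h3⟩⟩

theorem matchStmt_spec (hN : σ.var 2 = N) (hA : σ.tab 9 = A)
    (hact : ∀ p < N, act p ↔ σ.tab 7 0 p ≠ 0) :
    let σ' := matchStmt.denote σ
    MatchingCert N (fun p q => A p q ≠ 0) act (σ'.tab 10 0) (fun p => σ'.tab 12 0 p ≠ 0) := by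
  intro σ'
  set σ₁ := (Stmt.loop 13 2 (.write 10 (.const 0) (.var 13) (.const 0))).denote σ with hσ₁
  set σ₂ := σ₁.setVar 20 1 with hσ₂
  set body : Stmt := .ite (.var 20) phaseStmt .skip with hbody
  set σ₃ := (Stmt.loop 15 2 body).denote σ₂ with hσ₃
  have hσ' : σ' = body.denote σ₃ := rfl
  have v1 : σ₁.var 2 = N := (Stmt.denote_var _ (by decide) σ).trans hN
  have t1 : ∀ t, t ≠ 10 → σ₁.tab t = σ.tab t := fun t ht =>
    Stmt.denote_tab _ (by simp [Stmt.modT, ht]) σ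
  have f1 := Stmt.denote_fillRow (t := 10) (x := 13) (b := 2) (e := .const 0) (a := .const 0)
    (σ := σ) 0 (fun _ => 0) (fun τ hv ht hr k hk hx => ⟨rfl, rfl⟩)
  rw [← hσ₁, hN] at f1
  -- While the flag is set, each phase has gained a pair. A matching has at most `N` pairs, so `N +
  -- 1` phases, one of them after the loop, must clear the flag.
  let Inv : ℕ → Store → Prop := fun k τ => IsMatching N A act (τ.tab 10 0) ∧
    ((τ.var 20 = 0 ∧ MatchingCert N (fun p q => A p q ≠ 0) act (τ.tab 10 0)
        (fun p => τ.tab 12 0 p ≠ 0)) ∨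
      (τ.var 20 = 1 ∧ k ≤ matchingSize N (τ.tab 10 0)))
  have step : ∀ k τ, τ.var 2 = N → τ.tab 9 = σ.tab 9 → τ.tab 7 = σ.tab 7 → Inv k τ →
      Inv (k + 1) (body.denote τ) := by
    rintro k τ e2 e9 e7 ⟨h1, h2⟩
    rcases h2 with ⟨h0, h2⟩ | ⟨h0, h2⟩
    · have : body.denote τ = τ := Stmt.denote_ite_neg (by simp [h0])
      rw [this]
      exact ⟨h1, .inl ⟨h0, h2⟩⟩
    · have : body.denote τ = phaseStmt.denote τ := Stmt.denote_ite_pos (by simp [h0])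
      rw [this]
      obtain ⟨h3, h4⟩ := phaseStmt_spec e2 (e9.trans hA) (by rw [e7]; exact hact) h1
      refine ⟨h3, h4.imp_right fun h4 => ⟨h4.1, ?_⟩⟩
      have := h4.2
      omega
  have h3 : Inv N σ₃ := by
    have := Stmt.denote_loop body 15 2 σ₂ Inv ⟨⟨?_, ?_⟩, .inr ⟨by simp [hσ₂], by simp⟩⟩ ?_
    · have e : σ₂.var 2 = N := v1
      rwa [e] at this
    · intro p hp q hq
      have : σ₂.tab 10 0 p = 0 := (f1 0 p).trans (if_pos ⟨rfl, hp⟩)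
      omega
    · intro p hp _ _ q hq
      have : σ₂.tab 10 0 p = 0 := (f1 0 p).trans (if_pos ⟨rfl, hp⟩)
      omega
    · rintro i - τ hv ht hI
      refine step i (τ.setVar 15 i) ?_ ?_ ?_ hI
      · exact (hv 2 (by decide)).trans v1
      · exact (ht 9 (by decide)).trans (t1 9 (by decide))
      · exact (ht 7 (by decide)).trans (t1 7 (by decide))
  have h4 := step N σ₃ ((Stmt.denote_var _ (by decide) σ₂).trans v1)
    ((Stmt.denote_tab _ (by decide) σ₂).trans (t1 9 (by decide)))
    ((Stmt.denote_tab _ (by decide) σ₂).trans (t1 7 (by decide))) h3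
  rw [← hσ'] at h4
  rcases h4.2 with ⟨-, h⟩ | ⟨-, h⟩
  · exact h
  · have := matchingSize_le N (σ'.tab 10 0)
    omega

end search

end RAM

namespace RAM

variable {n : ℕ}

/-! ## The two programs -/

/-- Computes the least robust matching into row `n * n`. -/
def baseStmt : Stmt :=
  .seq (.assign 4 (.var 2)) (.seq (.assign 5 (.const 0)) (.seq (.assign 6 (.var 0)) leastStmt))

/-- Computes the least robust matchings under all rank bounds. -/
def boundsStmt : Stmt :=
  .loop 16 2 (.seq (.assign 4 (.var 16)) (.seq (.assign 5 (Exp.divN 16))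
    (.seq (.assign 6 (Exp.modN 16)) leastStmt)))

/-- Computes which bounds require which positions. -/
def adjStmt : Stmt :=
  .loop 10 2 (.loop 11 2 (.write 9 (.var 10) (.var 11) (.bool (.and (.cell 7 (.const 0) (.var 10))
    (.and (.le (.cell 6 (.var 2) (Exp.divN 11)) (Exp.modN 11))
      (.sub (.cell 6 (.var 10) (Exp.divN 11)) (Exp.modN 11)))))))

/-- Computes the positions in the optimum matching. -/
def supStmt : Stmt :=
  .loop 17 0 (.write 8 (.const 0) (.var 17) (.sum 0 (.bool (.add
    (.sub (.cell 6 (.var 2) (.var 17)) (.bvar 0))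
    (.sum 2 (.and (.cell 12 (.const 0) (.bvar 0)) (.sub (.cell 6 (.bvar 0) (.var 17)) (.bvar 1))))))))

/-- Writes the matching with the given positions to table `2`. -/
def outStmt (t : ℕ) (r : Exp) : Stmt :=
  .loop 8 0 (.write 2 (.const 0) (.var 8) (.cell 0 (.var 8) (.cell t r (.var 8))))

/-- The program that finds a perfect robust matching. -/
def perfectStmt : Stmt :=
  .seq initStmt (.seq baseStmt (.seq (outStmt 6 (.var 2))
    (.assign 3 (.bool (.and (.cell 7 (.const 0) (.var 2))
      (.not (.sum 0 (.not (.cell 2 (.const 0) (.bvar 0))))))))))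

/-- The program that finds a robust matching of minimum egalitarian cost. -/
def egalStmt : Stmt :=
  .seq initStmt (.seq baseStmt (.seq boundsStmt (.seq adjStmt (.seq matchStmt (.seq supStmt
    (.seq (outStmt 8 (.const 0)) (.assign 3 (.bool (.cell 7 (.const 0) (.var 2))))))))))

theorem entry_posU {P : PrefProfile n} {d : ℕ} {M : Matching n} (h : P.Robust d M) (u : Fin n) :
    entry (P.prefU u) (P.posU M u) =
      match M u with
      | none => 0
      | some w => (w : ℕ) + 1 := by
  unfold entry
  cases hM : M u <;> simp [h.getElem?_posU, hM]

/-- Rank bound `n` is void, so the unrestricted least matching is an instance of the restricted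
computation. -/
theorem avoids_refuses (P : PrefProfile n) (M : Matching n) (w₀ : ℕ) :
    PrefProfile.Avoids M (refuses P w₀ n) := by
  rintro u w - ⟨-, h⟩
  have : (P.prefW w).rank u ≤ (P.prefW w).1.length := List.idxOf_le_length
  have := PrefList.length_le (P.prefW w)
  omega

theorem outStmt_spec {P : PrefProfile n} {d : ℕ} {σ : Store} (h : Base P d σ) {t : ℕ} (ht : t ≠ 2)
    {r : Exp} {i : ℕ} (hr : ∀ τ : Store, (∀ y, y ≠ 8 → τ.var y = σ.var y) → r.eval τ [] = i)
    {M : Matching n} (hM : P.Robust d M) (hpos : ∀ u : Fin n, σ.tab t i u = P.posU M u) (u : Fin n) :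
    ((outStmt t r).denote σ).tab 2 0 u =
      match M u with
      | none => 0
      | some w => (w : ℕ) + 1 := by
  rw [outStmt, Stmt.denote_fillRow 0 (fun u => σ.tab 0 u (σ.tab t i u)), h.size, if_pos ⟨rfl, u.2⟩,
    hpos, h.listU, entry_posU hM]
  intro τ hv ht' _ k _ hx
  refine ⟨rfl, ?_⟩
  simp [ht' 0 (by decide), ht' t ht, hr τ hv, hx]

theorem baseStmt_spec {P : PrefProfile n} {d : ℕ} {σ : Store} (h : Base P d σ) :
    LeastSpec P d (refuses P 0 n) ((baseStmt.denote σ).tab 6 (n * n))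
      ((baseStmt.denote σ).tab 7 0 (n * n)) := by
  set σ₁ := ((σ.setVar 4 (σ.var 2)).setVar 5 0).setVar 6 (σ.var 0) with hσ₁
  have he : baseStmt.denote σ = leastStmt.denote σ₁ := by
    simp [baseStmt, Stmt.denote_seq, Stmt.denote_assign, hσ₁]
  have hB : Base P d σ₁ := h.of_eq
    (fun x hx => by simp [hσ₁, show x ≠ 4 by omega, show x ≠ 5 by omega, show x ≠ 6 by omega])
    (fun t ht => rfl)
  have h4 : σ₁.var 4 = n * n := by simp [hσ₁, h.sq]
  have := (leastStmt_spec hB (F := refuses P 0 n) (by simp [hσ₁, h.size])).1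
  rwa [h4, ← he] at this

theorem boundsStmt_spec {P : PrefProfile n} {d : ℕ} {σ : Store} (h : Base P d σ) :
    let σ' := boundsStmt.denote σ
    (∀ p < n * n, LeastSpec P d (P.forb p) (σ'.tab 6 p) (σ'.tab 7 0 p)) ∧
      σ'.tab 6 (n * n) = σ.tab 6 (n * n) ∧ σ'.tab 7 0 (n * n) = σ.tab 7 0 (n * n) := by
  set body : Stmt := .seq (.assign 4 (.var 16)) (.seq (.assign 5 (Exp.divN 16))
    (.seq (.assign 6 (Exp.modN 16)) leastStmt)) with hbody
  have := Stmt.denote_loop body 16 2 σ (fun k τ =>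
    (∀ p < k, LeastSpec P d (P.forb p) (τ.tab 6 p) (τ.tab 7 0 p)) ∧
      τ.tab 6 (n * n) = σ.tab 6 (n * n) ∧ τ.tab 7 0 (n * n) = σ.tab 7 0 (n * n))
    ⟨by simp, rfl, rfl⟩ ?_
  · rwa [h.sq] at this
  · rintro p hp τ hv ht ⟨h1, h2, h3⟩
    rw [h.sq] at hp
    have hB : Base P d (τ.setVar 16 p) := h.of_eq
      (fun x hx => by
        rw [Store.setVar_var, if_neg (by omega)]
        apply hv
        simp [hbody, Stmt.modV, leastStmt, moveStmt]
        omega)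
      (fun t ht' => ht t (by simp [hbody, Stmt.modT, leastStmt, moveStmt]; omega))
    set σ₁ := (((τ.setVar 16 p).setVar 4 p).setVar 5 (p / n)).setVar 6 (p % n) with hσ₁
    have he : body.denote (τ.setVar 16 p) = leastStmt.denote σ₁ := by
      have h0 : τ.var 0 = n := by simpa using hB.size
      have d1 : (Exp.divN 16).eval ((τ.setVar 16 p).setVar 4 p) [] = p / n := by
        rw [Exp.eval_divN _ _ (by simpa [h0] using hp)]
        simp [h0]
      have d2 : (Exp.modN 16).eval (((τ.setVar 16 p).setVar 4 p).setVar 5 (p / n)) [] = p % n := by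
        rw [Exp.eval_modN _ _ (by simpa [h0] using hp)]
        simp [h0]
      simp [hbody, Stmt.denote_seq, Stmt.denote_assign, hσ₁, d1, d2]
    have hB₁ : Base P d σ₁ := hB.of_eq
      (fun x hx => by simp [hσ₁, show x ≠ 4 by omega, show x ≠ 5 by omega, show x ≠ 6 by omega])
      (fun t ht => rfl)
    have h4 : σ₁.var 4 = p := by simp [hσ₁]
    -- `P.forb p` unfolds to `refuses P (p / n) (p % n)`. Row `n * n` lies outside the range of `p`
    -- and keeps the unrestricted least matching.
    obtain ⟨h5, h6⟩ := leastStmt_spec hB₁ (F := P.forb p) (by simp [hσ₁]; rfl)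
    rw [h4, ← he] at h5 h6
    refine ⟨fun p' hp' => ?_, ?_, ?_⟩
    · by_cases hpe : p' = p
      · rw [hpe]
        exact h5
      · rw [(h6 p' hpe).1, (h6 p' hpe).2]
        exact h1 p' (by omega)
    · rw [(h6 (n * n) (by omega)).1]
      exact h2
    · rw [(h6 (n * n) (by omega)).2]
      exact h3

theorem adjStmt_spec {P : PrefProfile n} {d : ℕ} {σ : Store} (h : Base P d σ) (p q : ℕ)
    (hp : p < n * n) (hq : q < n * n) :
    (adjStmt.denote σ).tab 9 p q ≠ 0 ↔ σ.tab 7 0 p ≠ 0 ∧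
      σ.tab 6 (n * n) (q / n) ≤ q % n ∧ q % n < σ.tab 6 p (q / n) := by
  classical
  have := Stmt.denote_fill (t := 9) (x := 10) (y := 11) (b := 2) (c := 2)
    (a := .bool (.and (.cell 7 (.const 0) (.var 10))
    (.and (.le (.cell 6 (.var 2) (Exp.divN 11)) (Exp.modN 11))
      (.sub (.cell 6 (.var 10) (Exp.divN 11)) (Exp.modN 11))))) (σ := σ) (by decide) (by decide)
    (fun p q => if σ.tab 7 0 p ≠ 0 ∧
      σ.tab 6 (n * n) (q / n) ≤ q % n ∧ q % n < σ.tab 6 p (q / n) then 1 else 0)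
    (fun τ hv ht hi hj => by
      have h0 : τ.var 0 = n := (hv 0 (by decide) (by decide)).trans h.size
      have h2 : τ.var 2 = n * n := (hv 2 (by decide) (by decide)).trans h.sq
      rw [h.sq] at hj
      have d1 := Exp.eval_divN τ [] (x := 11) (by rwa [h0])
      have d2 := Exp.eval_modN τ [] (x := 11) (by rwa [h0])
      rw [h0] at d1 d2
      simp [d1, d2, h2, ht 7 (by decide), ht 6 (by decide)]) p q
  rw [h.sq, if_pos ⟨hp, hq⟩] at this
  unfold adjStmt
  rw [this]
  simp

/-- A maximum is computed by counting the `i < n` that lie below one of its members. -/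
theorem supStmt_spec {P : PrefProfile n} {d : ℕ} {σ : Store} (h : Base P d σ) {M : Matching n}
    (hM : ∀ (u : Fin n) (i : ℕ), i < P.posU M u ↔ i < σ.tab 6 (n * n) u ∨
      ∃ p < n * n, σ.tab 12 0 p ≠ 0 ∧ i < σ.tab 6 p u) (u : Fin n) :
    (supStmt.denote σ).tab 8 0 u = P.posU M u := by
  classical
  have := Stmt.denote_fillRow (t := 8) (x := 17) (b := 0) (e := .const 0)
    (a := .sum 0 (.bool (.add (.sub (.cell 6 (.var 2) (.var 17)) (.bvar 0))
      (.sum 2 (.and (.cell 12 (.const 0) (.bvar 0)) (.sub (.cell 6 (.bvar 0) (.var 17)) (.bvar 1)))))))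
    (σ := σ) 0 (fun u => ((Finset.range n).filter fun i => i < σ.tab 6 (n * n) u ∨
      ∃ p < n * n, σ.tab 12 0 p ≠ 0 ∧ i < σ.tab 6 p u).card)
    (fun τ hv ht _ k hk hx => ⟨rfl, by
      have h0 : τ.var 0 = n := (hv 0 (by decide)).trans h.size
      have h2 : τ.var 2 = n * n := (hv 2 (by decide)).trans h.sq
      simp only [Exp.eval_sum, Exp.eval_bool, Exp.holds_add, Exp.holds_sub, Exp.holds_sum,
        Exp.holds_and, Exp.holds_cell, Exp.eval_cell, Exp.eval_var, Exp.eval_const,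
        Exp.eval_bvar_zero, Exp.eval_bvar_one, h0, h2, hx, ht 6 (by decide), ht 12 (by decide)]
      rw [Finset.card_filter]⟩) 0 u
  rw [h.size, if_pos ⟨rfl, u.2⟩] at this
  refine this.trans ?_
  simp only [← hM]
  have he : (Finset.range n).filter (fun i => i < P.posU M u) = Finset.range (P.posU M u) := by
    ext i
    have := P.posU_le M u
    simp only [Finset.mem_filter, Finset.mem_range]
    omega
  rw [he, Finset.card_range]

theorem perfectStmt_spec (P : PrefProfile n) (d : ℕ) :
    let σ := perfectStmt.denote ((inputStore P d).setVar 2 (n * n))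
    (σ.var 3 = 1 ∧ ∃ M : Matching n, (P.Robust d M ∧ M.Perfect) ∧ ∀ u : Fin n, σ.tab 2 0 u =
      match M u with
      | none => 0
      | some w => (w : ℕ) + 1) ∨
    (σ.var 3 = 0 ∧ ¬ ∃ M : Matching n, P.Robust d M ∧ M.Perfect) := by
  intro σ
  set σ₁ := initStmt.denote ((inputStore P d).setVar 2 (n * n)) with hσ₁
  set σ₂ := baseStmt.denote σ₁ with hσ₂
  set σ₃ := (outStmt 6 (.var 2)).denote σ₂ with hσ₃
  have B1 : Base P d σ₁ := initStmt_spec P d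
  have B2 : Base P d σ₂ := B1.denote baseStmt rfl rfl
  have h0 : σ₃.var 0 = n := (Stmt.denote_var _ (by decide) σ₂).trans B2.size
  have h2 : σ₃.var 2 = n * n := (Stmt.denote_var _ (by decide) σ₂).trans B2.sq
  have h7 : σ₃.tab 7 = σ₂.tab 7 := (outStmt 6 (.var 2)).denote_tab (by simp [outStmt, Stmt.modT]) σ₂
  have htab : σ.tab 2 = σ₃.tab 2 := rfl
  have hvar : σ.var 3 = if σ₂.tab 7 0 (n * n) ≠ 0 ∧ ∀ u < n, σ₃.tab 2 0 u ≠ 0 then 1 else 0 := by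
    have : σ.var 3 = (Exp.bool (.and (.cell 7 (.const 0) (.var 2))
      (.not (.sum 0 (.not (.cell 2 (.const 0) (.bvar 0))))))).eval σ₃ [] := rfl
    rw [this, Exp.eval_bool]
    simp only [Exp.holds_and, Exp.holds_cell, Exp.holds_not, Exp.holds_sum, Exp.eval_var,
      Exp.eval_const, Exp.eval_bvar_zero, h0, h2, h7, not_exists, not_and, not_not]
  rw [hvar, htab]
  rcases baseStmt_spec B1 with ⟨hf, ⟨M, hM, -, -, hpos⟩, hleast⟩ | ⟨hf, hno⟩
  · have hout := outStmt_spec B2 (t := 6) (by decide) (r := .var 2) (i := n * n)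
      (fun τ hv => (hv 2 (by decide)).trans B2.sq) hM (fun u => (hpos u).symm)
    rw [← hσ₃] at hout
    by_cases hall : ∀ u : Fin n, ∃ w, w ∈ M u
    · left
      refine ⟨if_pos ⟨by simp [hσ₂, hf], fun u hu => ?_⟩, M, ⟨hM, hall, ?_⟩, hout⟩
      -- As both sides have `n` agents, a matching that covers `U` covers `W`.
      · choose g hg using hall
        have hinj : Function.Injective g := by
          intro u v huv
          have h1 := hg u
          rw [huv] at h1
          exact M.inj h1 (hg v)
        intro w
        obtain ⟨u, rfl⟩ := (Finite.injective_iff_surjective.1 hinj) w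
        exact ⟨u, M.mem_iff_mem.2 (hg u)⟩
      · obtain ⟨w, hw⟩ := hall ⟨u, hu⟩
        have := hout ⟨u, hu⟩
        rw [Option.mem_def.1 hw] at this
        simp only at this
        omega
    · right
      obtain ⟨u, hu⟩ := not_forall.1 hall
      constructor
      · refine if_neg fun hcon => hcon.2 u u.2 ?_
        rw [hout u]
        have : M u = none := by
          rw [Option.eq_none_iff_forall_not_mem]
          exact fun w hw => hu ⟨w, hw⟩
        rw [this]
      -- An agent unmatched in the least matching has the length of its list as position, which
      -- bounds its position in every robust matching from below; so it is unmatched in all of them.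
      · rintro ⟨M', hM', hperf⟩
        obtain ⟨w, hw⟩ := hperf.1 u
        have h1 := hleast M' hM' (avoids_refuses P M' 0) u
        have h2 := PrefList.rank_lt_length.2 (hM'.mutual hw).1
        rw [← hpos, PrefProfile.posU_of_unmatched fun w hw => hu ⟨w, hw⟩,
          PrefProfile.posU_of_mem hw] at h1
        omega
  · right
    refine ⟨if_neg fun hcon => hcon.1 hf, ?_⟩
    rintro ⟨M, hM, -⟩
    exact hno M hM (avoids_refuses P M 0)

/-- The tables produced by the successive programs are the data required by
`exists_isMinEgalRobust`. If the unrestricted least matching does not exist, there is no robust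
matching at all. -/
theorem egalStmt_spec (P : PrefProfile n) (d : ℕ) (σ : Store)
    (hσ : egalStmt.denote ((inputStore P d).setVar 2 (n * n)) = σ) :
    (σ.var 3 = 1 ∧ ∃ M : Matching n, P.IsMinEgalRobust d M ∧ ∀ u : Fin n, σ.tab 2 0 u =
      match M u with
      | none => 0
      | some w => (w : ℕ) + 1) ∨
    (σ.var 3 = 0 ∧ ¬ ∃ M : Matching n, P.IsMinEgalRobust d M) := by
  unfold egalStmt at hσ
  simp only [Stmt.denote_seq] at hσ
  have B1 : Base P d (initStmt.denote ((inputStore P d).setVar 2 (n * n))) := initStmt_spec P d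
  generalize initStmt.denote ((inputStore P d).setVar 2 (n * n)) = σ₁ at hσ B1
  generalize hσ₂ : baseStmt.denote σ₁ = σ₂ at hσ
  generalize hσ₃ : boundsStmt.denote σ₂ = σ₃ at hσ
  generalize hσ₄ : adjStmt.denote σ₃ = σ₄ at hσ
  generalize hσ₅ : matchStmt.denote σ₄ = σ₅ at hσ
  generalize hσ₆ : supStmt.denote σ₅ = σ₆ at hσ
  generalize hσ₇ : (outStmt 8 (.const 0)).denote σ₆ = σ₇ at hσ
  have B2 : Base P d σ₂ := hσ₂ ▸ B1.denote baseStmt rfl rfl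
  have B3 : Base P d σ₃ := hσ₃ ▸ B2.denote boundsStmt rfl rfl
  have B4 : Base P d σ₄ := hσ₄ ▸ B3.denote adjStmt rfl rfl
  have B5 : Base P d σ₅ := hσ₅ ▸ B4.denote matchStmt rfl rfl
  have B6 : Base P d σ₆ := hσ₆ ▸ B5.denote supStmt rfl rfl
  have e2 : σ₇.var 2 = n * n := by
    rw [← hσ₇, (outStmt 8 (.const 0)).denote_var (by decide), B6.sq]
  have t4 : ∀ t, t ≠ 9 → σ₄.tab t = σ₃.tab t := fun t ht => by
    rw [← hσ₄, adjStmt.denote_tab (by simp [adjStmt, Stmt.modT, ht])]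
  have m6 : σ₅.tab 6 = σ₄.tab 6 := by rw [← hσ₅, matchStmt.denote_tab (by decide)]
  have m7 : σ₇.tab 7 = σ₃.tab 7 := by
    rw [← hσ₇, (outStmt 8 (.const 0)).denote_tab (by decide), ← hσ₆, supStmt.denote_tab (by decide),
      ← hσ₅, matchStmt.denote_tab (by decide), t4 7 (by decide)]
  obtain ⟨hrows, hrow, hflag⟩ := boundsStmt_spec B2
  rw [hσ₃] at hrows hrow hflag
  have hvar : σ.var 3 = if σ₃.tab 7 0 (n * n) ≠ 0 then 1 else 0 := by
    rw [← hσ, Stmt.denote_assign, Exp.eval_bool]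
    simp [e2, m7]
  have htab : σ.tab 2 = σ₇.tab 2 := by rw [← hσ, Stmt.denote_assign, Store.setVar_tab]
  rw [hvar, htab]
  have hbase := baseStmt_spec B1
  rw [hσ₂, ← hrow, ← hflag] at hbase
  rcases hbase with ⟨hf, ⟨M₀, hM₀, -, -, hpos₀⟩, hleast⟩ | ⟨hf, hno⟩
  · left
    refine ⟨by simp [hf], ?_⟩
    have hcert := matchStmt_spec (σ := σ₄) (act := fun p => σ₄.tab 7 0 p ≠ 0) B4.sq rfl
      (fun _ _ => Iff.rfl)
    rw [hσ₅] at hcert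
    have key := PrefProfile.exists_isMinEgalRobust (P := P) (d := d)
      (x₀ := σ₃.tab 6 (n * n)) (X := σ₃.tab 6) ⟨M₀, hM₀, hpos₀⟩
      (fun M hM => hleast M hM (avoids_refuses P M 0)) ?_ ?_ ?_ hcert
    · obtain ⟨M, hM, hpos⟩ := key
      have hsup := supStmt_spec B5 (M := M) (by
        rw [m6, t4 6 (by decide)]
        exact hpos)
      rw [hσ₆] at hsup
      have hout := outStmt_spec B6 (t := 8) (by decide) (r := .const 0) (fun τ _ => rfl) hM.1 hsup
      rw [hσ₇] at hout
      exact ⟨M, hM, hout⟩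
    · intro p hp hact
      rw [t4 7 (by decide)] at hact
      rcases hrows p hp with ⟨-, ⟨M, hM, hav, -, hpos⟩, -⟩ | ⟨h0, -⟩
      · exact ⟨M, hM, hav, hpos⟩
      · exact absurd h0 hact
    · intro p hp M hM hav
      rcases hrows p hp with ⟨h1, -, hle⟩ | ⟨-, hno⟩
      · rw [t4 7 (by decide), h1]
        exact ⟨one_ne_zero, hle M hM hav⟩
      · exact absurd hav (hno M hM)
    · intro p hp q hq
      rw [t4 7 (by decide), ← hσ₄]
      exact adjStmt_spec B3 p q hp hq
  · right
    refine ⟨by simp [hf], ?_⟩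
    rintro ⟨M, hM, -⟩
    exact hno M hM (avoids_refuses P M 0)

end RAM

theorem mainTheorem2 :
    RAM.SolvableInPolyTime (fun P d M => P.Robust d M ∧ M.Perfect) ∧
    RAM.SolvableInPolyTime (fun P d M => P.IsMinEgalRobust d M) :=
  ⟨RAM.solvableInPolyTime_of_stmt RAM.perfectStmt rfl fun _ P d => RAM.perfectStmt_spec P d,
    RAM.solvableInPolyTime_of_stmt RAM.egalStmt rfl fun _ P d => RAM.egalStmt_spec P d _ rfl⟩
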